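/- Let $\hbar\in\mathbb C$ and $q=e^{\hbar}$ with $q^2\neq 1$, and write $q^x=e^{\hbar x}$. Let $U=U_q(H_1,H_2,X^\pm)$ be the Hopf algebra over $\mathbb C$ generated by $H_1,H_2,X^\pm$ (together with the exponentials $e^{zH_1+wH_2}$, $z,w\in\mathbb C$, which are group-like) with relations $$[H_1,H_2]=0,\quad [H_1,X^\pm]=\pm2X^\pm,\quad [H_2,X^\pm]=\mp2X^\pm,\quad [X^+,X^-]=\frac{K_1K_2-K_1^{-1}K_2^{-1}}{q-q^{-1}},\quad (X^\pm)^2=0,$$ where $K_1=q^{H_1/2}$, $K_2=e^{i\pi H_2/2}q^{H_2/2}$, and $$\Delta H_i=H_i\otimes1+1\otimes H_i,\quad \Delta X^+=X^+\otimes K_1+K_2^{-1}\otimes X^+,\quad \Delta X^-=X^-\otimes K_2+K_1^{-1}\otimes X^- .$$ The antipode is given by $S(H_i)=-H_i$, $S(X^+)=-qK_1^{-1}K_2X^+$, $S(X^-)=qK_1K_2^{-1}X^-$, and the counit by $\varepsilon(H_i)=\varepsilon(X^\pm)=0$. Let $g=e^{i\pi H_2/2}$. The superization of a Hopf algebra $H$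 with a group-like $g$, $g^2=1$, has the algebra and counit of $H$, the grading $ghg^{-1}=(-1)^{\deg h}h$, the coproduct $\underline\Delta h=\sum x_k g^{-\deg y_k}\otimes y_k$ if $\Delta h=\sum x_k\otimes y_k$, and the antipode $\underline S(h)=g^{\deg h}S(h)$. A quasitriangular structure $\mathcal R=\sum a_i\otimes b_i$ of $H$, in a completed tensor square, becomes $\underline{\mathcal R}=\mathcal R_g^{-1}\sum a_ig^{-\deg b_i}\otimes b_i$, where $\mathcal R_g=\mathcal R_g^{-1}=1\otimes1-2p\otimes p$ and $p=(1-g)/2$. Then: (1) There is a super-Hopf algebra $U_q\,gl(1|1)$ generated by even $C,N$ (with their exponentials $e^{cC+nN}$, even and group-like) and odd $\eta,\eta^+$, with $C$ central and $$[N,\eta]=-\eta,\quad [N,\eta^+]=\eta^+,\quad \{\eta,\eta^+\}=\frac{q^C-q^{-C}}{q-q^{-1}},\quad \eta^2=(\eta^+)^2=0,$$ $$\underline\Delta C=C\otimes1+1\otimes C,\quad \underline\Delta N=N\otimes1+1\otimes N,\quad \underline\Delta\eta=\eta\otimes q^{C-N}+q^{-N}\otimes\eta,\quad \underline\Delta\eta^+=\eta^+\otimes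 q^N+q^{-C+N}\otimes\eta^+ .$$ It has the super-quasitriangular structure $$\underline{\mathcal R}=q^{-(C\otimes N+N\otimes C)}\left(1\otimes1+(1-q^2)\,q^N\eta\otimes q^{-N}\eta^+\right),$$ and both structures descend to the quotient $U_q\,gl(1|1)/(e^{2\pi iN}-1)$. (2) The superization of $U/(g^2-1)$ with respect to $g$ is isomorphic, as a super-Hopf algebra, to $U_q\,gl(1|1)/(e^{2\pi iN}-1)$, through $C=(H_1+H_2)/2$, $N=H_2/2$, $\eta=X^+$, $\eta^+=X^-g$. (3) Let $\mathcal R=e^{-i\frac{\pi}{4}H_2\otimes H_2}\,q^{\frac14(H_1\otimes H_1-H_2\otimes H_2)}\left(1\otimes1+(1-q^2)K_2X^+\otimes K_2^{-1}X^-\right)$. Both $\mathcal R$ and $q^{-C\otimes C}\mathcal R$ are quasitriangular structures of $U/(g^2-1)$. Under the isomorphism of (2), the superization of $q^{-C\otimes C}\mathcal R$ is $\underline{\mathcal R}$, and the superization of $\mathcal R$ is $q^{C\otimes C}\,\underline{\mathcal R}$. The elements of completed (super) tensor powers, in particular $\mathcal R$ and $\underline{\mathcal R}$, are understood through their values at pairs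 and triples of (super-)commuting homomorphisms to complex Banach algebras that send the formal exponentials to actual ones. -/

import Mathlib

open scoped TensorProduct

set_option linter.unusedSimpArgs false

noncomputable section

/-! ### Super-Hopf algebras over `ℂ` -/

/-- The product of the super tensor product `A ⊗ A` of a superalgebra with parity automorphism `σ`:
on homogeneous elements `(a ⊗ b)(c ⊗ d) = (-1)^{|b||c|} ac ⊗ bd`. It is written through the ordinary
product of `A ⊗ A`, the parity of the second leg of `x` and the parity of the first leg of `y`. -/
def superMul {A : Type*} [Ring A] [Algebra ℂ A] (σ : A →ₐ[ℂ] A) (x y : A ⊗[ℂ] A) : A ⊗[ℂ] A :=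
  (1 / 2 : ℂ) • (x * y
    + x * Algebra.TensorProduct.map σ (AlgHom.id ℂ A) y
    + Algebra.TensorProduct.map (AlgHom.id ℂ A) σ x * y
    - Algebra.TensorProduct.map (AlgHom.id ℂ A) σ x *
        Algebra.TensorProduct.map σ (AlgHom.id ℂ A) y)

/-- A super-Hopf algebra structure on an algebra `A` over `ℂ`. The `ℤ/2`-grading is given by its
parity automorphism: even elements are those with `parity a = a`, odd ones those with
`parity a = -a`. All structure maps are even, and the coproduct is multiplicative for the super
tensor product. -/
structure SuperHopfAlgebra (A : Type*) [Ring A] [Algebra ℂ A] where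
  parity : A →ₐ[ℂ] A
  parity_parity : ∀ a, parity (parity a) = a
  comul : A →ₗ[ℂ] A ⊗[ℂ] A
  counit : A →ₗ[ℂ] ℂ
  antipode : A →ₗ[ℂ] A
  comul_parity : ∀ a, comul (parity a) = TensorProduct.map parity.toLinearMap parity.toLinearMap (comul a)
  counit_parity : ∀ a, counit (parity a) = counit a
  antipode_parity : ∀ a, antipode (parity a) = parity (antipode a)
  coassoc : ∀ a, TensorProduct.assoc ℂ A A A (comul.rTensor A (comul a)) = comul.lTensor A (comul a)
  rTensor_counit : ∀ a, counit.rTensor A (comul a) = 1 ⊗ₜ[ℂ] a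
  lTensor_counit : ∀ a, counit.lTensor A (comul a) = a ⊗ₜ[ℂ] 1
  counit_one : counit 1 = 1
  counit_mul : ∀ a b, counit (a * b) = counit a * counit b
  comul_one : comul 1 = 1
  comul_mul : ∀ a b, comul (a * b) = superMul parity (comul a) (comul b)
  mul_antipode_rTensor : ∀ a,
    LinearMap.mul' ℂ A (antipode.rTensor A (comul a)) = algebraMap ℂ A (counit a)
  mul_antipode_lTensor : ∀ a,
    LinearMap.mul' ℂ A (antipode.lTensor A (comul a)) = algebraMap ℂ A (counit a)

section General

variable {A : Type*} [Ring A] [Algebra ℂ A]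

theorem superMul_tmul (σ : A →ₐ[ℂ] A) (a b c d : A) :
    superMul σ (a ⊗ₜ b) (c ⊗ₜ d) = (1 / 2 : ℂ) • ((a * c) ⊗ₜ (b * d) + (a * σ c) ⊗ₜ (b * d)
      + (a * c) ⊗ₜ (σ b * d) - (a * σ c) ⊗ₜ[ℂ] (σ b * d)) := by
  simp [superMul]

theorem superMul_add_left (σ : A →ₐ[ℂ] A) (x x' y : A ⊗[ℂ] A) :
    superMul σ (x + x') y = superMul σ x y + superMul σ x' y := by
  simp only [superMul, add_mul, map_add, ← smul_add]; congr 1; abel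

theorem superMul_add_right (σ : A →ₐ[ℂ] A) (x y y' : A ⊗[ℂ] A) :
    superMul σ x (y + y') = superMul σ x y + superMul σ x y' := by
  simp only [superMul, mul_add, map_add, ← smul_add]; congr 1; abel

theorem superMul_zero_left (σ : A →ₐ[ℂ] A) (y : A ⊗[ℂ] A) : superMul σ 0 y = 0 := by
  simp [superMul]

theorem superMul_zero_right (σ : A →ₐ[ℂ] A) (x : A ⊗[ℂ] A) : superMul σ x 0 = 0 := by
  simp [superMul]

theorem superMul_even_left (σ : A →ₐ[ℂ] A) (a b c d : A) (hb : σ b = b) :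
    superMul σ (a ⊗ₜ b) (c ⊗ₜ d) = (a * c) ⊗ₜ (b * d) := by
  rw [superMul_tmul, hb]; module

theorem superMul_odd_left (σ : A →ₐ[ℂ] A) (a b c d : A) (hb : σ b = -b) :
    superMul σ (a ⊗ₜ b) (c ⊗ₜ d) = (a * σ c) ⊗ₜ (b * d) := by
  rw [superMul_tmul, hb]; simp only [neg_mul, TensorProduct.tmul_neg]; module

namespace SuperHopfAlgebra

variable (D : SuperHopfAlgebra A)

/-- The even part of an element. -/
def evenPart : A →ₗ[ℂ] A := (1 / 2 : ℂ) • (LinearMap.id + D.parity.toLinearMap)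

/-- The odd part of an element. -/
def oddPart : A →ₗ[ℂ] A := (1 / 2 : ℂ) • (LinearMap.id - D.parity.toLinearMap)

theorem evenPart_add_oddPart (a : A) : D.evenPart a + D.oddPart a = a := by
  simp only [evenPart, oddPart, LinearMap.smul_apply, LinearMap.add_apply, LinearMap.sub_apply,
    LinearMap.id_apply]
  module

theorem parity_evenPart (a : A) : D.parity (D.evenPart a) = D.evenPart a := by
  simp [evenPart, D.parity_parity, add_comm]

theorem parity_oddPart (a : A) : D.parity (D.oddPart a) = -D.oddPart a := by
  simp [oddPart, D.parity_parity, ← smul_neg]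

theorem homogeneous_induction {P : A → Prop} (h0 : ∀ a, D.parity a = a → P a)
    (h1 : ∀ a, D.parity a = -a → P a) (hadd : ∀ a b, P a → P b → P (a + b)) (a : A) : P a := by
  rw [← D.evenPart_add_oddPart a]
  exact hadd _ _ (h0 _ (D.parity_evenPart a)) (h1 _ (D.parity_oddPart a))

/-- Homomorphisms of super-Hopf algebras. -/
structure IsHom {A' : Type*} [Ring A'] [Algebra ℂ A'] (D : SuperHopfAlgebra A)
    (D' : SuperHopfAlgebra A') (f : A →ₐ[ℂ] A') : Prop where
  parity : ∀ a, f (D.parity a) = D'.parity (f a)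
  comul : ∀ a, TensorProduct.map f.toLinearMap f.toLinearMap (D.comul a) = D'.comul (f a)
  counit : ∀ a, D'.counit (f a) = D.counit a
  antipode : ∀ a, f (D.antipode a) = D'.antipode (f a)

/-! ### Elements of completed super tensor powers and super-quasitriangular structures -/

/-- Two algebra homomorphisms out of a superalgebra super-commute when
`x(a) y(b) = (-1)^{|a||b|} y(b) x(a)` on homogeneous elements. -/
structure SuperCommute {B : Type*} [Ring B] [Algebra ℂ B] (D : SuperHopfAlgebra A)
    (x y : A →ₐ[ℂ] B) : Prop where
  even_left : ∀ a b, D.parity a = a → x a * y b = y b * x a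
  even_right : ∀ a b, D.parity b = b → x a * y b = y b * x a
  odd_odd : ∀ a b, D.parity a = -a → D.parity b = -b → x a * y b = -(y b * x a)

variable {D} {B : Type*} [Ring B] [Algebra ℂ B] {x y z : A →ₐ[ℂ] B}

theorem SuperCommute.symm (h : D.SuperCommute x y) : D.SuperCommute y x where
  even_left a b ha := (h.even_right b a ha).symm
  even_right a b hb := (h.even_left b a hb).symm
  odd_odd a b ha hb := by rw [h.odd_odd b a hb ha, neg_neg]

theorem SuperCommute.odd_right (h : D.SuperCommute x y) (a b : A) (hb : D.parity b = -b) :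
    x a * y b = y b * x (D.parity a) := by
  induction a using D.homogeneous_induction with
  | h0 a ha => rw [ha, h.even_left a b ha]
  | h1 a ha => rw [ha, h.odd_odd a b ha hb, map_neg, mul_neg]
  | hadd a a' h1 h2 => simp only [map_add, add_mul, mul_add, h1, h2]

theorem SuperCommute.of_right (h0 : ∀ a b, D.parity b = b → x a * y b = y b * x a)
    (h1 : ∀ a b, D.parity b = -b → x a * y b = y b * x (D.parity a)) : D.SuperCommute x y where
  even_left a b ha := by
    induction b using D.homogeneous_induction with
    | h0 b hb => exact h0 a b hb
    | h1 b hb => rw [h1 a b hb, ha]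
    | hadd b b' h1 h2 => simp only [map_add, add_mul, mul_add, h1, h2]
  even_right := h0
  odd_odd a b ha hb := by rw [h1 a b hb, ha, map_neg, mul_neg]

theorem SuperCommute.comp {B' : Type*} [Ring B'] [Algebra ℂ B'] (h : D.SuperCommute x y)
    (f : B →ₐ[ℂ] B') : D.SuperCommute (f.comp x) (f.comp y) where
  even_left a b ha := by simp [← map_mul, h.even_left a b ha]
  even_right a b hb := by simp [← map_mul, h.even_right a b hb]
  odd_odd a b ha hb := by simp [← map_mul, ← map_neg, h.odd_odd a b ha hb]

theorem SuperCommute.comp_parity (h : D.SuperCommute x y) :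
    D.SuperCommute (x.comp D.parity) (y.comp D.parity) where
  even_left a b ha := h.even_left _ _ (by simp [ha])
  even_right a b hb := h.even_right _ _ (by simp [hb])
  odd_odd a b ha hb := h.odd_odd _ _ (by simp [ha]) (by simp [hb])

/-- The evaluation `a ⊗ b ↦ x(a) y(b)` of the super tensor square at a pair of homomorphisms. -/
def evalPair (x y : A →ₐ[ℂ] B) : A ⊗[ℂ] A →ₗ[ℂ] B :=
  LinearMap.mul' ℂ B ∘ₗ TensorProduct.map x.toLinearMap y.toLinearMap

@[simp] theorem evalPair_tmul (x y : A →ₐ[ℂ] B) (a b : A) : evalPair x y (a ⊗ₜ b) = x a * y b := by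
  simp [evalPair]

theorem evalPair_superMul (h : D.SuperCommute x y) (s t : A ⊗[ℂ] A) :
    evalPair x y (superMul D.parity s t) = evalPair x y s * evalPair x y t := by
  induction s with
  | zero => simp [superMul_zero_left]
  | add s s' hs hs' => simp [superMul_add_left, hs, hs', add_mul]
  | tmul a b =>
    induction t with
    | zero => simp [superMul_zero_right]
    | add t t' hs hs' => simp [superMul_add_right, hs, hs', mul_add]
    | tmul c d =>
      induction b using D.homogeneous_induction with
      | h0 b hb =>
        rw [superMul_even_left _ _ _ _ _ hb]
        simp only [evalPair_tmul, map_mul]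
        rw [mul_assoc, ← mul_assoc (x c), h.even_right c b hb]
        simp only [mul_assoc]
      | h1 b hb =>
        rw [superMul_odd_left _ _ _ _ _ hb]
        simp only [evalPair_tmul, map_mul]
        have := h.odd_right (D.parity c) b hb
        rw [D.parity_parity] at this
        rw [mul_assoc, ← mul_assoc (x (D.parity c)), this]
        simp only [mul_assoc]
      | hadd b b' h1 h2 =>
        rw [TensorProduct.tmul_add, superMul_add_left, map_add, h1, h2, map_add, add_mul]

/-- The convolution of two super-commuting homomorphisms: the composite of the coproduct with the
algebra homomorphism `a ⊗ b ↦ x(a) y(b)` on the super tensor square. -/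
def SuperCommute.conv (h : D.SuperCommute x y) : A →ₐ[ℂ] B :=
  AlgHom.ofLinearMap (evalPair x y ∘ₗ D.comul)
    (by simp [D.comul_one, Algebra.TensorProduct.one_def])
    (fun a b => by simp [D.comul_mul, evalPair_superMul h])

theorem SuperCommute.conv_apply (h : D.SuperCommute x y) (a : A) :
    h.conv a = evalPair x y (D.comul a) := rfl

theorem SuperCommute.conv_left (hxy : D.SuperCommute x y) (hxz : D.SuperCommute x z)
    (hyz : D.SuperCommute y z) : D.SuperCommute hxy.conv z := by
  refine .of_right (fun a b hb => ?_) (fun a b hb => ?_)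
  · rw [hxy.conv_apply]
    induction D.comul a with
    | zero => simp
    | add s t hs ht => simp [add_mul, mul_add, hs, ht]
    | tmul c d =>
      rw [evalPair_tmul, mul_assoc, hyz.even_right d b hb, ← mul_assoc, hxz.even_right c b hb,
        mul_assoc]
  · rw [hxy.conv_apply, hxy.conv_apply, D.comul_parity]
    induction D.comul a with
    | zero => simp
    | add s t hs ht => simp [add_mul, mul_add, hs, ht]
    | tmul c d =>
      rw [evalPair_tmul, mul_assoc, hyz.odd_right d b hb, ← mul_assoc, hxz.odd_right c b hb,
        mul_assoc]
      simp

theorem SuperCommute.conv_right (hxy : D.SuperCommute x y) (hxz : D.SuperCommute x z)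
    (hyz : D.SuperCommute y z) : D.SuperCommute x hyz.conv :=
  (hyz.conv_left hxy.symm hxz.symm).symm

/-- A class of algebra homomorphisms from `A` to complex Banach algebras. It is used to say that the
elements of `A` that stand for exponentials go to the exponentials of the Banach algebra. -/
abbrev PointClass (A : Type*) [Ring A] [Algebra ℂ A] :=
  ∀ (B : Type) [NormedRing B] [NormedAlgebra ℂ B] [CompleteSpace B], (A →ₐ[ℂ] B) → Prop

/-- A homomorphism from the super tensor square of `A` to an algebra `B` is the same as a
super-commuting pair of homomorphisms from `A` to `B`. An element `∑ aᵢ ⊗ bᵢ` of a completed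
super tensor square is given by its values `∑ x(aᵢ) y(bᵢ)` at the super-commuting pairs in
Banach algebras. -/
abbrev PairFamily (D : SuperHopfAlgebra A) :=
  ∀ (B : Type) [NormedRing B] [NormedAlgebra ℂ B] [CompleteSpace B] (x y : A →ₐ[ℂ] B),
    D.SuperCommute x y → B

/-- `R`, as an element of the completed super tensor square of `A` (completed with respect to the
class `P` of homomorphisms to Banach algebras), is a super-quasitriangular structure:
`R` is even and invertible, `R Δ(a) = Δ'(a) R` with `Δ'` the super-opposite coproduct,
`(Δ ⊗ id) R = R₁₃ R₂₃` and `(id ⊗ Δ) R = R₁₃ R₁₂`. Every identity is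
evaluated at the pairs and triples of super-commuting homomorphisms `x, y, z` of the class `P`. -/
structure IsUniversalR (D : SuperHopfAlgebra A) (P : PointClass A) (R : D.PairFamily) : Prop where
  natural : ∀ (B B' : Type) [NormedRing B] [NormedAlgebra ℂ B] [CompleteSpace B]
    [NormedRing B'] [NormedAlgebra ℂ B'] [CompleteSpace B'] (f : B →ₐ[ℂ] B') (x y : A →ₐ[ℂ] B)
    (h : D.SuperCommute x y), Continuous f → P B x → P B y →
    R B' (f.comp x) (f.comp y) (h.comp f) = f (R B x y h)
  even : ∀ (B : Type) [NormedRing B] [NormedAlgebra ℂ B] [CompleteSpace B] (x y : A →ₐ[ℂ] B)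
    (h : D.SuperCommute x y), P B x → P B y →
    R B (x.comp D.parity) (y.comp D.parity) h.comp_parity = R B x y h
  isUnit : ∀ (B : Type) [NormedRing B] [NormedAlgebra ℂ B] [CompleteSpace B] (x y : A →ₐ[ℂ] B)
    (h : D.SuperCommute x y), P B x → P B y → IsUnit (R B x y h)
  intertwine : ∀ (B : Type) [NormedRing B] [NormedAlgebra ℂ B] [CompleteSpace B]
    (x y : A →ₐ[ℂ] B) (h : D.SuperCommute x y), P B x → P B y → ∀ a,
    R B x y h * h.conv a = h.symm.conv a * R B x y h
  comul_left : ∀ (B : Type) [NormedRing B] [NormedAlgebra ℂ B] [CompleteSpace B]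
    (x y z : A →ₐ[ℂ] B) (hxy : D.SuperCommute x y) (hxz : D.SuperCommute x z)
    (hyz : D.SuperCommute y z), P B x → P B y → P B z →
    R B hxy.conv z (hxy.conv_left hxz hyz) = R B x z hxz * R B y z hyz
  comul_right : ∀ (B : Type) [NormedRing B] [NormedAlgebra ℂ B] [CompleteSpace B]
    (x y z : A →ₐ[ℂ] B) (hxy : D.SuperCommute x y) (hxz : D.SuperCommute x z)
    (hyz : D.SuperCommute y z), P B x → P B y → P B z →
    R B x hyz.conv (hxy.conv_right hxz hyz) = R B x z hxz * R B x y hxy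

/-- An ordinary Hopf algebra, regarded as a super-Hopf algebra in which everything is even.
For it `IsUniversalR` says that `R` is an ordinary quasitriangular structure. -/
def ofHopf (H : Type*) [Ring H] [HopfAlgebra ℂ H] : SuperHopfAlgebra H where
  parity := AlgHom.id ℂ H
  parity_parity _ := rfl
  comul := CoalgebraStruct.comul
  counit := CoalgebraStruct.counit
  antipode := HopfAlgebraStruct.antipode ℂ
  comul_parity a := by simp
  counit_parity _ := rfl
  antipode_parity _ := rfl
  coassoc a := Coalgebra.coassoc_apply a
  rTensor_counit a := Coalgebra.rTensor_counit_comul a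
  lTensor_counit a := Coalgebra.lTensor_counit_comul a
  counit_one := Bialgebra.counit_one
  counit_mul := Bialgebra.counit_mul
  comul_one := Bialgebra.comul_one
  comul_mul a b := by
    have h (x : H ⊗[ℂ] H) : Algebra.TensorProduct.map (AlgHom.id ℂ H) (AlgHom.id ℂ H) x = x := by
      simp
    rw [Bialgebra.comul_mul, superMul, h, h]; module
  mul_antipode_rTensor a := HopfAlgebra.mul_antipode_rTensor_comul_apply a
  mul_antipode_lTensor a := HopfAlgebra.mul_antipode_lTensor_comul_apply a

end SuperHopfAlgebra

/-! ### Superization of a Hopf algebra with a group-like involution -/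

namespace Superization

variable {H : Type*} [Ring H] [HopfAlgebra ℂ H] (g : H)

/-- The adjoint action `h ↦ g h g⁻¹` of an involution `g`. -/
def conj (hg2 : g * g = 1) : H →ₐ[ℂ] H :=
  AlgHom.ofLinearMap (LinearMap.mulRight ℂ g ∘ₗ LinearMap.mulLeft ℂ g) (by simp [hg2])
    (fun a b => by
      simp only [LinearMap.comp_apply, LinearMap.mulRight_apply, LinearMap.mulLeft_apply]
      rw [show g * a * g * (g * b * g) = g * a * (g * g) * b * g by simp only [mul_assoc], hg2]
      simp only [mul_assoc, mul_one])

theorem conj_apply (hg2 : g * g = 1) (a : H) : conj g hg2 a = g * a * g := rfl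

/-- The projection to degree `0`, that is, to the elements that commute with `g`. -/
def P0 (hg2 : g * g = 1) : H →ₗ[ℂ] H := (1 / 2 : ℂ) • (LinearMap.id + (conj g hg2).toLinearMap)

/-- The projection to degree `1`, that is, to the elements that anticommute with `g`. -/
def P1 (hg2 : g * g = 1) : H →ₗ[ℂ] H := (1 / 2 : ℂ) • (LinearMap.id - (conj g hg2).toLinearMap)

/-- The map `x ⊗ y ↦ x g^{-deg y} ⊗ y`; recall `g⁻¹ = g`. -/
def twistLeg (hg2 : g * g = 1) : H ⊗[ℂ] H →ₗ[ℂ] H ⊗[ℂ] H :=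
  TensorProduct.map LinearMap.id (P0 g hg2) +
    TensorProduct.map (LinearMap.mulRight ℂ g) (P1 g hg2)

section Lemmas

variable {g} (hg2 : g * g = 1)

theorem conj_conj (a : H) : conj g hg2 (conj g hg2 a) = a := by
  simp only [conj_apply]
  rw [show g * (g * a * g) * g = g * g * a * (g * g) by simp only [mul_assoc], hg2]
  simp

theorem conj_self : conj g hg2 g = g := by simp [conj_apply, hg2]

theorem P0_even {a : H} (ha : conj g hg2 a = a) : P0 g hg2 a = a := by
  simp only [P0, LinearMap.smul_apply, LinearMap.add_apply, LinearMap.id_apply,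
    AlgHom.toLinearMap_apply, ha]
  module

theorem P1_even {a : H} (ha : conj g hg2 a = a) : P1 g hg2 a = 0 := by
  simp [P1, ha]

theorem P0_odd {a : H} (ha : conj g hg2 a = -a) : P0 g hg2 a = 0 := by
  simp [P0, ha]

theorem P1_odd {a : H} (ha : conj g hg2 a = -a) : P1 g hg2 a = a := by
  simp only [P1, LinearMap.smul_apply, LinearMap.sub_apply, LinearMap.id_apply,
    AlgHom.toLinearMap_apply, ha]
  module

theorem conj_induction {P : H → Prop} (h0 : ∀ a, conj g hg2 a = a → P a)
    (h1 : ∀ a, conj g hg2 a = -a → P a) (hadd : ∀ a b, P a → P b → P (a + b)) (a : H) : P a := by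
  have h : P0 g hg2 a + P1 g hg2 a = a := by
    simp only [P0, P1, LinearMap.smul_apply, LinearMap.add_apply, LinearMap.sub_apply,
      LinearMap.id_apply]
    module
  rw [← h]
  refine hadd _ _ (h0 _ ?_) (h1 _ ?_)
  · simp [P0, conj_conj, add_comm]
  · simp [P1, conj_conj, ← smul_neg]

theorem mul_even {a : H} (ha : conj g hg2 a = a) : a * g = g * a := by
  conv_lhs => rw [← ha, conj_apply, mul_assoc, hg2, mul_one]

theorem mul_odd {a : H} (ha : conj g hg2 a = -a) : a * g = -(g * a) := by
  have h : g * a = -(a * g) := by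
    rw [← neg_mul, ← ha, conj_apply, mul_assoc, hg2, mul_one]
  rw [h, neg_neg]

theorem twistLeg_even (a : H) {b : H} (hb : conj g hg2 b = b) :
    twistLeg g hg2 (a ⊗ₜ b) = a ⊗ₜ b := by
  simp [twistLeg, P0_even hg2 hb, P1_even hg2 hb]

theorem twistLeg_odd (a : H) {b : H} (hb : conj g hg2 b = -b) :
    twistLeg g hg2 (a ⊗ₜ b) = (a * g) ⊗ₜ b := by
  simp [twistLeg, P0_odd hg2 hb, P1_odd hg2 hb]

theorem conj_mul_self_even {b : H} (hb : conj g hg2 b = b) : conj g hg2 (b * g) = b * g := by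
  rw [map_mul, conj_self, hb]

theorem conj_mul_self_odd {b : H} (hb : conj g hg2 b = -b) : conj g hg2 (b * g) = -(b * g) := by
  rw [map_mul, conj_self, hb, neg_mul]

theorem twistLeg_mul (s t : H ⊗[ℂ] H) :
    twistLeg g hg2 (s * t) = superMul (conj g hg2) (twistLeg g hg2 s) (twistLeg g hg2 t) := by
  induction s with
  | zero => simp [superMul_zero_left]
  | add s s' hs hs' => simp [superMul_add_left, hs, hs', add_mul]
  | tmul a b =>
    induction t with
    | zero => simp [superMul_zero_right]
    | add t t' hs hs' => simp [superMul_add_right, hs, hs', mul_add]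
    | tmul c d =>
      rw [Algebra.TensorProduct.tmul_mul_tmul]
      induction b using conj_induction hg2 with
      | hadd b b' h1 h2 =>
        rw [TensorProduct.tmul_add, add_mul, TensorProduct.tmul_add, map_add, h1, h2, map_add,
          superMul_add_left]
      | h0 b hb =>
        induction d using conj_induction hg2 with
        | hadd d d' h1 h2 =>
          rw [TensorProduct.tmul_add, mul_add, TensorProduct.tmul_add, map_add, h1, h2, map_add,
            superMul_add_right]
        | h0 d hd =>
          rw [twistLeg_even hg2 a hb, twistLeg_even hg2 c hd, superMul_even_left _ _ _ _ _ hb,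
            twistLeg_even hg2 _ (by rw [map_mul, hb, hd])]
        | h1 d hd =>
          rw [twistLeg_even hg2 a hb, twistLeg_odd hg2 c hd, superMul_even_left _ _ _ _ _ hb,
            twistLeg_odd hg2 _ (by rw [map_mul, hb, hd, mul_neg]), mul_assoc]
      | h1 b hb =>
        have key (c : H) : a * c * g = a * g * conj g hg2 c := by
          rw [conj_apply, show a * g * (g * c * g) = a * (g * g) * (c * g) by
            simp only [mul_assoc], hg2, mul_one, mul_assoc]
        induction d using conj_induction hg2 with
        | hadd d d' h1 h2 =>
          rw [TensorProduct.tmul_add, mul_add, TensorProduct.tmul_add, map_add, h1, h2, map_add,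
            superMul_add_right]
        | h0 d hd =>
          rw [twistLeg_odd hg2 a hb, twistLeg_even hg2 c hd, superMul_odd_left _ _ _ _ _ hb,
            twistLeg_odd hg2 _ (by rw [map_mul, hb, hd, neg_mul]), key]
        | h1 d hd =>
          rw [twistLeg_odd hg2 a hb, twistLeg_odd hg2 c hd, superMul_odd_left _ _ _ _ _ hb,
            twistLeg_even hg2 _ (by rw [map_mul, hb, hd, neg_mul_neg]), ← key,
            show a * (c * g) * g = a * c * (g * g) by simp only [mul_assoc], hg2, mul_one]

theorem map_conj_twistLeg (s : H ⊗[ℂ] H) :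
    twistLeg g hg2 (TensorProduct.map (conj g hg2).toLinearMap (conj g hg2).toLinearMap s) =
      TensorProduct.map (conj g hg2).toLinearMap (conj g hg2).toLinearMap (twistLeg g hg2 s) := by
  induction s with
  | zero => simp
  | add s s' hs hs' => simp only [map_add, hs, hs']
  | tmul a b =>
    induction b using conj_induction hg2 with
    | hadd b b' h1 h2 => simp only [TensorProduct.tmul_add, map_add, h1, h2]
    | h0 b hb => simp [twistLeg_even hg2 _ hb, hb]
    | h1 b hb => simp [twistLeg_odd hg2 _ hb, hb, conj_self, TensorProduct.tmul_neg]

theorem twistLeg_mul_diag (s : H ⊗[ℂ] H) :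
    twistLeg g hg2 (s * (g ⊗ₜ g)) = twistLeg g hg2 s * (g ⊗ₜ g) := by
  induction s with
  | zero => simp
  | add s s' hs hs' => simp only [map_add, add_mul, hs, hs']
  | tmul a b =>
    induction b using conj_induction hg2 with
    | hadd b b' h1 h2 => simp only [TensorProduct.tmul_add, add_mul, map_add, h1, h2]
    | h0 b hb => simp [twistLeg_even hg2 _ hb, twistLeg_even hg2 _ (conj_mul_self_even hg2 hb)]
    | h1 b hb => simp [twistLeg_odd hg2 _ hb, twistLeg_odd hg2 _ (conj_mul_self_odd hg2 hb)]

theorem comul_conj (hg : IsGroupLikeElem ℂ g) (a : H) :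
    (CoalgebraStruct.comul (conj g hg2 a) : H ⊗[ℂ] H) =
      TensorProduct.map (conj g hg2).toLinearMap (conj g hg2).toLinearMap
        (CoalgebraStruct.comul a) := by
  rw [conj_apply, Bialgebra.comul_mul, Bialgebra.comul_mul, hg.comul_eq_tmul_self]
  induction (CoalgebraStruct.comul a : H ⊗[ℂ] H) with
  | zero => simp
  | add s t hs ht => simp only [mul_add, add_mul, map_add, hs, ht]
  | tmul a b => simp [conj_apply]

theorem counit_conj (hg : IsGroupLikeElem ℂ g) (a : H) :
    (CoalgebraStruct.counit (conj g hg2 a) : ℂ) = CoalgebraStruct.counit a := by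
  rw [conj_apply, Bialgebra.counit_mul, Bialgebra.counit_mul, hg.counit_eq_one]
  simp

theorem antipode_self (hg2 : g * g = 1) (hg : IsGroupLikeElem ℂ g) : HopfAlgebraStruct.antipode ℂ g = g := by
  have h := HopfAlgebra.mul_antipode_rTensor_comul_apply (R := ℂ) g
  rw [hg.comul_eq_tmul_self, hg.counit_eq_one] at h
  simp only [LinearMap.rTensor_tmul, LinearMap.mul'_apply, map_one] at h
  calc _ = HopfAlgebraStruct.antipode ℂ g * g * g := by rw [mul_assoc, hg2, mul_one]
    _ = g := by rw [h, one_mul]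

theorem antipode_conj (hg : IsGroupLikeElem ℂ g) (a : H) :
    HopfAlgebraStruct.antipode ℂ (conj g hg2 a) = conj g hg2 (HopfAlgebraStruct.antipode ℂ a) := by
  rw [conj_apply, conj_apply, HopfAlgebra.antipode_mul_antidistrib,
    HopfAlgebra.antipode_mul_antidistrib, antipode_self hg2 hg, mul_assoc]

/-- `a ⊗ b ⊗ c ↦ a g^{-deg b - deg c} ⊗ b g^{-deg c} ⊗ c`. -/
def twistLeg₃ : H ⊗[ℂ] (H ⊗[ℂ] H) →ₗ[ℂ] H ⊗[ℂ] (H ⊗[ℂ] H) :=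
  (twistLeg g hg2).lTensor H ∘ₗ ((1 / 2 : ℂ) •
    (TensorProduct.map LinearMap.id (LinearMap.id +
        TensorProduct.map (conj g hg2).toLinearMap (conj g hg2).toLinearMap) +
      TensorProduct.map (LinearMap.mulRight ℂ g) (LinearMap.id -
        TensorProduct.map (conj g hg2).toLinearMap (conj g hg2).toLinearMap)))

theorem twistLeg₃_even (a : H) {s : H ⊗[ℂ] H}
    (hs : TensorProduct.map (conj g hg2).toLinearMap (conj g hg2).toLinearMap s = s) :
    twistLeg₃ hg2 (a ⊗ₜ s) = a ⊗ₜ twistLeg g hg2 s := by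
  simp only [twistLeg₃, LinearMap.comp_apply, LinearMap.smul_apply, LinearMap.add_apply,
    TensorProduct.map_tmul, LinearMap.sub_apply, LinearMap.id_apply, hs, sub_self,
    TensorProduct.tmul_zero, add_zero, TensorProduct.tmul_add, map_smul, map_add,
    LinearMap.lTensor_tmul]
  module

theorem twistLeg₃_odd (a : H) {s : H ⊗[ℂ] H}
    (hs : TensorProduct.map (conj g hg2).toLinearMap (conj g hg2).toLinearMap s = -s) :
    twistLeg₃ hg2 (a ⊗ₜ s) = (a * g) ⊗ₜ twistLeg g hg2 s := by
  simp only [twistLeg₃, LinearMap.comp_apply, LinearMap.smul_apply, LinearMap.add_apply,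
    TensorProduct.map_tmul, LinearMap.sub_apply, LinearMap.id_apply, hs, add_neg_cancel,
    TensorProduct.tmul_zero, zero_add, TensorProduct.tmul_add, map_smul, map_add,
    LinearMap.lTensor_tmul, sub_neg_eq_add, LinearMap.mulRight_apply]
  module

theorem coassoc_left (hg : IsGroupLikeElem ℂ g) (t : H ⊗[ℂ] H) :
    TensorProduct.assoc ℂ H H H ((twistLeg g hg2 ∘ₗ CoalgebraStruct.comul).rTensor H
      (twistLeg g hg2 t)) =
    twistLeg₃ hg2 (TensorProduct.assoc ℂ H H H
      ((CoalgebraStruct.comul (R := ℂ) (A := H)).rTensor H t)) := by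
  induction t with
  | zero => simp
  | add s t hs ht => simp only [map_add, hs, ht]
  | tmul a b =>
    induction b using conj_induction hg2 with
    | hadd b b' h1 h2 => simp only [TensorProduct.tmul_add, map_add, h1, h2]
    | h0 b hb =>
      simp only [twistLeg_even hg2 a hb, LinearMap.rTensor_tmul, LinearMap.comp_apply]
      induction (CoalgebraStruct.comul a : H ⊗[ℂ] H) with
      | zero => simp
      | add s t hs ht => simp only [map_add, TensorProduct.add_tmul, hs, ht]
      | tmul c d =>
        induction d using conj_induction hg2 with
        | hadd b b' h1 h2 => simp only [TensorProduct.tmul_add, TensorProduct.add_tmul, map_add, h1, h2]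
        | h0 d hd =>
          rw [twistLeg_even hg2 c hd, TensorProduct.assoc_tmul, twistLeg₃_even hg2 _ (by simp [hb, hd]),
            twistLeg_even hg2 d hb]
        | h1 d hd =>
          rw [twistLeg_odd hg2 c hd, TensorProduct.assoc_tmul, TensorProduct.assoc_tmul,
            twistLeg₃_odd hg2 _ (by simp [hb, hd, TensorProduct.neg_tmul]), twistLeg_even hg2 d hb]
    | h1 b hb =>
      simp only [twistLeg_odd hg2 a hb, LinearMap.rTensor_tmul, LinearMap.comp_apply,
        Bialgebra.comul_mul, hg.comul_eq_tmul_self, twistLeg_mul_diag]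
      induction (CoalgebraStruct.comul a : H ⊗[ℂ] H) with
      | zero => simp
      | add s t hs ht => simp only [map_add, add_mul, TensorProduct.add_tmul, hs, ht]
      | tmul c d =>
        induction d using conj_induction hg2 with
        | hadd b b' h1 h2 =>
          simp only [TensorProduct.tmul_add, TensorProduct.add_tmul, map_add, add_mul, h1, h2]
        | h0 d hd =>
          rw [twistLeg_even hg2 c hd, Algebra.TensorProduct.tmul_mul_tmul,
            TensorProduct.assoc_tmul, TensorProduct.assoc_tmul,
            twistLeg₃_odd hg2 _ (by simp [hb, hd, TensorProduct.tmul_neg]), twistLeg_odd hg2 d hb]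
        | h1 d hd =>
          rw [twistLeg_odd hg2 c hd, Algebra.TensorProduct.tmul_mul_tmul,
            TensorProduct.assoc_tmul, TensorProduct.assoc_tmul,
            twistLeg₃_even hg2 _ (by simp [hb, hd, TensorProduct.neg_tmul, TensorProduct.tmul_neg]),
            twistLeg_odd hg2 d hb, mul_assoc c g g, hg2, mul_one]

theorem coassoc_right (hg : IsGroupLikeElem ℂ g) (t : H ⊗[ℂ] H) :
    (twistLeg g hg2 ∘ₗ CoalgebraStruct.comul).lTensor H (twistLeg g hg2 t) =
    twistLeg₃ hg2 ((CoalgebraStruct.comul (R := ℂ) (A := H)).lTensor H t) := by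
  induction t with
  | zero => simp
  | add s t hs ht => simp only [map_add, hs, ht]
  | tmul a b =>
    induction b using conj_induction hg2 with
    | hadd b b' h1 h2 => simp only [TensorProduct.tmul_add, map_add, h1, h2]
    | h0 b hb =>
      rw [twistLeg_even hg2 a hb, LinearMap.lTensor_tmul, LinearMap.lTensor_tmul,
        twistLeg₃_even hg2 _ (by rw [← comul_conj hg2 hg, hb])]
      rfl
    | h1 b hb =>
      rw [twistLeg_odd hg2 a hb, LinearMap.lTensor_tmul, LinearMap.lTensor_tmul,
        twistLeg₃_odd hg2 _ (by rw [← comul_conj hg2 hg, hb, map_neg])]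
      rfl

/-- `h ↦ g^{deg h} S(h)`. -/
def antipode : H →ₗ[ℂ] H :=
  HopfAlgebraStruct.antipode ℂ ∘ₗ P0 g hg2 +
    LinearMap.mulLeft ℂ g ∘ₗ HopfAlgebraStruct.antipode ℂ ∘ₗ P1 g hg2

theorem antipode_even {a : H} (ha : conj g hg2 a = a) :
    antipode hg2 a = HopfAlgebraStruct.antipode ℂ a := by
  simp [antipode, P0_even hg2 ha, P1_even hg2 ha]

theorem antipode_odd {a : H} (ha : conj g hg2 a = -a) :
    antipode hg2 a = g * HopfAlgebraStruct.antipode ℂ a := by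
  simp [antipode, P0_odd hg2 ha, P1_odd hg2 ha]

theorem antipode_left (hg : IsGroupLikeElem ℂ g) (t : H ⊗[ℂ] H) :
    LinearMap.mul' ℂ H ((antipode hg2).rTensor H (twistLeg g hg2 t)) =
      (1 / 2 : ℂ) • (LinearMap.mul' ℂ H ((HopfAlgebraStruct.antipode ℂ).rTensor H
          (t + TensorProduct.map (conj g hg2).toLinearMap (conj g hg2).toLinearMap t)) +
        g * LinearMap.mul' ℂ H ((HopfAlgebraStruct.antipode ℂ).rTensor H
          (t - TensorProduct.map (conj g hg2).toLinearMap (conj g hg2).toLinearMap t))) := by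
  have hS (a : H) : HopfAlgebraStruct.antipode ℂ (a * g) = g * HopfAlgebraStruct.antipode ℂ a := by
    rw [HopfAlgebra.antipode_mul_antidistrib, antipode_self hg2 hg]
  induction t with
  | zero => simp
  | add s t hs ht =>
    simp only [map_add, hs, ht, map_sub, mul_add, mul_sub]; module
  | tmul a b =>
    induction b using conj_induction hg2 with
    | hadd b b' h1 h2 =>
      simp only [TensorProduct.tmul_add, map_add, h1, h2, map_sub, mul_add, mul_sub]; module
    | h0 b hb =>
      induction a using conj_induction hg2 with
      | hadd a a' h1 h2 =>
        simp only [TensorProduct.add_tmul, map_add, h1, h2, map_sub, mul_add, mul_sub]; module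
      | h0 a ha =>
        simp only [twistLeg_even hg2 a hb, LinearMap.rTensor_tmul, antipode_even hg2 ha,
          TensorProduct.map_tmul, AlgHom.toLinearMap_apply, ha, hb, map_add,
          LinearMap.mul'_apply, sub_self, map_zero, mul_zero]
        module
      | h1 a ha =>
        simp only [twistLeg_even hg2 a hb, LinearMap.rTensor_tmul, antipode_odd hg2 ha,
          TensorProduct.map_tmul, AlgHom.toLinearMap_apply, ha, hb, map_add, map_sub,
          LinearMap.mul'_apply, map_neg, neg_mul, mul_add, mul_sub, mul_neg, ← mul_assoc]
        module
    | h1 b hb =>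
      induction a using conj_induction hg2 with
      | hadd a a' h1 h2 =>
        simp only [TensorProduct.add_tmul, map_add, h1, h2, map_sub, mul_add, mul_sub]; module
      | h0 a ha =>
        simp only [twistLeg_odd hg2 a hb, LinearMap.rTensor_tmul,
          antipode_even hg2 (conj_mul_self_even hg2 ha), hS,
          TensorProduct.map_tmul, AlgHom.toLinearMap_apply, ha, hb, map_add, map_sub,
          LinearMap.mul'_apply, map_neg, neg_mul, mul_add, mul_sub, mul_neg, ← mul_assoc]
        module
      | h1 a ha =>
        simp only [twistLeg_odd hg2 a hb, LinearMap.rTensor_tmul,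
          antipode_odd hg2 (conj_mul_self_odd hg2 ha), hS, ← mul_assoc, hg2, one_mul,
          TensorProduct.map_tmul, AlgHom.toLinearMap_apply, ha, hb, map_add, map_sub,
          LinearMap.mul'_apply, map_neg, neg_mul, mul_add, mul_sub, mul_neg]
        module

theorem antipode_right (t : H ⊗[ℂ] H) :
    LinearMap.mul' ℂ H ((antipode hg2).lTensor H (twistLeg g hg2 t)) =
      LinearMap.mul' ℂ H ((HopfAlgebraStruct.antipode ℂ).lTensor H t) := by
  induction t with
  | zero => simp
  | add s t hs ht => simp only [map_add, hs, ht]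
  | tmul a b =>
    induction b using conj_induction hg2 with
    | hadd b b' h1 h2 => simp only [TensorProduct.tmul_add, map_add, h1, h2]
    | h0 b hb =>
      simp only [twistLeg_even hg2 a hb, LinearMap.lTensor_tmul, antipode_even hg2 hb]
    | h1 b hb =>
      simp only [twistLeg_odd hg2 a hb, LinearMap.lTensor_tmul, antipode_odd hg2 hb,
        LinearMap.mul'_apply]
      rw [mul_assoc, ← mul_assoc g, hg2, one_mul]

theorem counit_twistLeg_left (t : H ⊗[ℂ] H) (hg : IsGroupLikeElem ℂ g) :
    (CoalgebraStruct.counit (R := ℂ) (A := H)).rTensor H (twistLeg g hg2 t) =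
      (CoalgebraStruct.counit (R := ℂ) (A := H)).rTensor H t := by
  induction t with
  | zero => simp
  | add s t hs ht => simp only [map_add, hs, ht]
  | tmul a b =>
    induction b using conj_induction hg2 with
    | hadd b b' h1 h2 => simp only [TensorProduct.tmul_add, map_add, h1, h2]
    | h0 b hb => simp [twistLeg_even hg2 a hb]
    | h1 b hb => simp [twistLeg_odd hg2 a hb, hg.counit_eq_one]

theorem counit_twistLeg_right (t : H ⊗[ℂ] H) (hg : IsGroupLikeElem ℂ g) :
    (CoalgebraStruct.counit (R := ℂ) (A := H)).lTensor H (twistLeg g hg2 t) =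
      (CoalgebraStruct.counit (R := ℂ) (A := H)).lTensor H t := by
  induction t with
  | zero => simp
  | add s t hs ht => simp only [map_add, hs, ht]
  | tmul a b =>
    induction b using conj_induction hg2 with
    | hadd b b' h1 h2 => simp only [TensorProduct.tmul_add, map_add, h1, h2]
    | h0 b hb => simp [twistLeg_even hg2 a hb]
    | h1 b hb =>
      have : (CoalgebraStruct.counit b : ℂ) = 0 := by
        have h := counit_conj hg2 hg b
        rw [hb, map_neg] at h
        linear_combination (-1 / 2 : ℂ) * h
      simp [twistLeg_odd hg2 a hb, this]

end Lemmas

end Superization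

open Superization in
/-- The superization of a Hopf algebra `H` with a group-like element `g`, `g² = 1`: the algebra and
the counit are those of `H`, the degree of `h` is given by `g h g⁻¹ = (-1)^{deg h} h`, and
`Δ h = ∑ x g^{-deg y} ⊗ y` if `∑ x ⊗ y` is the coproduct of `h` in `H`, and
the antipode is `h ↦ g^{deg h} S(h)`. -/
def superization {H : Type*} [Ring H] [HopfAlgebra ℂ H] (g : H) (hg : IsGroupLikeElem ℂ g)
    (hg2 : g * g = 1) : SuperHopfAlgebra H where
  parity := conj g hg2
  parity_parity := conj_conj hg2
  comul := twistLeg g hg2 ∘ₗ CoalgebraStruct.comul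
  counit := CoalgebraStruct.counit
  antipode := antipode hg2
  comul_parity a := by
    simp only [LinearMap.comp_apply, comul_conj hg2 hg, map_conj_twistLeg]
  counit_parity a := counit_conj hg2 hg a
  antipode_parity a := by
    induction a using conj_induction hg2 with
    | hadd a b h1 h2 => simp only [map_add, h1, h2]
    | h0 a ha => rw [ha, antipode_even hg2 ha, ← antipode_conj hg2 hg, ha]
    | h1 a ha =>
      rw [ha, map_neg, antipode_odd hg2 ha, map_mul, conj_self, ← antipode_conj hg2 hg, ha, map_neg,
        mul_neg]
  coassoc a := by
    simp only [LinearMap.comp_apply, coassoc_left hg2 hg, coassoc_right hg2 hg,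
      Coalgebra.coassoc_apply]
  rTensor_counit a := by
    simp only [LinearMap.comp_apply, counit_twistLeg_left hg2 _ hg, Coalgebra.rTensor_counit_comul]
  lTensor_counit a := by
    simp only [LinearMap.comp_apply, counit_twistLeg_right hg2 _ hg, Coalgebra.lTensor_counit_comul]
  counit_one := Bialgebra.counit_one
  counit_mul := Bialgebra.counit_mul
  comul_one := by
    simp [Algebra.TensorProduct.one_def, twistLeg_even hg2 (1 : H) (map_one (conj g hg2))]
  comul_mul a b := by
    simp only [LinearMap.comp_apply, Bialgebra.comul_mul, twistLeg_mul]
  mul_antipode_rTensor a := by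
    simp only [LinearMap.comp_apply, antipode_left hg2 hg, map_add, map_sub,
      HopfAlgebra.mul_antipode_rTensor_comul_apply, ← comul_conj hg2 hg, counit_conj hg2 hg,
      sub_self, mul_zero, add_zero]
    module
  mul_antipode_lTensor a := by
    simp only [LinearMap.comp_apply, antipode_right,
      HopfAlgebra.mul_antipode_lTensor_comul_apply]

namespace Superization

variable {H : Type*} [Ring H] [HopfAlgebra ℂ H] {g : H} (hg : IsGroupLikeElem ℂ g)
  (hg2 : g * g = 1) {B : Type*} [Ring B] [Algebra ℂ B] {x y : H →ₐ[ℂ] B}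

theorem map_g_comm (h : (superization g hg hg2).SuperCommute x y) (b : H) :
    x g * y b = y b * x g :=
  h.even_left g b (conj_self hg2)

/-- If `x`, `y` super-commute, then `b ↦ x(g)^{-deg b} y(b)` is an algebra homomorphism. -/
def twistHom (h : (superization g hg hg2).SuperCommute x y) : H →ₐ[ℂ] B :=
  AlgHom.ofLinearMap
    (y.toLinearMap ∘ₗ P0 g hg2 + LinearMap.mulLeft ℂ (x g) ∘ₗ y.toLinearMap ∘ₗ P1 g hg2)
    (by
      have h1 : conj g hg2 1 = 1 := map_one _
      simp [P0_even hg2 h1, P1_even hg2 h1])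
    (fun a b => by
      have hc := map_g_comm hg hg2 h
      have hx : x g * x g = 1 := by rw [← map_mul, hg2, map_one]
      simp only [LinearMap.add_apply, LinearMap.comp_apply, LinearMap.mulLeft_apply,
        AlgHom.toLinearMap_apply]
      induction a using conj_induction hg2 with
      | hadd a a' h1 h2 => simp only [add_mul, map_add, mul_add] at *; rw [
          add_add_add_comm, h1, h2]; abel
      | h0 a ha =>
        induction b using conj_induction hg2 with
        | hadd b b' h1 h2 => simp only [add_mul, map_add, mul_add] at *; rw [
            add_add_add_comm, h1, h2]; abel
        | h0 b hb =>
          have hab : conj g hg2 (a * b) = a * b := by rw [map_mul, ha, hb]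
          simp [P0_even hg2 ha, P0_even hg2 hb, P1_even hg2 ha, P1_even hg2 hb, P0_even hg2 hab,
            P1_even hg2 hab]
        | h1 b hb =>
          have hab : conj g hg2 (a * b) = -(a * b) := by rw [map_mul, ha, hb, mul_neg]
          simp only [P0_even hg2 ha, P0_odd hg2 hb, P1_even hg2 ha, P1_odd hg2 hb, P0_odd hg2 hab,
            P1_odd hg2 hab, map_zero, map_mul, mul_zero, add_zero, zero_add]
          rw [← mul_assoc, ← mul_assoc, hc]
      | h1 a ha =>
        induction b using conj_induction hg2 with
        | hadd b b' h1 h2 => simp only [add_mul, map_add, mul_add] at *; rw [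
            add_add_add_comm, h1, h2]; abel
        | h0 b hb =>
          have hab : conj g hg2 (a * b) = -(a * b) := by rw [map_mul, ha, hb, neg_mul]
          simp only [P0_odd hg2 ha, P0_even hg2 hb, P1_odd hg2 ha, P1_even hg2 hb, P0_odd hg2 hab,
            P1_odd hg2 hab, map_zero, map_mul, mul_zero, add_zero, zero_add]
          rw [← mul_assoc]
        | h1 b hb =>
          have hab : conj g hg2 (a * b) = a * b := by rw [map_mul, ha, hb, neg_mul_neg]
          simp only [P0_odd hg2 ha, P0_odd hg2 hb, P1_odd hg2 ha, P1_odd hg2 hb, P0_even hg2 hab,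
            P1_even hg2 hab, map_zero, map_mul, mul_zero, add_zero, zero_add]
          rw [hc a, mul_assoc, ← mul_assoc (x g), hx, one_mul])

theorem twistHom_apply (h : (superization g hg hg2).SuperCommute x y) (b : H) :
    twistHom hg hg2 h b = y (P0 g hg2 b) + x g * y (P1 g hg2 b) := rfl

theorem commute_twistHom (h : (superization g hg hg2).SuperCommute x y) :
    (SuperHopfAlgebra.ofHopf H).SuperCommute x (twistHom hg hg2 h) := by
  have key (a b : H) : x a * twistHom hg hg2 h b = twistHom hg hg2 h b * x a := by
    simp only [twistHom_apply]
    induction b using conj_induction hg2 with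
    | hadd b b' h1 h2 =>
      simp only [add_mul, map_add, mul_add] at *
      rw [add_add_add_comm, h1, h2]; abel
    | h0 b hb => simp [P0_even hg2 hb, P1_even hg2 hb, h.even_right a b hb]
    | h1 b hb =>
      simp only [P0_odd hg2 hb, P1_odd hg2 hb, map_zero, zero_add]
      have h1 : x a * y b = y b * x (conj g hg2 a) := h.odd_right a b hb
      have h2 : x (conj g hg2 a) * x g = x g * x a := by
        rw [← map_mul, ← map_mul, conj_apply, mul_assoc, hg2, mul_one]
      rw [map_g_comm hg hg2 h, ← mul_assoc, h1, mul_assoc, mul_assoc, h2]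
  exact ⟨fun a b _ => key a b, fun a b _ => key a b, fun a b ha _ => by
    have h0 : a = 0 := by
      have h2 : (2 : ℂ) • a = 0 := by
        rw [two_smul]; nth_rewrite 1 [show a = -a from ha]; exact neg_add_cancel a
      exact (smul_eq_zero_iff_right two_ne_zero).1 h2
    simp [h0]⟩

/-- The superization `R_g⁻¹ ∑ aᵢ g^{-deg bᵢ} ⊗ bᵢ` of a quasitriangular structure `∑ aᵢ ⊗ bᵢ`, with
`R_g = R_g⁻¹ = 1 ⊗ 1 - 2 p ⊗ p` and `p = (1 - g) / 2`. Its value at a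
super-commuting pair `x, y` is `(1 - 2 x(p) y(p)) ∑ x(aᵢ) (x(g)^{-deg bᵢ} y(bᵢ))`, where the sum is
the value of the given quasitriangular structure at the commuting pair consisting of `x` and
`b ↦ x(g)^{-deg b} y(b)`. -/
def universalR (R : (SuperHopfAlgebra.ofHopf H).PairFamily) :
    (superization g hg hg2).PairFamily :=
  fun B _ _ _ x y h =>
    (1 - (2 : ℂ) • (x ((1 / 2 : ℂ) • (1 - g)) * y ((1 / 2 : ℂ) • (1 - g)))) *
      R B x (twistHom hg hg2 h) (commute_twistHom hg hg2 h)

end Superization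

end General

section Antipode

variable {A : Type*} [Ring A] [Bialgebra ℂ A] (S : A →ₐ[ℂ] Aᵐᵒᵖ)

/-- The linear map underlying an anti-homomorphism. -/
def antiLin : A →ₗ[ℂ] A := (MulOpposite.opLinearEquiv ℂ).symm.toLinearMap ∘ₗ S.toLinearMap

theorem antiLin_apply (a : A) : antiLin S a = (S a).unop := rfl

theorem antiLin_mul (a b : A) : antiLin S (a * b) = antiLin S b * antiLin S a := by
  simp [antiLin_apply]

/-- The antipode axioms at an element. -/
def AntipodeAt (a : A) : Prop :=
  LinearMap.mul' ℂ A ((antiLin S).rTensor A (CoalgebraStruct.comul a)) =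
      algebraMap ℂ A (CoalgebraStruct.counit a) ∧
    LinearMap.mul' ℂ A ((antiLin S).lTensor A (CoalgebraStruct.comul a)) =
      algebraMap ℂ A (CoalgebraStruct.counit a)

theorem AntipodeAt.algebraMap (c : ℂ) : AntipodeAt S (algebraMap ℂ A c) := by
  have h : antiLin S 1 = 1 := by simp [antiLin_apply]
  simp [AntipodeAt, h, Algebra.algebraMap_eq_smul_one, Algebra.TensorProduct.one_def]

theorem AntipodeAt.add {a b : A} (ha : AntipodeAt S a) (hb : AntipodeAt S b) :
    AntipodeAt S (a + b) := by
  simp [AntipodeAt, ha.1, ha.2, hb.1, hb.2]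

theorem mul_rTensor_mul (s t : A ⊗[ℂ] A) (r : ℂ)
    (hs : LinearMap.mul' ℂ A ((antiLin S).rTensor A s) = algebraMap ℂ A r) :
    LinearMap.mul' ℂ A ((antiLin S).rTensor A (s * t)) =
      r • LinearMap.mul' ℂ A ((antiLin S).rTensor A t) := by
  induction t with
  | zero => simp
  | add t t' h h' => simp only [mul_add, map_add, h, h', smul_add]
  | tmul c d =>
    have key : LinearMap.mul' ℂ A ((antiLin S).rTensor A (s * (c ⊗ₜ d))) =
        antiLin S c * LinearMap.mul' ℂ A ((antiLin S).rTensor A s) * d := by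
      clear hs
      induction s with
      | zero => simp
      | add s s' h h' => simp only [add_mul, mul_add, map_add, h, h']
      | tmul a b => simp [antiLin_mul, mul_assoc]
    rw [key, hs, ← Algebra.commutes, mul_assoc, ← Algebra.smul_def]
    simp

theorem mul_lTensor_mul (s t : A ⊗[ℂ] A) (r : ℂ)
    (ht : LinearMap.mul' ℂ A ((antiLin S).lTensor A t) = algebraMap ℂ A r) :
    LinearMap.mul' ℂ A ((antiLin S).lTensor A (s * t)) =
      r • LinearMap.mul' ℂ A ((antiLin S).lTensor A s) := by
  induction s with
  | zero => simp
  | add t t' h h' => simp only [add_mul, map_add, h, h', smul_add]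
  | tmul c d =>
    have key : LinearMap.mul' ℂ A ((antiLin S).lTensor A ((c ⊗ₜ d) * t)) =
        c * LinearMap.mul' ℂ A ((antiLin S).lTensor A t) * antiLin S d := by
      clear ht
      induction t with
      | zero => simp
      | add s s' h h' => simp only [add_mul, mul_add, map_add, h, h']
      | tmul a b => simp [antiLin_mul, mul_assoc]
    rw [key, ht, ← Algebra.commutes, mul_assoc, ← Algebra.smul_def]
    simp

theorem AntipodeAt.mul {a b : A} (ha : AntipodeAt S a) (hb : AntipodeAt S b) :
    AntipodeAt S (a * b) := by
  constructor
  · rw [Bialgebra.comul_mul, mul_rTensor_mul S _ _ _ ha.1, hb.1, Bialgebra.counit_mul, map_mul,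
      Algebra.smul_def]
  · rw [Bialgebra.comul_mul, mul_lTensor_mul S _ _ _ hb.2, ha.2, Bialgebra.counit_mul, mul_comm,
      map_mul, Algebra.smul_def]

/-- A bialgebra with an anti-homomorphism that satisfies the antipode axioms is a Hopf algebra. -/
abbrev hopfOfAntipode (h : ∀ a, AntipodeAt S a) : HopfAlgebra ℂ A where
  antipode := antiLin S
  mul_antipode_rTensor_comul := LinearMap.ext fun a => (h a).1
  mul_antipode_lTensor_comul := LinearMap.ext fun a => (h a).2

end Antipode

/-! ### The Hopf algebra `U_q(H₁, H₂, X^±)` -/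

/-- Generators of `U_q(H₁, H₂, X^±)`. The generator `E z w` stands for the exponential
`e^{z H₁ + w H₂}`. -/
inductive UqGen
  | H1 | H2 | Xp | Xm
  | E (z w : ℂ)

namespace UqGen

/-- The generators in the free algebra. -/
abbrev free (s : UqGen) : FreeAlgebra ℂ UqGen := FreeAlgebra.ι ℂ s

end UqGen

open UqGen in
/-- The relations of `U_q(H₁, H₂, X^±)`, `q = e^ℏ`: the relations between `H₁, H₂, X^±`, in which
`K₁ = q^{H₁/2}`, `K₂ = e^{iπH₂/2} q^{H₂/2}`, and the relations that `[Hᵢ, X^±]` and `[H₁, H₂] = 0`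
force on the exponentials `e^{z H₁ + w H₂}` (`q^x` means `e^{ℏ x}`). As functions of two complex
variables, exponentials with distinct exponents are linearly independent over the polynomials, so
the actual exponentials satisfy no further relations. -/
inductive UqRel (ℏ : ℂ) : FreeAlgebra ℂ UqGen → FreeAlgebra ℂ UqGen → Prop
  | H1_H2 : UqRel ℏ (H1.free * H2.free - H2.free * H1.free) 0
  | H1_Xp : UqRel ℏ (H1.free * Xp.free - Xp.free * H1.free) ((2 : ℂ) • Xp.free)
  | H1_Xm : UqRel ℏ (H1.free * Xm.free - Xm.free * H1.free) (-(2 : ℂ) • Xm.free)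
  | H2_Xp : UqRel ℏ (H2.free * Xp.free - Xp.free * H2.free) (-(2 : ℂ) • Xp.free)
  | H2_Xm : UqRel ℏ (H2.free * Xm.free - Xm.free * H2.free) ((2 : ℂ) • Xm.free)
  | Xp_Xm : UqRel ℏ (Xp.free * Xm.free - Xm.free * Xp.free)
      ((Complex.exp ℏ - (Complex.exp ℏ)⁻¹)⁻¹ •
        ((E (ℏ / 2) 0).free * (E 0 (Complex.I * Real.pi / 2 + ℏ / 2)).free
          - (E (-(ℏ / 2)) 0).free * (E 0 (-(Complex.I * Real.pi / 2 + ℏ / 2))).free))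
  | Xp_Xp : UqRel ℏ (Xp.free * Xp.free) 0
  | Xm_Xm : UqRel ℏ (Xm.free * Xm.free) 0
  | E_zero : UqRel ℏ (E 0 0).free 1
  | E_add (z w z' w' : ℂ) :
      UqRel ℏ ((E z w).free * (E z' w').free) (E (z + z') (w + w')).free
  | E_H1 (z w : ℂ) : UqRel ℏ ((E z w).free * H1.free) (H1.free * (E z w).free)
  | E_H2 (z w : ℂ) : UqRel ℏ ((E z w).free * H2.free) (H2.free * (E z w).free)
  | E_Xp (z w : ℂ) : UqRel ℏ ((E z w).free * Xp.free)
      (Complex.exp (2 * (z - w)) • (Xp.free * (E z w).free))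
  | E_Xm (z w : ℂ) : UqRel ℏ ((E z w).free * Xm.free)
      (Complex.exp (-(2 * (z - w))) • (Xm.free * (E z w).free))

/-- The algebra `U_q(H₁, H₂, X^±)` over `ℂ` with `q = e^ℏ`. -/
def Uq (ℏ : ℂ) : Type := RingQuot (UqRel ℏ)

instance (ℏ : ℂ) : Ring (Uq ℏ) := inferInstanceAs (Ring (RingQuot (UqRel ℏ)))

instance (ℏ : ℂ) : Algebra ℂ (Uq ℏ) := inferInstanceAs (Algebra ℂ (RingQuot (UqRel ℏ)))

namespace Uq

variable (ℏ : ℂ)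

/-- The projection from the free algebra. -/
def mk : FreeAlgebra ℂ UqGen →ₐ[ℂ] Uq ℏ := RingQuot.mkAlgHom ℂ (UqRel ℏ)

/-- The image of a generator in `U_q(H₁, H₂, X^±)`. -/
def gen (s : UqGen) : Uq ℏ := mk ℏ s.free

def H1 : Uq ℏ := gen ℏ .H1
def H2 : Uq ℏ := gen ℏ .H2
def Xp : Uq ℏ := gen ℏ .Xp
def Xm : Uq ℏ := gen ℏ .Xm

/-- `e^{z H₁ + w H₂}` -/
def E (z w : ℂ) : Uq ℏ := gen ℏ (.E z w)

/-- `K₁ = q^{H₁/2}` -/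
def K1 : Uq ℏ := E ℏ (ℏ / 2) 0

/-- `K₁⁻¹` -/
def K1inv : Uq ℏ := E ℏ (-(ℏ / 2)) 0

/-- `K₂ = e^{iπH₂/2} q^{H₂/2}` -/
def K2 : Uq ℏ := E ℏ 0 (Complex.I * Real.pi / 2 + ℏ / 2)

/-- `K₂⁻¹` -/
def K2inv : Uq ℏ := E ℏ 0 (-(Complex.I * Real.pi / 2 + ℏ / 2))

/-- `g = e^{iπH₂/2}` -/
def g : Uq ℏ := E ℏ 0 (Complex.I * Real.pi / 2)

theorem mk_rel {ℏ : ℂ} {a b : FreeAlgebra ℂ UqGen} (h : UqRel ℏ a b) : mk ℏ a = mk ℏ b :=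
  RingQuot.mkAlgHom_rel ℂ h

theorem H1_H2 : H1 ℏ * H2 ℏ = H2 ℏ * H1 ℏ := by
  simpa [sub_eq_zero, H1, H2, gen] using mk_rel (UqRel.H1_H2 (ℏ := ℏ))

theorem H1_Xp : H1 ℏ * Xp ℏ = Xp ℏ * H1 ℏ + (2 : ℂ) • Xp ℏ := by
  simpa [sub_eq_iff_eq_add', H1, Xp, gen] using mk_rel (UqRel.H1_Xp (ℏ := ℏ))

theorem H1_Xm : H1 ℏ * Xm ℏ = Xm ℏ * H1 ℏ + -(2 : ℂ) • Xm ℏ := by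
  have h := mk_rel (UqRel.H1_Xm (ℏ := ℏ))
  rwa [map_sub, map_mul, map_mul, map_smul, sub_eq_iff_eq_add'] at h

theorem H2_Xp : H2 ℏ * Xp ℏ = Xp ℏ * H2 ℏ + -(2 : ℂ) • Xp ℏ := by
  have h := mk_rel (UqRel.H2_Xp (ℏ := ℏ))
  rwa [map_sub, map_mul, map_mul, map_smul, sub_eq_iff_eq_add'] at h

theorem H2_Xm : H2 ℏ * Xm ℏ = Xm ℏ * H2 ℏ + (2 : ℂ) • Xm ℏ := by
  have h := mk_rel (UqRel.H2_Xm (ℏ := ℏ))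
  rwa [map_sub, map_mul, map_mul, map_smul, sub_eq_iff_eq_add'] at h

theorem Xp_Xm : Xp ℏ * Xm ℏ = Xm ℏ * Xp ℏ + (Complex.exp ℏ - (Complex.exp ℏ)⁻¹)⁻¹ •
    (K1 ℏ * K2 ℏ - K1inv ℏ * K2inv ℏ) := by
  have h := mk_rel (UqRel.Xp_Xm (ℏ := ℏ))
  rwa [map_sub, map_mul, map_mul, map_smul, map_sub, map_mul, map_mul, sub_eq_iff_eq_add'] at h

theorem Xp_Xp : Xp ℏ * Xp ℏ = 0 := by
  simpa [Xp, gen] using mk_rel (UqRel.Xp_Xp (ℏ := ℏ))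

theorem Xm_Xm : Xm ℏ * Xm ℏ = 0 := by
  simpa [Xm, gen] using mk_rel (UqRel.Xm_Xm (ℏ := ℏ))

theorem E_zero : E ℏ 0 0 = 1 := by
  simpa [E, gen] using mk_rel (UqRel.E_zero (ℏ := ℏ))

theorem E_add (z w z' w' : ℂ) : E ℏ z w * E ℏ z' w' = E ℏ (z + z') (w + w') := by
  simpa [E, gen] using mk_rel (UqRel.E_add (ℏ := ℏ) z w z' w')

theorem E_H1 (z w : ℂ) : E ℏ z w * H1 ℏ = H1 ℏ * E ℏ z w := by
  simpa [E, H1, gen] using mk_rel (UqRel.E_H1 (ℏ := ℏ) z w)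

theorem E_H2 (z w : ℂ) : E ℏ z w * H2 ℏ = H2 ℏ * E ℏ z w := by
  simpa [E, H2, gen] using mk_rel (UqRel.E_H2 (ℏ := ℏ) z w)

theorem E_Xp (z w : ℂ) : E ℏ z w * Xp ℏ = Complex.exp (2 * (z - w)) • (Xp ℏ * E ℏ z w) := by
  have h := mk_rel (UqRel.E_Xp (ℏ := ℏ) z w)
  rwa [map_mul, map_smul, map_mul] at h

theorem E_Xm (z w : ℂ) : E ℏ z w * Xm ℏ = Complex.exp (-(2 * (z - w))) • (Xm ℏ * E ℏ z w) := by
  have h := mk_rel (UqRel.E_Xm (ℏ := ℏ) z w)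
  rwa [map_mul, map_smul, map_mul] at h

/-- The coproduct on generators. -/
def comulGen : UqGen → Uq ℏ ⊗[ℂ] Uq ℏ
  | .H1 => H1 ℏ ⊗ₜ 1 + 1 ⊗ₜ H1 ℏ
  | .H2 => H2 ℏ ⊗ₜ 1 + 1 ⊗ₜ H2 ℏ
  | .Xp => Xp ℏ ⊗ₜ K1 ℏ + K2inv ℏ ⊗ₜ Xp ℏ
  | .Xm => Xm ℏ ⊗ₜ K2 ℏ + K1inv ℏ ⊗ₜ Xm ℏ
  | .E z w => E ℏ z w ⊗ₜ E ℏ z w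

/-- The counit on generators. -/
def counitGen : UqGen → ℂ
  | .H1 => 0
  | .H2 => 0
  | .Xp => 0
  | .Xm => 0
  | .E _ _ => 1

/-- The antipode on generators. -/
def antipodeGen : UqGen → Uq ℏ
  | .H1 => -H1 ℏ
  | .H2 => -H2 ℏ
  | .Xp => -Complex.exp ℏ • (K1inv ℏ * K2 ℏ * Xp ℏ)
  | .Xm => Complex.exp ℏ • (K1 ℏ * K2inv ℏ * Xm ℏ)
  | .E z w => E ℏ (-z) (-w)

theorem exp_aux1 : Complex.exp (-(2 * (-(Complex.I * Real.pi / 2 + ℏ / 2)))) =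
    -Complex.exp ℏ := by
  rw [show -(2 * (-(Complex.I * Real.pi / 2 + ℏ / 2))) = ℏ + Real.pi * Complex.I by ring,
    Complex.exp_add, Complex.exp_pi_mul_I]; ring

theorem exp_aux2 : Complex.exp (2 * (-(Complex.I * Real.pi / 2 + ℏ / 2))) =
    -(Complex.exp ℏ)⁻¹ := by
  rw [show 2 * (-(Complex.I * Real.pi / 2 + ℏ / 2)) = -(ℏ + Real.pi * Complex.I) by ring,
    Complex.exp_neg, Complex.exp_add, Complex.exp_pi_mul_I]; simp

theorem K1_Xp : K1 ℏ * Xp ℏ = Complex.exp ℏ • (Xp ℏ * K1 ℏ) := by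
  rw [K1, E_Xp]; congr 2; ring

theorem K1_Xm : K1 ℏ * Xm ℏ = (Complex.exp ℏ)⁻¹ • (Xm ℏ * K1 ℏ) := by
  rw [K1, E_Xm, ← Complex.exp_neg]; congr 2; ring

theorem K1inv_Xp : K1inv ℏ * Xp ℏ = (Complex.exp ℏ)⁻¹ • (Xp ℏ * K1inv ℏ) := by
  rw [K1inv, E_Xp, ← Complex.exp_neg]; congr 2; ring

theorem K1inv_Xm : K1inv ℏ * Xm ℏ = Complex.exp ℏ • (Xm ℏ * K1inv ℏ) := by
  rw [K1inv, E_Xm]; congr 2; ring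

theorem K2_Xp : K2 ℏ * Xp ℏ = -(Complex.exp ℏ)⁻¹ • (Xp ℏ * K2 ℏ) := by
  rw [K2, E_Xp, ← exp_aux2]; congr 2; ring

theorem K2_Xm : K2 ℏ * Xm ℏ = -Complex.exp ℏ • (Xm ℏ * K2 ℏ) := by
  rw [K2, E_Xm, ← exp_aux1]; congr 2; ring

theorem K2inv_Xp : K2inv ℏ * Xp ℏ = -Complex.exp ℏ • (Xp ℏ * K2inv ℏ) := by
  rw [K2inv, E_Xp, ← exp_aux1]; congr 2; ring

theorem K2inv_Xm : K2inv ℏ * Xm ℏ = -(Complex.exp ℏ)⁻¹ • (Xm ℏ * K2inv ℏ) := by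
  rw [K2inv, E_Xm, ← exp_aux2]; congr 2; ring

theorem K1_K1inv : K1 ℏ * K1inv ℏ = 1 := by rw [K1, K1inv, E_add, ← E_zero]; congr 1 <;> ring
theorem K1inv_K1 : K1inv ℏ * K1 ℏ = 1 := by rw [K1, K1inv, E_add, ← E_zero]; congr 1 <;> ring
theorem K2_K2inv : K2 ℏ * K2inv ℏ = 1 := by rw [K2, K2inv, E_add, ← E_zero]; congr 1 <;> ring
theorem K2inv_K2 : K2inv ℏ * K2 ℏ = 1 := by rw [K2, K2inv, E_add, ← E_zero]; congr 1 <;> ring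

theorem E_comm (z w z' w' : ℂ) : E ℏ z w * E ℏ z' w' = E ℏ z' w' * E ℏ z w := by
  rw [E_add, E_add, add_comm z, add_comm w]

theorem comul_rel ⦃a b : FreeAlgebra ℂ UqGen⦄ (h : UqRel ℏ a b) :
    FreeAlgebra.lift ℂ (comulGen ℏ) a = FreeAlgebra.lift ℂ (comulGen ℏ) b := by
  cases h <;> simp only [map_sub, map_mul, map_smul, map_zero, map_one, UqGen.free,
      FreeAlgebra.lift_ι_apply, comulGen]
  case H1_H2 =>
    simp only [add_mul, mul_add, Algebra.TensorProduct.tmul_mul_tmul, one_mul, mul_one, H1_H2]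
    abel
  case H1_Xp =>
    simp only [add_mul, mul_add, Algebra.TensorProduct.tmul_mul_tmul, one_mul, mul_one, H1_Xp,
      K1, K2inv, E_H1, TensorProduct.add_tmul, TensorProduct.tmul_add, ← TensorProduct.smul_tmul',
      TensorProduct.tmul_smul]
    module
  case H1_Xm =>
    simp only [add_mul, mul_add, Algebra.TensorProduct.tmul_mul_tmul, one_mul, mul_one, H1_Xm,
      K1inv, K2, E_H1, TensorProduct.add_tmul, TensorProduct.tmul_add, ← TensorProduct.smul_tmul',
      TensorProduct.tmul_smul]
    module
  case H2_Xp =>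
    simp only [add_mul, mul_add, Algebra.TensorProduct.tmul_mul_tmul, one_mul, mul_one, H2_Xp,
      K1, K2inv, E_H2, TensorProduct.add_tmul, TensorProduct.tmul_add, ← TensorProduct.smul_tmul',
      TensorProduct.tmul_smul]
    module
  case H2_Xm =>
    simp only [add_mul, mul_add, Algebra.TensorProduct.tmul_mul_tmul, one_mul, mul_one, H2_Xm,
      K1inv, K2, E_H2, TensorProduct.add_tmul, TensorProduct.tmul_add, ← TensorProduct.smul_tmul',
      TensorProduct.tmul_smul]
    module
  case Xp_Xm =>
    have h1 : K2inv ℏ * K1inv ℏ = K1inv ℏ * K2inv ℏ := E_comm ..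
    have h2 : K2 ℏ * K1 ℏ = K1 ℏ * K2 ℏ := E_comm ..
    rw [← K1, ← K2, ← K1inv, ← K2inv]
    simp only [add_mul, mul_add, Algebra.TensorProduct.tmul_mul_tmul, Xp_Xm, K1_Xm, K2inv_Xm,
      K1inv_Xp, K2_Xp, h1, h2, TensorProduct.add_tmul, TensorProduct.tmul_add,
      ← TensorProduct.smul_tmul', TensorProduct.tmul_smul, TensorProduct.sub_tmul,
      TensorProduct.tmul_sub]
    module
  case Xp_Xp =>
    simp only [add_mul, mul_add, Algebra.TensorProduct.tmul_mul_tmul, Xp_Xp, K1_Xp, K2inv_Xp,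
      ← TensorProduct.smul_tmul', TensorProduct.tmul_smul, TensorProduct.zero_tmul,
      TensorProduct.tmul_zero]
    module
  case Xm_Xm =>
    simp only [add_mul, mul_add, Algebra.TensorProduct.tmul_mul_tmul, Xm_Xm, K2_Xm, K1inv_Xm,
      ← TensorProduct.smul_tmul', TensorProduct.tmul_smul, TensorProduct.zero_tmul,
      TensorProduct.tmul_zero]
    module
  case E_zero => rw [E_zero, Algebra.TensorProduct.one_def]
  case E_add => rw [Algebra.TensorProduct.tmul_mul_tmul, E_add]
  case E_H1 =>
    simp only [add_mul, mul_add, Algebra.TensorProduct.tmul_mul_tmul, one_mul, mul_one, E_H1]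
  case E_H2 =>
    simp only [add_mul, mul_add, Algebra.TensorProduct.tmul_mul_tmul, one_mul, mul_one, E_H2]
  case E_Xp z w =>
    have h1 : E ℏ z w * K1 ℏ = K1 ℏ * E ℏ z w := E_comm ..
    have h2 : E ℏ z w * K2inv ℏ = K2inv ℏ * E ℏ z w := E_comm ..
    simp only [add_mul, mul_add, Algebra.TensorProduct.tmul_mul_tmul, E_Xp, h1, h2,
      ← TensorProduct.smul_tmul', TensorProduct.tmul_smul, smul_add]
  case E_Xm z w =>
    have h1 : E ℏ z w * K2 ℏ = K2 ℏ * E ℏ z w := E_comm ..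
    have h2 : E ℏ z w * K1inv ℏ = K1inv ℏ * E ℏ z w := E_comm ..
    simp only [add_mul, mul_add, Algebra.TensorProduct.tmul_mul_tmul, E_Xm, h1, h2,
      ← TensorProduct.smul_tmul', TensorProduct.tmul_smul, smul_add]

theorem counit_rel ⦃a b : FreeAlgebra ℂ UqGen⦄ (h : UqRel ℏ a b) :
    FreeAlgebra.lift ℂ counitGen a = FreeAlgebra.lift ℂ counitGen b := by
  cases h <;> simp [UqGen.free, counitGen]

theorem antipodeGen_Xp : -Complex.exp ℏ • (K1inv ℏ * K2 ℏ * Xp ℏ) =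
    (Complex.exp ℏ)⁻¹ • (Xp ℏ * E ℏ (-(ℏ / 2)) (Complex.I * Real.pi / 2 + ℏ / 2)) := by
  have h : K1inv ℏ * K2 ℏ = E ℏ (-(ℏ / 2)) (Complex.I * Real.pi / 2 + ℏ / 2) := by
    rw [K1inv, K2, E_add]; simp
  rw [h, E_Xp, smul_smul,
    show 2 * (-(ℏ / 2) - (Complex.I * Real.pi / 2 + ℏ / 2)) = -(ℏ + ℏ + Real.pi * Complex.I) by ring,
    Complex.exp_neg, Complex.exp_add, Complex.exp_add, Complex.exp_pi_mul_I]
  have := Complex.exp_ne_zero ℏ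
  congr 1; field_simp

theorem antipodeGen_Xm : Complex.exp ℏ • (K1 ℏ * K2inv ℏ * Xm ℏ) =
    -(Complex.exp ℏ)⁻¹ • (Xm ℏ * E ℏ (ℏ / 2) (-(Complex.I * Real.pi / 2 + ℏ / 2))) := by
  have h : K1 ℏ * K2inv ℏ = E ℏ (ℏ / 2) (-(Complex.I * Real.pi / 2 + ℏ / 2)) := by
    rw [K1, K2inv, E_add]; simp
  rw [h, E_Xm, smul_smul,
    show -(2 * (ℏ / 2 - -(Complex.I * Real.pi / 2 + ℏ / 2))) = -(ℏ + ℏ + Real.pi * Complex.I) by ring,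
    Complex.exp_neg, Complex.exp_add, Complex.exp_add, Complex.exp_pi_mul_I]
  have := Complex.exp_ne_zero ℏ
  congr 1; field_simp

theorem antipode_rel ⦃a b : FreeAlgebra ℂ UqGen⦄ (h : UqRel ℏ a b) :
    FreeAlgebra.lift ℂ (fun s => MulOpposite.op (antipodeGen ℏ s)) a =
      FreeAlgebra.lift ℂ (fun s => MulOpposite.op (antipodeGen ℏ s)) b := by
  cases h <;> simp only [map_sub, map_mul, map_smul, map_zero, map_one, UqGen.free,
      FreeAlgebra.lift_ι_apply, antipodeGen, ← MulOpposite.op_mul, ← MulOpposite.op_sub,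
      ← MulOpposite.op_smul, ← MulOpposite.op_zero, ← MulOpposite.op_one] <;>
    refine congrArg MulOpposite.op ?_
  case H1_H2 => simp [H1_H2]
  case H1_Xp =>
    rw [antipodeGen_Xp]
    simp only [smul_mul_assoc, mul_smul_comm, mul_neg, neg_mul, mul_assoc, E_H1]
    simp only [← mul_assoc, H1_Xp, add_mul, smul_mul_assoc]
    module
  case H1_Xm =>
    rw [antipodeGen_Xm]
    simp only [smul_mul_assoc, mul_smul_comm, mul_neg, neg_mul, mul_assoc, E_H1]
    simp only [← mul_assoc, H1_Xm, add_mul, smul_mul_assoc]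
    module
  case H2_Xp =>
    rw [antipodeGen_Xp]
    simp only [smul_mul_assoc, mul_smul_comm, mul_neg, neg_mul, mul_assoc, E_H2]
    simp only [← mul_assoc, H2_Xp, add_mul, smul_mul_assoc]
    module
  case H2_Xm =>
    rw [antipodeGen_Xm]
    simp only [smul_mul_assoc, mul_smul_comm, mul_neg, neg_mul, mul_assoc, E_H2]
    simp only [← mul_assoc, H2_Xm, add_mul, smul_mul_assoc]
    module
  case Xp_Xm =>
    rw [antipodeGen_Xp, antipodeGen_Xm]
    have h1 : Xm ℏ * E ℏ (ℏ / 2) (-(Complex.I * Real.pi / 2 + ℏ / 2)) *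
        (Xp ℏ * E ℏ (-(ℏ / 2)) (Complex.I * Real.pi / 2 + ℏ / 2)) =
        -(Complex.exp ℏ * Complex.exp ℏ) • (Xm ℏ * Xp ℏ) := by
      rw [mul_assoc, ← mul_assoc (E _ _ _), E_Xp, smul_mul_assoc, mul_assoc (Xp ℏ), E_add,
        mul_smul_comm, show ℏ / 2 + -(ℏ / 2) = 0 by ring, neg_add_cancel, E_zero, mul_one,
        show 2 * (ℏ / 2 - -(Complex.I * Real.pi / 2 + ℏ / 2)) = ℏ + ℏ + Real.pi * Complex.I by ring,
        Complex.exp_add, Complex.exp_add, Complex.exp_pi_mul_I]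
      congr 1; ring
    have h2 : Xp ℏ * E ℏ (-(ℏ / 2)) (Complex.I * Real.pi / 2 + ℏ / 2) *
        (Xm ℏ * E ℏ (ℏ / 2) (-(Complex.I * Real.pi / 2 + ℏ / 2))) =
        -(Complex.exp ℏ * Complex.exp ℏ) • (Xp ℏ * Xm ℏ) := by
      rw [mul_assoc, ← mul_assoc (E _ _ _), E_Xm, smul_mul_assoc, mul_assoc (Xm ℏ), E_add,
        mul_smul_comm, show -(ℏ / 2) + ℏ / 2 = 0 by ring, add_neg_cancel, E_zero, mul_one,
        show -(2 * (-(ℏ / 2) - (Complex.I * Real.pi / 2 + ℏ / 2))) =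
          ℏ + ℏ + Real.pi * Complex.I by ring,
        Complex.exp_add, Complex.exp_add, Complex.exp_pi_mul_I]
      congr 1; ring
    have hq : (Complex.exp ℏ)⁻¹ * (Complex.exp ℏ)⁻¹ * (Complex.exp ℏ * Complex.exp ℏ) = 1 := by
      have := Complex.exp_ne_zero ℏ
      field_simp
    have h3 (c : ℂ) : (Complex.exp ℏ)⁻¹ * (-(Complex.exp ℏ)⁻¹ *
        (-(Complex.exp ℏ * Complex.exp ℏ) * c)) = c := by linear_combination c * hq
    have h4 : K2inv ℏ * K1inv ℏ = K1inv ℏ * K2inv ℏ := E_comm ..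
    have h5 : K2 ℏ * K1 ℏ = K1 ℏ * K2 ℏ := E_comm ..
    simp only [neg_neg, neg_zero]
    rw [← K1, ← K2, ← K1inv, ← K2inv, h4, h5]
    simp only [smul_mul_smul_comm, h1, h2, smul_smul, Xp_Xm]
    have h6 : -(Complex.exp ℏ)⁻¹ * (Complex.exp ℏ)⁻¹ * -(Complex.exp ℏ * Complex.exp ℏ) = 1 := by
      linear_combination hq
    have h7 : (Complex.exp ℏ)⁻¹ * -(Complex.exp ℏ)⁻¹ * -(Complex.exp ℏ * Complex.exp ℏ) = 1 := by
      linear_combination hq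
    rw [h6, h7]
    module
  case Xp_Xp =>
    rw [antipodeGen_Xp, smul_mul_smul_comm, mul_assoc, ← mul_assoc (E _ _ _), E_Xp, smul_mul_assoc,
      mul_smul_comm, mul_assoc (Xp ℏ), ← mul_assoc (Xp ℏ), Xp_Xp]
    simp
  case Xm_Xm =>
    rw [antipodeGen_Xm, smul_mul_smul_comm, mul_assoc, ← mul_assoc (E _ _ _), E_Xm, smul_mul_assoc,
      mul_smul_comm, mul_assoc (Xm ℏ), ← mul_assoc (Xm ℏ), Xm_Xm]
    simp
  case E_zero => simp [E_zero]
  case E_add => rw [E_add, neg_add_rev, neg_add_rev]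
  case E_H1 => simp [E_H1]
  case E_H2 => simp [E_H2]
  case E_Xp z w =>
    have h (a b : ℂ) : E ℏ (-z) (-w) * (Xp ℏ * E ℏ a b) =
        Complex.exp (2 * (-z - -w)) • (Xp ℏ * E ℏ a b * E ℏ (-z) (-w)) := by
      rw [← mul_assoc, E_Xp, smul_mul_assoc, mul_assoc, mul_assoc, E_comm]
    rw [antipodeGen_Xp, mul_smul_comm, h, smul_mul_assoc, smul_comm, smul_smul (Complex.exp _),
      ← Complex.exp_add, show 2 * (z - w) + 2 * (-z - -w) = 0 by ring, Complex.exp_zero, one_smul]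
  case E_Xm z w =>
    have h (a b : ℂ) : E ℏ (-z) (-w) * (Xm ℏ * E ℏ a b) =
        Complex.exp (-(2 * (-z - -w))) • (Xm ℏ * E ℏ a b * E ℏ (-z) (-w)) := by
      rw [← mul_assoc, E_Xm, smul_mul_assoc, mul_assoc, mul_assoc, E_comm]
    rw [antipodeGen_Xm, mul_smul_comm, h, smul_mul_assoc, smul_comm, smul_smul (Complex.exp _),
      ← Complex.exp_add, show -(2 * (z - w)) + -(2 * (-z - -w)) = 0 by ring, Complex.exp_zero, one_smul]

/-- The coproduct of `U_q(H₁, H₂, X^±)`. -/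
def comulHom : Uq ℏ →ₐ[ℂ] Uq ℏ ⊗[ℂ] Uq ℏ :=
  RingQuot.liftAlgHom ℂ ⟨FreeAlgebra.lift ℂ (comulGen ℏ), comul_rel ℏ⟩

/-- The counit of `U_q(H₁, H₂, X^±)`. -/
def counitHom : Uq ℏ →ₐ[ℂ] ℂ :=
  RingQuot.liftAlgHom ℂ ⟨FreeAlgebra.lift ℂ counitGen, counit_rel ℏ⟩

/-- The antipode of `U_q(H₁, H₂, X^±)`, an anti-homomorphism. -/
def antipodeHom : Uq ℏ →ₐ[ℂ] (Uq ℏ)ᵐᵒᵖ :=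
  RingQuot.liftAlgHom ℂ ⟨FreeAlgebra.lift ℂ (fun s => MulOpposite.op (antipodeGen ℏ s)),
    antipode_rel ℏ⟩

theorem comulHom_gen (s : UqGen) : comulHom ℏ (gen ℏ s) = comulGen ℏ s :=
  (RingQuot.liftAlgHom_mkAlgHom_apply ℂ _ (comul_rel ℏ) _).trans (FreeAlgebra.lift_ι_apply _ _)

theorem counitHom_gen (s : UqGen) : counitHom ℏ (gen ℏ s) = counitGen s :=
  (RingQuot.liftAlgHom_mkAlgHom_apply ℂ _ (counit_rel ℏ) _).trans (FreeAlgebra.lift_ι_apply _ _)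

theorem antipodeHom_gen (s : UqGen) :
    antipodeHom ℏ (gen ℏ s) = MulOpposite.op (antipodeGen ℏ s) :=
  (RingQuot.liftAlgHom_mkAlgHom_apply ℂ _ (antipode_rel ℏ) _).trans (FreeAlgebra.lift_ι_apply _ _)

theorem hom_ext {ℏ : ℂ} {B : Type*} [Semiring B] [Algebra ℂ B] {f f' : Uq ℏ →ₐ[ℂ] B}
    (h : ∀ s, f (gen ℏ s) = f' (gen ℏ s)) : f = f' :=
  RingQuot.ringQuot_ext' ℂ f f' (FreeAlgebra.hom_ext (funext h))

theorem induction {ℏ : ℂ} {P : Uq ℏ → Prop} (hc : ∀ c : ℂ, P (algebraMap ℂ _ c))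
    (hgen : ∀ s, P (gen ℏ s)) (hmul : ∀ a b, P a → P b → P (a * b))
    (hadd : ∀ a b, P a → P b → P (a + b)) (a : Uq ℏ) : P a := by
  obtain ⟨a, rfl⟩ := RingQuot.mkAlgHom_surjective ℂ (UqRel ℏ) a
  induction a using FreeAlgebra.induction with
  | grade0 c =>
    have h := hc c
    rwa [← (mk ℏ).commutes c] at h
  | grade1 s => exact hgen s
  | mul a b ha hb =>
    have h : P (mk ℏ a * mk ℏ b) := hmul _ _ ha hb
    rwa [← map_mul] at h
  | add a b ha hb =>
    have h : P (mk ℏ a + mk ℏ b) := hadd _ _ ha hb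
    rwa [← map_add] at h

instance : Bialgebra ℂ (Uq ℏ) := Bialgebra.ofAlgHom (comulHom ℏ) (counitHom ℏ)
  (hom_ext fun s => by
    cases s <;> simp only [AlgHom.comp_apply, comulHom_gen] <;>
      simp only [comulGen, K1, K2, K1inv, K2inv, H1, H2, Xp, Xm, E, map_add,
        Algebra.TensorProduct.map_tmul, comulHom_gen, AlgHom.id_apply, map_one,
        Algebra.TensorProduct.one_def, TensorProduct.add_tmul, TensorProduct.tmul_add] <;>
      simp [add_assoc])
  (hom_ext fun s => by
    cases s <;> simp only [AlgHom.comp_apply, comulHom_gen] <;>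
      simp [comulGen, K1, K2, K1inv, K2inv, H1, H2, Xp, Xm, E, counitHom_gen, counitGen])
  (hom_ext fun s => by
    cases s <;> simp only [AlgHom.comp_apply, comulHom_gen] <;>
      simp [comulGen, K1, K2, K1inv, K2inv, H1, H2, Xp, Xm, E, counitHom_gen, counitGen])

theorem comul_gen (s : UqGen) : CoalgebraStruct.comul (R := ℂ) (gen ℏ s) = comulGen ℏ s :=
  comulHom_gen ℏ s

theorem counit_gen (s : UqGen) : CoalgebraStruct.counit (R := ℂ) (gen ℏ s) = counitGen s :=
  counitHom_gen ℏ s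

theorem antipodeAt_gen (s : UqGen) : AntipodeAt (antipodeHom ℏ) (gen ℏ s) := by
  have hS (s : UqGen) : antiLin (antipodeHom ℏ) (gen ℏ s) = antipodeGen ℏ s := by
    rw [antiLin_apply, antipodeHom_gen, MulOpposite.unop_op]
  have h1 : antiLin (antipodeHom ℏ) 1 = 1 := by simp [antiLin_apply]
  have hE (z w : ℂ) : antiLin (antipodeHom ℏ) (E ℏ z w) = E ℏ (-z) (-w) := hS (.E z w)
  have hX : antiLin (antipodeHom ℏ) (Xp ℏ) = -Complex.exp ℏ • (K1inv ℏ * K2 ℏ * Xp ℏ) := hS .Xp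
  have hY : antiLin (antipodeHom ℏ) (Xm ℏ) = Complex.exp ℏ • (K1 ℏ * K2inv ℏ * Xm ℏ) := hS .Xm
  have hK1 : antiLin (antipodeHom ℏ) (K1 ℏ) = K1inv ℏ := by rw [K1, hE, neg_zero, K1inv]
  have hK1' : antiLin (antipodeHom ℏ) (K1inv ℏ) = K1 ℏ := by rw [K1inv, hE, neg_zero, neg_neg, K1]
  have hK2 : antiLin (antipodeHom ℏ) (K2 ℏ) = K2inv ℏ := by rw [K2, hE, neg_zero, K2inv]
  have hK2' : antiLin (antipodeHom ℏ) (K2inv ℏ) = K2 ℏ := by rw [K2inv, hE, neg_zero, neg_neg, K2]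
  have hH1 : antiLin (antipodeHom ℏ) (H1 ℏ) = -H1 ℏ := hS .H1
  have hH2 : antiLin (antipodeHom ℏ) (H2 ℏ) = -H2 ℏ := hS .H2
  have hq := Complex.exp_ne_zero ℏ
  rw [AntipodeAt, comul_gen, counit_gen]
  cases s with
  | H1 => simp [comulGen, counitGen, h1, hH1]
  | H2 => simp [comulGen, counitGen, h1, hH2]
  | E z w => simp [comulGen, counitGen, hE, E_add, E_zero]
  | Xp =>
    simp only [comulGen, counitGen, map_add, LinearMap.rTensor_tmul, LinearMap.lTensor_tmul,
      LinearMap.mul'_apply, hX, hK2', hK1, map_zero]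
    constructor
    · have h : K1inv ℏ * K2 ℏ * Xp ℏ * K1 ℏ = (Complex.exp ℏ)⁻¹ • (K2 ℏ * Xp ℏ) := by
        rw [show K1inv ℏ * K2 ℏ = K2 ℏ * K1inv ℏ from E_comm .., mul_assoc (K2 ℏ), K1inv_Xp,
          mul_smul_comm, smul_mul_assoc, mul_assoc, mul_assoc, K1inv_K1, mul_one]
      rw [smul_mul_assoc, h, smul_smul, neg_mul, mul_inv_cancel₀ hq]; simp
    · have h : K2inv ℏ * (K1inv ℏ * K2 ℏ * Xp ℏ) = (Complex.exp ℏ)⁻¹ • (Xp ℏ * K1inv ℏ) := by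
        rw [show K1inv ℏ * K2 ℏ = K2 ℏ * K1inv ℏ from E_comm .., ← mul_assoc, ← mul_assoc,
          K2inv_K2, one_mul, K1inv_Xp]
      rw [mul_smul_comm, h, smul_smul, neg_mul, mul_inv_cancel₀ hq]; simp
  | Xm =>
    simp only [comulGen, counitGen, map_add, LinearMap.rTensor_tmul, LinearMap.lTensor_tmul,
      LinearMap.mul'_apply, hY, hK1', hK2, map_zero]
    constructor
    · have h : K1 ℏ * K2inv ℏ * Xm ℏ * K2 ℏ = -(Complex.exp ℏ)⁻¹ • (K1 ℏ * Xm ℏ) := by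
        rw [mul_assoc (K1 ℏ), K2inv_Xm,
          mul_smul_comm, smul_mul_assoc, mul_assoc, mul_assoc, K2inv_K2, mul_one]
      rw [smul_mul_assoc, h, smul_smul, mul_neg, mul_inv_cancel₀ hq]; simp
    · have h : K1inv ℏ * (K1 ℏ * K2inv ℏ * Xm ℏ) = -(Complex.exp ℏ)⁻¹ • (Xm ℏ * K2inv ℏ) := by
        rw [← mul_assoc, ← mul_assoc, K1inv_K1, one_mul, K2inv_Xm]
      rw [mul_smul_comm, h, smul_smul, mul_neg, mul_inv_cancel₀ hq]; simp

instance : HopfAlgebra ℂ (Uq ℏ) :=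
  hopfOfAntipode (antipodeHom ℏ) (induction (AntipodeAt.algebraMap _) (antipodeAt_gen ℏ)
    (fun _ _ => AntipodeAt.mul _) (fun _ _ => AntipodeAt.add _))

end Uq

/-! ### The quotient by `g² = 1` -/

/-- The quotient of `U_q(H₁, H₂, X^±)` by the two-sided ideal generated by `g² - 1`,
`g = e^{iπH₂/2}`. -/
def UqQuot (ℏ : ℂ) : Type := RingQuot fun a b : Uq ℏ => a = Uq.g ℏ * Uq.g ℏ ∧ b = 1

instance (ℏ : ℂ) : Ring (UqQuot ℏ) :=
  inferInstanceAs (Ring (RingQuot fun a b : Uq ℏ => a = Uq.g ℏ * Uq.g ℏ ∧ b = 1))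

instance (ℏ : ℂ) : Algebra ℂ (UqQuot ℏ) :=
  inferInstanceAs (Algebra ℂ (RingQuot fun a b : Uq ℏ => a = Uq.g ℏ * Uq.g ℏ ∧ b = 1))

namespace UqQuot

variable (ℏ : ℂ)

/-- The projection. -/
def proj : Uq ℏ →ₐ[ℂ] UqQuot ℏ := RingQuot.mkAlgHom ℂ _

theorem proj_surjective : Function.Surjective (proj ℏ) := RingQuot.mkAlgHom_surjective ℂ _

/-- The image of `g` in the quotient. -/
def g : UqQuot ℏ := proj ℏ (Uq.g ℏ)

theorem g_mul_g : g ℏ * g ℏ = 1 := by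
  rw [g, ← map_mul, ← map_one (proj ℏ)]
  exact RingQuot.mkAlgHom_rel ℂ ⟨rfl, rfl⟩

/-- Homomorphisms on the quotient. -/
def lift {B : Type*} [Semiring B] [Algebra ℂ B] (f : Uq ℏ →ₐ[ℂ] B)
    (hf : f (Uq.g ℏ * Uq.g ℏ) = 1) : UqQuot ℏ →ₐ[ℂ] B :=
  RingQuot.liftAlgHom ℂ ⟨f, by rintro a b ⟨rfl, rfl⟩; rw [hf, map_one]⟩

theorem lift_proj {B : Type*} [Semiring B] [Algebra ℂ B] (f : Uq ℏ →ₐ[ℂ] B)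
    (hf : f (Uq.g ℏ * Uq.g ℏ) = 1) (a : Uq ℏ) : lift ℏ f hf (proj ℏ a) = f a :=
  RingQuot.liftAlgHom_mkAlgHom_apply ℂ _ _ _

theorem hom_ext {ℏ : ℂ} {B : Type*} [Semiring B] [Algebra ℂ B] {f f' : UqQuot ℏ →ₐ[ℂ] B}
    (h : ∀ s, f (proj ℏ (Uq.gen ℏ s)) = f' (proj ℏ (Uq.gen ℏ s))) : f = f' :=
  RingQuot.ringQuot_ext' ℂ f f' (Uq.hom_ext h)

/-- The coproduct of the quotient, induced by that of `U_q(H₁, H₂, X^±)`. -/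
def comulHom : UqQuot ℏ →ₐ[ℂ] UqQuot ℏ ⊗[ℂ] UqQuot ℏ :=
  lift ℏ ((Algebra.TensorProduct.map (proj ℏ) (proj ℏ)).comp (Uq.comulHom ℏ)) (by
    have h : Uq.comulHom ℏ (Uq.g ℏ) = Uq.g ℏ ⊗ₜ Uq.g ℏ := Uq.comulHom_gen ℏ _
    have h2 := g_mul_g ℏ
    rw [g] at h2
    rw [map_mul, AlgHom.comp_apply, h, Algebra.TensorProduct.map_tmul,
      Algebra.TensorProduct.tmul_mul_tmul, h2, Algebra.TensorProduct.one_def])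

/-- The counit of the quotient, induced by that of `U_q(H₁, H₂, X^±)`. -/
def counitHom : UqQuot ℏ →ₐ[ℂ] ℂ :=
  lift ℏ (Uq.counitHom ℏ) (by
    have h : Uq.counitHom ℏ (Uq.g ℏ) = 1 := Uq.counitHom_gen ℏ _
    rw [map_mul, h, one_mul])

/-- The antipode of the quotient, induced by that of `U_q(H₁, H₂, X^±)`. -/
def antipodeHom : UqQuot ℏ →ₐ[ℂ] (UqQuot ℏ)ᵐᵒᵖ :=
  lift ℏ ((AlgHom.op (proj ℏ)).comp (Uq.antipodeHom ℏ)) (by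
    have h : Uq.antipodeHom ℏ (Uq.g ℏ) = MulOpposite.op (Uq.E ℏ (-0) (-(Complex.I * Real.pi / 2))) :=
      Uq.antipodeHom_gen ℏ _
    have h3 : Uq.E ℏ (-0) (-(Complex.I * Real.pi / 2)) * Uq.g ℏ = 1 := by
      rw [Uq.g, Uq.E_add, neg_add_cancel, neg_add_cancel, Uq.E_zero]
    have h2 := g_mul_g ℏ
    have h4 : proj ℏ (Uq.E ℏ (-0) (-(Complex.I * Real.pi / 2))) = g ℏ := by
      have h5 := congrArg (proj ℏ) h3
      rw [map_mul, map_one] at h5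
      rw [← mul_one (proj ℏ _), ← h2, ← mul_assoc, g, h5, one_mul]
    rw [map_mul, AlgHom.comp_apply, h]
    change MulOpposite.op (proj ℏ _) * MulOpposite.op (proj ℏ _) = 1
    rw [MulOpposite.unop_op, h4, ← MulOpposite.op_mul, h2, MulOpposite.op_one])

theorem comulHom_proj (a : Uq ℏ) : comulHom ℏ (proj ℏ a) =
    Algebra.TensorProduct.map (proj ℏ) (proj ℏ) (Uq.comulHom ℏ a) := lift_proj ..

theorem counitHom_proj (a : Uq ℏ) : counitHom ℏ (proj ℏ a) = Uq.counitHom ℏ a := lift_proj ..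

theorem antipodeHom_proj (a : Uq ℏ) : antipodeHom ℏ (proj ℏ a) =
    MulOpposite.op (proj ℏ (Uq.antipodeHom ℏ a).unop) := lift_proj ..

open Uq in
instance : Bialgebra ℂ (UqQuot ℏ) := Bialgebra.ofAlgHom (comulHom ℏ) (counitHom ℏ)
  (hom_ext fun s => by
    cases s <;> simp only [AlgHom.comp_apply, comulHom_proj, Uq.comulHom_gen] <;>
      simp only [comulGen, K1, K2, K1inv, K2inv, H1, H2, Xp, Xm, E, map_add, comulHom_proj,
        Algebra.TensorProduct.map_tmul, Uq.comulHom_gen, AlgHom.id_apply, map_one,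
        Algebra.TensorProduct.one_def, TensorProduct.add_tmul, TensorProduct.tmul_add] <;>
      simp [add_assoc])
  (hom_ext fun s => by
    cases s <;> simp only [AlgHom.comp_apply, comulHom_proj, Uq.comulHom_gen] <;>
      simp [comulGen, K1, K2, K1inv, K2inv, H1, H2, Xp, Xm, E, counitHom_proj, Uq.counitHom_gen,
        counitGen])
  (hom_ext fun s => by
    cases s <;> simp only [AlgHom.comp_apply, comulHom_proj, Uq.comulHom_gen] <;>
      simp [comulGen, K1, K2, K1inv, K2inv, H1, H2, Xp, Xm, E, counitHom_proj, Uq.counitHom_gen,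
        counitGen])

theorem antipodeAt_proj (a : Uq ℏ) : AntipodeAt (antipodeHom ℏ) (proj ℏ a) := by
  have h : AntipodeAt (Uq.antipodeHom ℏ) a :=
    Uq.induction (AntipodeAt.algebraMap _) (Uq.antipodeAt_gen ℏ)
      (fun _ _ => AntipodeAt.mul _) (fun _ _ => AntipodeAt.add _) a
  have hc : (CoalgebraStruct.comul (proj ℏ a) : UqQuot ℏ ⊗[ℂ] UqQuot ℏ) =
      Algebra.TensorProduct.map (proj ℏ) (proj ℏ) (CoalgebraStruct.comul a) := comulHom_proj ℏ a
  have he : (CoalgebraStruct.counit (proj ℏ a) : ℂ) = CoalgebraStruct.counit a :=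
    counitHom_proj ℏ a
  have hl (t : Uq ℏ ⊗[ℂ] Uq ℏ) : LinearMap.mul' ℂ _ ((antiLin (antipodeHom ℏ)).rTensor _
      (Algebra.TensorProduct.map (proj ℏ) (proj ℏ) t)) =
      proj ℏ (LinearMap.mul' ℂ _ ((antiLin (Uq.antipodeHom ℏ)).rTensor _ t)) := by
    induction t with
    | zero => simp
    | add s t hs ht => simp only [map_add, hs, ht]
    | tmul a b => simp [antiLin_apply, antipodeHom_proj]
  have hr (t : Uq ℏ ⊗[ℂ] Uq ℏ) : LinearMap.mul' ℂ _ ((antiLin (antipodeHom ℏ)).lTensor _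
      (Algebra.TensorProduct.map (proj ℏ) (proj ℏ) t)) =
      proj ℏ (LinearMap.mul' ℂ _ ((antiLin (Uq.antipodeHom ℏ)).lTensor _ t)) := by
    induction t with
    | zero => simp
    | add s t hs ht => simp only [map_add, hs, ht]
    | tmul a b => simp [antiLin_apply, antipodeHom_proj]
  rw [AntipodeAt, hc, he, hl, hr, h.1, h.2, AlgHom.commutes]
  exact ⟨rfl, rfl⟩

instance : HopfAlgebra ℂ (UqQuot ℏ) :=
  hopfOfAntipode (antipodeHom ℏ) fun a => by
    obtain ⟨a, rfl⟩ := proj_surjective ℏ a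
    exact antipodeAt_proj ℏ a

theorem isGroupLikeElem_g : IsGroupLikeElem ℂ (g ℏ) where
  counit_eq_one := (counitHom_proj ℏ _).trans (Uq.counitHom_gen ℏ _)
  comul_eq_tmul_self := (comulHom_proj ℏ _).trans
    (congrArg (Algebra.TensorProduct.map (proj ℏ) (proj ℏ)) (Uq.comulHom_gen ℏ _))

end UqQuot

/-! ### The superalgebra `U_q gl(1|1)` -/

/-- Generators of `U_q gl(1|1)`. The generator `E c n` stands for the exponential
`e^{c C + n N}`. -/
inductive GlGen
  | C | N | eta | etaP
  | E (c n : ℂ)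

namespace GlGen

/-- The generators in the free algebra. -/
abbrev free (s : GlGen) : FreeAlgebra ℂ GlGen := FreeAlgebra.ι ℂ s

end GlGen

open GlGen in
/-- The relations of `U_q gl(1|1)`, `q = e^ℏ`: the relations between `C, N, η, η⁺`, in which
`q^{±C} = e^{±ℏ C}`, and the relations that `[N, η] = -η`, `[N, η⁺] = η⁺` and the centrality of `C`
force on the exponentials `e^{c C + n N}`. -/
inductive GlRel (ℏ : ℂ) : FreeAlgebra ℂ GlGen → FreeAlgebra ℂ GlGen → Prop
  | C_N : GlRel ℏ (C.free * N.free) (N.free * C.free)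
  | C_eta : GlRel ℏ (C.free * eta.free) (eta.free * C.free)
  | C_etaP : GlRel ℏ (C.free * etaP.free) (etaP.free * C.free)
  | N_eta : GlRel ℏ (N.free * eta.free - eta.free * N.free) (-eta.free)
  | N_etaP : GlRel ℏ (N.free * etaP.free - etaP.free * N.free) etaP.free
  | eta_etaP : GlRel ℏ (eta.free * etaP.free + etaP.free * eta.free)
      ((Complex.exp ℏ - (Complex.exp ℏ)⁻¹)⁻¹ • ((E ℏ 0).free - (E (-ℏ) 0).free))
  | eta_eta : GlRel ℏ (eta.free * eta.free) 0
  | etaP_etaP : GlRel ℏ (etaP.free * etaP.free) 0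
  | E_zero : GlRel ℏ (E 0 0).free 1
  | E_add (c n c' n' : ℂ) :
      GlRel ℏ ((E c n).free * (E c' n').free) (E (c + c') (n + n')).free
  | E_C (c n : ℂ) : GlRel ℏ ((E c n).free * C.free) (C.free * (E c n).free)
  | E_N (c n : ℂ) : GlRel ℏ ((E c n).free * N.free) (N.free * (E c n).free)
  | E_eta (c n : ℂ) : GlRel ℏ ((E c n).free * eta.free)
      (Complex.exp (-n) • (eta.free * (E c n).free))
  | E_etaP (c n : ℂ) : GlRel ℏ ((E c n).free * etaP.free)
      (Complex.exp n • (etaP.free * (E c n).free))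

/-- The algebra underlying `U_q gl(1|1)` over `ℂ` with `q = e^ℏ`. -/
def Gl (ℏ : ℂ) : Type := RingQuot (GlRel ℏ)

instance (ℏ : ℂ) : Ring (Gl ℏ) := inferInstanceAs (Ring (RingQuot (GlRel ℏ)))

instance (ℏ : ℂ) : Algebra ℂ (Gl ℏ) := inferInstanceAs (Algebra ℂ (RingQuot (GlRel ℏ)))

namespace Gl

variable (ℏ : ℂ)

/-- The image of a generator in `U_q gl(1|1)`. -/
def gen (s : GlGen) : Gl ℏ := RingQuot.mkAlgHom ℂ (GlRel ℏ) s.free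

def C : Gl ℏ := gen ℏ .C
def N : Gl ℏ := gen ℏ .N
def eta : Gl ℏ := gen ℏ .eta
def etaP : Gl ℏ := gen ℏ .etaP

/-- `e^{c C + n N}` -/
def E (c n : ℂ) : Gl ℏ := gen ℏ (.E c n)

/-- `q^{a C + b N}` -/
def qpow (a b : ℂ) : Gl ℏ := E ℏ (ℏ * a) (ℏ * b)

variable {ℏ}

/-- The super-Hopf algebra structure of `U_q gl(1|1)`: `C`, `N` and their exponentials are even,
`η`, `η⁺` are odd, and the coproduct takes the given values on the generators. A super-Hopf algebra
structure is determined by these values. -/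
structure IsStandard (D : SuperHopfAlgebra (Gl ℏ)) : Prop where
  parity_C : D.parity (C ℏ) = C ℏ
  parity_N : D.parity (N ℏ) = N ℏ
  parity_E : ∀ c n, D.parity (E ℏ c n) = E ℏ c n
  parity_eta : D.parity (eta ℏ) = -eta ℏ
  parity_etaP : D.parity (etaP ℏ) = -etaP ℏ
  comul_C : D.comul (C ℏ) = C ℏ ⊗ₜ 1 + 1 ⊗ₜ C ℏ
  comul_N : D.comul (N ℏ) = N ℏ ⊗ₜ 1 + 1 ⊗ₜ N ℏ
  comul_E : ∀ c n, D.comul (E ℏ c n) = E ℏ c n ⊗ₜ E ℏ c n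
  comul_eta : D.comul (eta ℏ) = eta ℏ ⊗ₜ qpow ℏ 1 (-1) + qpow ℏ 0 (-1) ⊗ₜ eta ℏ
  comul_etaP : D.comul (etaP ℏ) = etaP ℏ ⊗ₜ qpow ℏ 0 1 + qpow ℏ (-1) 1 ⊗ₜ etaP ℏ

variable (ℏ)

/-- The homomorphisms from `U_q gl(1|1)` to Banach algebras under which the elements
`e^{c C + n N}` go to actual exponentials. -/
def IsPoint : SuperHopfAlgebra.PointClass (Gl ℏ) := fun _ _ _ _ x =>
  ∀ c n : ℂ, x (E ℏ c n) = NormedSpace.exp (c • x (C ℏ) + n • x (N ℏ))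

/-- `q^{-(C ⊗ N + N ⊗ C)} (1 ⊗ 1 + (1 - q²) q^N η ⊗ q^{-N} η⁺)` evaluated at `x, y`. -/
def R {B : Type} [NormedRing B] [NormedAlgebra ℂ B] (x y : Gl ℏ →ₐ[ℂ] B) : B :=
  NormedSpace.exp ((-ℏ) • (x (C ℏ) * y (N ℏ) + x (N ℏ) * y (C ℏ))) *
    (1 + (1 - Complex.exp ℏ ^ 2) • (x (qpow ℏ 0 1 * eta ℏ) * y (qpow ℏ 0 (-1) * etaP ℏ)))

/-- `q^{C ⊗ C}` evaluated at `x, y`. -/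
def qCC {B : Type} [NormedRing B] [NormedAlgebra ℂ B] (x y : Gl ℏ →ₐ[ℂ] B) : B :=
  NormedSpace.exp (ℏ • (x (C ℏ) * y (C ℏ)))

end Gl

/-- The relation `e^{2πiN} = 1`. -/
def GlQuotRel (ℏ : ℂ) (a b : Gl ℏ) : Prop :=
  a = Gl.E ℏ 0 (2 * Real.pi * Complex.I) ∧ b = 1

/-- The algebra underlying the quotient of `U_q gl(1|1)` by the two-sided ideal generated by
`e^{2πiN} - 1`. -/
def GlQuot (ℏ : ℂ) : Type := RingQuot (GlQuotRel ℏ)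

instance (ℏ : ℂ) : Ring (GlQuot ℏ) := inferInstanceAs (Ring (RingQuot (GlQuotRel ℏ)))

instance (ℏ : ℂ) : Algebra ℂ (GlQuot ℏ) := inferInstanceAs (Algebra ℂ (RingQuot (GlQuotRel ℏ)))

namespace GlQuot

variable (ℏ : ℂ)

/-- The projection. -/
def proj : Gl ℏ →ₐ[ℂ] GlQuot ℏ := RingQuot.mkAlgHom ℂ (GlQuotRel ℏ)

/-- The homomorphisms from the quotient to Banach algebras under which the elements
`e^{c C + n N}` go to actual exponentials. -/
def IsPoint : SuperHopfAlgebra.PointClass (GlQuot ℏ) := fun B _ _ _ x =>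
  Gl.IsPoint ℏ B (x.comp (proj ℏ))

end GlQuot

/-! ### The universal `R`-matrix of `U_q(H₁, H₂, X^±)` -/

namespace Uq

variable (ℏ : ℂ)

/-- The homomorphisms from `U_q(H₁, H₂, X^±)` to Banach algebras under which the elements
`e^{z H₁ + w H₂}` go to actual exponentials. -/
def IsPoint : SuperHopfAlgebra.PointClass (Uq ℏ) := fun _ _ _ _ x =>
  ∀ z w : ℂ, x (E ℏ z w) = NormedSpace.exp (z • x (H1 ℏ) + w • x (H2 ℏ))

/-- `e^{-iπ/4 H₂ ⊗ H₂} q^{(H₁ ⊗ H₁ - H₂ ⊗ H₂)/4} (1 ⊗ 1 + (1 - q²) K₂ X⁺ ⊗ K₂⁻¹ X⁻)`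
evaluated at `x, y`. -/
def R {B : Type} [NormedRing B] [NormedAlgebra ℂ B] (x y : Uq ℏ →ₐ[ℂ] B) : B :=
  NormedSpace.exp ((-(Complex.I * Real.pi / 4)) • (x (H2 ℏ) * y (H2 ℏ))) *
    NormedSpace.exp ((ℏ / 4) • (x (H1 ℏ) * y (H1 ℏ) - x (H2 ℏ) * y (H2 ℏ))) *
    (1 + (1 - Complex.exp ℏ ^ 2) • (x (K2 ℏ * Xp ℏ) * y (K2inv ℏ * Xm ℏ)))

/-- The central element `C = (H₁ + H₂) / 2`. -/
def C : Uq ℏ := (1 / 2 : ℂ) • (H1 ℏ + H2 ℏ)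

/-- `q^{-C ⊗ C}` evaluated at `x, y`. -/
def qCCinv {B : Type} [NormedRing B] [NormedAlgebra ℂ B] (x y : Uq ℏ →ₐ[ℂ] B) : B :=
  NormedSpace.exp ((-ℏ) • (x (C ℏ) * y (C ℏ)))

end Uq

namespace UqQuot

variable (ℏ : ℂ)

/-- The homomorphisms from the quotient to Banach algebras under which the elements
`e^{z H₁ + w H₂}` go to actual exponentials. -/
def IsPoint : SuperHopfAlgebra.PointClass (UqQuot ℏ) := fun B _ _ _ x =>
  Uq.IsPoint ℏ B (x.comp (proj ℏ))

/-- The `R`-matrix of `U_q(H₁, H₂, X^±)` in the quotient by `g² = 1`. -/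
def R : (SuperHopfAlgebra.ofHopf (UqQuot ℏ)).PairFamily := fun _ _ _ _ x y _ =>
  Uq.R ℏ (x.comp (proj ℏ)) (y.comp (proj ℏ))

/-- The `R`-matrix `q^{-C ⊗ C} R` in the quotient by `g² = 1`, with `C = (H₁ + H₂) / 2`. -/
def R' : (SuperHopfAlgebra.ofHopf (UqQuot ℏ)).PairFamily := fun _ _ _ _ x y _ =>
  Uq.qCCinv ℏ (x.comp (proj ℏ)) (y.comp (proj ℏ)) * Uq.R ℏ (x.comp (proj ℏ)) (y.comp (proj ℏ))

/-- The superization of the quotient Hopf algebra, with respect to the image of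
`g = e^{iπH₂/2}`. -/
def super : SuperHopfAlgebra (UqQuot ℏ) :=
  superization (g ℏ) (isGroupLikeElem_g ℏ) (g_mul_g ℏ)

/-- The superization of a quasitriangular structure of the quotient. -/
def superR (T : (SuperHopfAlgebra.ofHopf (UqQuot ℏ)).PairFamily) : (super ℏ).PairFamily :=
  Superization.universalR (isGroupLikeElem_g ℏ) (g_mul_g ℏ) T

end UqQuot

end

/-! All the quasitriangular structures come from one calculation. Both `Uq ℏ` and `Gl ℏ` are
generated by commuting primitive elements hᵢ, their group-like exponentials, and one pair of skew
primitive root vectors X, Y of weights α and -α and square zero, with XY - εYX = (q -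
q⁻¹)⁻¹(E(k₁+k₂) - E(-(k₁+k₂))). The sign ε is 1 in the ordinary case and -1 in the super case;
`RootDatum` treats both at once. Put e = E(k₂)X and f = E(-k₂)Y. For symmetric β the element exp(∑
βᵢⱼ hᵢ ⊗ hⱼ)(1 + (1 - q²) e ⊗ f) is a universal R-matrix as soon as ∑ᵢ αᵢβᵢⱼ = (k₁+k₂)ⱼ, because
this condition makes the exponential turn X ⊗ 1 into X ⊗ E(k₁+k₂) when one moves past the other. The
nilpotent factor handles the commutator of X and Y, and e² = f² = 0 removes the unwanted cross terms
in the two coproduct identities. The condition fixes β only up to symmetric forms that vanish on α.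
Since C = (H₁+H₂)/2 has weight zero, both `Uq.R` and its product with q^{-C⊗C} are covered
(`RootDatum.isUniversalR`, `Uq.isUniversalR'`).

The super-Hopf structure on `Gl ℏ` is obtained from algebra homomorphisms: the super tensor square
and the super opposite algebra are made into genuine algebras by twisting a product with a sign
(`Twisted`). A coproduct and an antipode are then defined by checking relations, and the axioms need
verification on generators only (`SuperHopfAlgebra.ofAlgHom`).

The two quotients are isomorphic as algebras by explicit mutually inverse maps. The quotient of `Gl
ℏ` receives the superized structure by transport along this isomorphism, so the isomorphism is a
super-Hopf map by construction. What has to be shown is that the projection from `Gl ℏ` respects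
that structure, which is a comparison on generators. The R-matrix then descends along the surjection
(`IsUniversalR.of_isHom`).

For the superized R-matrices, the essential point is analytic. Under N = H₂/2 the factor e^{-iπ/4
H₂⊗H₂} becomes e^{-iπ N⊗N}, whereas superization contributes 1 - 2p ⊗ p with p = (1 - e^{iπN})/2. In
a Banach algebra an element a with e^{2πia} = 1 is diagonalizable with integer eigenvalues: the
Fourier coefficients of t ↦ e^{2πita} are eigenprojections, only finitely many are nonzero, and they
sum to 1. Hence e^{-iπ N⊗N} and 1 - 2p ⊗ p agree (`exp_pi_I_mul_eq`), their product is 1, and the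
remaining exponent (H₁⊗H₁ - H₂⊗H₂)/4 equals C⊗C - C⊗N - N⊗C (`UqQuot.superR_eq`). -/

noncomputable section

/-! ### Twisted products -/

/-- Two commuting involutive automorphisms of an algebra. -/
structure Twisting (R : Type*) [Ring R] [Algebra ℂ R] where
  p : R →ₐ[ℂ] R
  r : R →ₐ[ℂ] R
  p_p : ∀ x, p (p x) = x
  r_r : ∀ x, r (r x) = x
  r_p : ∀ x, r (p x) = p (r x)

/-- The algebra `R` with the product `(x, y) ↦ (-1)^{|x||y|} x y`, where the degree of the left
factor is given by `r` and that of the right factor by `p`. -/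
def Twisted {R : Type*} [Ring R] [Algebra ℂ R] (_ : Twisting R) : Type _ := R

namespace Twisted

variable {R : Type*} [Ring R] [Algebra ℂ R] {t : Twisting R}

instance : AddCommGroup (Twisted t) := inferInstanceAs (AddCommGroup R)
instance : Module ℂ (Twisted t) := inferInstanceAs (Module ℂ R)

variable (t) in
/-- The identity map to the twisted algebra. -/
def of : R ≃ₗ[ℂ] Twisted t := LinearEquiv.refl ℂ R

instance : One (Twisted t) := ⟨of t 1⟩

instance : Mul (Twisted t) := ⟨fun x y => of t ((1 / 2 : ℂ) •
  ((of t).symm x * (of t).symm y + (of t).symm x * t.p ((of t).symm y)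
    + t.r ((of t).symm x) * (of t).symm y - t.r ((of t).symm x) * t.p ((of t).symm y)))⟩

theorem one_def : (1 : Twisted t) = of t 1 := rfl

theorem of_mul_of (x y : R) : of t x * of t y =
    of t ((1 / 2 : ℂ) • (x * y + x * t.p y + t.r x * y - t.r x * t.p y)) := rfl

theorem of_mul_of_right {x y : R} (hy : t.p y = y) : of t x * of t y = of t (x * y) := by
  rw [of_mul_of, hy]; congr 1; module

theorem of_mul_of_left {x y : R} (hx : t.r x = x) : of t x * of t y = of t (x * y) := by
  rw [of_mul_of, hx]; congr 1; module

theorem of_mul_of_odd {x y : R} (hx : t.r x = -x) : of t x * of t y = of t (x * t.p y) := by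
  rw [of_mul_of, hx]; congr 1; simp only [neg_mul]; module

protected theorem add_mul (x y z : Twisted t) : (x + y) * z = x * z + y * z := by
  obtain ⟨x, rfl⟩ := (of t).surjective x
  obtain ⟨y, rfl⟩ := (of t).surjective y
  obtain ⟨z, rfl⟩ := (of t).surjective z
  simp only [← map_add, of_mul_of]
  congr 1
  simp only [map_add, add_mul]
  module

protected theorem mul_add (x y z : Twisted t) : x * (y + z) = x * y + x * z := by
  obtain ⟨x, rfl⟩ := (of t).surjective x
  obtain ⟨y, rfl⟩ := (of t).surjective y
  obtain ⟨z, rfl⟩ := (of t).surjective z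
  simp only [← map_add, of_mul_of]
  congr 1
  simp only [map_add, mul_add]
  module

/-- Since `t.p` and `t.r` are automorphisms, both degrees are additive on products. Either
bracketing of homogeneous x, y, z therefore carries the sign with exponent |x||y| + |x||z| + |y||z|,
where the left degree is taken by `t.r` and the right one by `t.p`. -/
protected theorem mul_assoc (x y z : Twisted t) : x * y * z = x * (y * z) := by
  obtain ⟨x, rfl⟩ := (of t).surjective x
  obtain ⟨y, rfl⟩ := (of t).surjective y
  obtain ⟨z, rfl⟩ := (of t).surjective z
  simp only [of_mul_of]
  congr 1
  simp only [map_smul, map_add, map_sub, map_mul, t.p_p, t.r_r, t.r_p, smul_mul_assoc,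
    mul_smul_comm, mul_add, add_mul, mul_sub, sub_mul, smul_add, smul_sub, mul_assoc]
  module

instance : Ring (Twisted t) where
  __ := (inferInstance : AddCommGroup (Twisted t))
  left_distrib := Twisted.mul_add
  right_distrib := Twisted.add_mul
  mul_assoc := Twisted.mul_assoc
  one_mul x := (of_mul_of_left (map_one t.r)).trans (one_mul (M := R) x)
  mul_one x := (of_mul_of_right (map_one t.p)).trans (mul_one (M := R) x)
  zero_mul x := by
    have h := Twisted.add_mul 0 0 x
    rwa [add_zero, left_eq_add] at h
  mul_zero x := by
    have h := Twisted.mul_add x 0 0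
    rwa [add_zero, left_eq_add] at h

instance : Algebra ℂ (Twisted t) := Algebra.ofModule
  (fun c x y => by
    obtain ⟨x, rfl⟩ := (of t).surjective x
    obtain ⟨y, rfl⟩ := (of t).surjective y
    rw [← map_smul, of_mul_of, of_mul_of, ← map_smul]
    refine congrArg (of t) ?_
    simp only [map_smul, smul_mul_assoc]
    module)
  (fun c x y => by
    obtain ⟨x, rfl⟩ := (of t).surjective x
    obtain ⟨y, rfl⟩ := (of t).surjective y
    rw [← map_smul, of_mul_of, of_mul_of, ← map_smul]
    refine congrArg (of t) ?_
    simp only [map_smul, mul_smul_comm]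
    module)

/-- A homomorphism that commutes with the twistings is a homomorphism of the twisted algebras. -/
def map {R' : Type*} [Ring R'] [Algebra ℂ R'] {t' : Twisting R'} (f : R →ₐ[ℂ] R')
    (hp : ∀ x, f (t.p x) = t'.p (f x)) (hr : ∀ x, f (t.r x) = t'.r (f x)) :
    Twisted t →ₐ[ℂ] Twisted t' :=
  AlgHom.ofLinearMap ((of t').toLinearMap ∘ₗ f.toLinearMap ∘ₗ (of t).symm.toLinearMap)
    (congrArg (of t') (map_one f)) (fun x y => by
      obtain ⟨x, rfl⟩ := (of t).surjective x
      obtain ⟨y, rfl⟩ := (of t).surjective y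
      simp [of_mul_of, hp, hr])

/-- A homomorphism that is invariant under `p` remains one on the twisted algebra. -/
def lift {S : Type*} [Ring S] [Algebra ℂ S] (f : R →ₐ[ℂ] S)
    (h : (∀ x, f (t.p x) = f x) ∨ ∀ x, f (t.r x) = f x) : Twisted t →ₐ[ℂ] S :=
  AlgHom.ofLinearMap (f.toLinearMap ∘ₗ (of t).symm.toLinearMap) (map_one f) (fun x y => by
      obtain ⟨x, rfl⟩ := (of t).surjective x
      obtain ⟨y, rfl⟩ := (of t).surjective y
      -- Invariance under either automorphism suffices: two of the four terms of the twisted product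
      -- cancel and the other two are equal.
      rcases h with h | h
      · simp only [of_mul_of, LinearMap.comp_apply, LinearEquiv.coe_coe, LinearEquiv.symm_apply_apply,
          AlgHom.toLinearMap_apply, map_smul, map_add, map_sub, map_mul, h]
        module
      · simp only [of_mul_of, LinearMap.comp_apply, LinearEquiv.coe_coe, LinearEquiv.symm_apply_apply,
          AlgHom.toLinearMap_apply, map_smul, map_add, map_sub, map_mul, h]
        module)

theorem lift_of {S : Type*} [Ring S] [Algebra ℂ S] (f : R →ₐ[ℂ] S)
    (h : (∀ x, f (t.p x) = f x) ∨ ∀ x, f (t.r x) = f x) (x : R) : lift f h (of t x) = f x := rfl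

end Twisted

/-! ### Super tensor products -/

/-- A `ℤ/2`-grading on an algebra, given by its parity automorphism. -/
class Superalgebra (A : Type*) [Ring A] [Algebra ℂ A] where
  parity : A →ₐ[ℂ] A
  parity_parity : ∀ a, parity (parity a) = a

section SuperTensor

variable (A B C : Type*) [Ring A] [Algebra ℂ A] [Superalgebra A] [Ring B] [Algebra ℂ B]
  [Superalgebra B] [Ring C] [Algebra ℂ C] [Superalgebra C]

/-- The parity of a superalgebra. -/
abbrev par {A : Type*} [Ring A] [Algebra ℂ A] [Superalgebra A] : A →ₐ[ℂ] A := Superalgebra.parity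

/-- The twisting of `A ⊗ B` by the parity of the first leg of the right factor and the parity of
the second leg of the left factor. -/
def tensorTwisting : Twisting (A ⊗[ℂ] B) where
  p := Algebra.TensorProduct.map par (AlgHom.id ℂ B)
  r := Algebra.TensorProduct.map (AlgHom.id ℂ A) par
  p_p x := by
    induction x with
    | zero => simp
    | add x y hx hy => simp only [map_add, hx, hy]
    | tmul a b => simp [Superalgebra.parity_parity]
  r_r x := by
    induction x with
    | zero => simp
    | add x y hx hy => simp only [map_add, hx, hy]
    | tmul a b => simp [Superalgebra.parity_parity]
  r_p x := by
    induction x with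
    | zero => simp
    | add x y hx hy => simp only [map_add, hx, hy]
    | tmul a b => simp

variable {A B} in
@[simp] theorem tensorTwisting_p (a : A) (b : B) :
    (tensorTwisting A B).p (a ⊗ₜ b) = par a ⊗ₜ b := rfl

variable {A B} in
@[simp] theorem tensorTwisting_r (a : A) (b : B) :
    (tensorTwisting A B).r (a ⊗ₜ b) = a ⊗ₜ par b := rfl

/-- The super tensor product. -/
abbrev SuperTensor : Type _ := Twisted (tensorTwisting A B)

/-- The super opposite algebra, with the product `(a, b) ↦ (-1)^{|a||b|} b a`. -/
abbrev SuperOpposite : Type _ := Twisted (R := Aᵐᵒᵖ)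
  { p := AlgHom.op par
    r := AlgHom.op par
    p_p := fun x => congrArg MulOpposite.op (Superalgebra.parity_parity x.unop)
    r_r := fun x => congrArg MulOpposite.op (Superalgebra.parity_parity x.unop)
    r_p := fun _ => rfl }

variable {A B C}

namespace SuperTensor

/-- A pure tensor in the super tensor product. -/
abbrev tmul (a : A) (b : B) : SuperTensor A B := Twisted.of (tensorTwisting A B) (a ⊗ₜ b)

/-- This form needs no homogeneity, so it serves in calculations with arbitrary legs; the three
special cases that follow are for generators. -/
theorem tmul_mul_tmul (a c : A) (b d : B) : tmul a b * tmul c d = (1 / 2 : ℂ) •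
    (tmul (a * c) (b * d) + tmul (a * par c) (b * d) + tmul (a * c) (par b * d)
      - tmul (a * par c) (par b * d)) := by
  rw [Twisted.of_mul_of]
  simp

theorem tmul_mul_tmul_left (a c : A) {b : B} (d : B) (hb : par b = b) :
    tmul a b * tmul c d = tmul (a * c) (b * d) :=
  (Twisted.of_mul_of_left (by simp [hb])).trans (by simp)

theorem tmul_mul_tmul_right (a : A) {c : A} (b d : B) (hc : par c = c) :
    tmul a b * tmul c d = tmul (a * c) (b * d) :=
  (Twisted.of_mul_of_right (by simp [hc])).trans (by simp)

theorem tmul_mul_tmul_odd (a : A) {c : A} {b : B} (d : B) (hb : par b = -b) (hc : par c = -c) :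
    tmul a b * tmul c d = -tmul (a * c) (b * d) :=
  (Twisted.of_mul_of_odd (by simp [hb, TensorProduct.tmul_neg])).trans
    (by simp [hc, TensorProduct.neg_tmul])

theorem tmul_add (a : A) (b b' : B) : tmul a (b + b') = tmul a b + tmul a b' := by
  simp [tmul, TensorProduct.tmul_add]
theorem add_tmul (a a' : A) (b : B) : tmul (a + a') b = tmul a b + tmul a' b := by
  simp [tmul, TensorProduct.add_tmul]
theorem tmul_sub (a : A) (b b' : B) : tmul a (b - b') = tmul a b - tmul a b' := by
  simp [tmul, TensorProduct.tmul_sub]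
theorem sub_tmul (a a' : A) (b : B) : tmul (a - a') b = tmul a b - tmul a' b := by
  simp [tmul, TensorProduct.sub_tmul]
theorem tmul_smul (c : ℂ) (a : A) (b : B) : tmul a (c • b) = c • tmul a b := by
  simp [tmul, TensorProduct.tmul_smul]
theorem smul_tmul (c : ℂ) (a : A) (b : B) : tmul (c • a) b = c • tmul a b := by
  simp [tmul, ← TensorProduct.smul_tmul']
theorem tmul_neg (a : A) (b : B) : tmul a (-b) = -tmul a b := by
  simp [tmul, TensorProduct.tmul_neg]
theorem neg_tmul (a : A) (b : B) : tmul (-a) b = -tmul a b := by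
  simp [tmul, TensorProduct.neg_tmul]
theorem tmul_zero (a : A) : tmul a (0 : B) = 0 := by simp [tmul]
theorem zero_tmul (b : B) : tmul (0 : A) b = 0 := by simp [tmul]

theorem one_def : (1 : SuperTensor A B) = tmul 1 1 := rfl

/-- The super tensor product of even homomorphisms. -/
def map {A' B' : Type*} [Ring A'] [Algebra ℂ A'] [Superalgebra A'] [Ring B'] [Algebra ℂ B']
    [Superalgebra B'] (f : A →ₐ[ℂ] A') (g : B →ₐ[ℂ] B') (hf : ∀ a, f (par a) = par (f a))
    (hg : ∀ b, g (par b) = par (g b)) : SuperTensor A B →ₐ[ℂ] SuperTensor A' B' :=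
  Twisted.map (Algebra.TensorProduct.map f g)
    (fun x => by
      induction x with
      | zero => simp
      | add x y hx hy => simp only [map_add, hx, hy]
      | tmul a b => simp [hf])
    (fun x => by
      induction x with
      | zero => simp
      | add x y hx hy => simp only [map_add, hx, hy]
      | tmul a b => simp [hg])

theorem map_tmul {A' B' : Type*} [Ring A'] [Algebra ℂ A'] [Superalgebra A'] [Ring B']
    [Algebra ℂ B'] [Superalgebra B'] (f : A →ₐ[ℂ] A') (g : B →ₐ[ℂ] B')
    (hf : ∀ a, f (par a) = par (f a)) (hg : ∀ b, g (par b) = par (g b)) (a : A) (b : B) :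
    map f g hf hg (tmul a b) = tmul (f a) (g b) := rfl

instance : Superalgebra (SuperTensor A B) where
  parity := map par par (fun _ => rfl) (fun _ => rfl)
  parity_parity x := by
    obtain ⟨x, rfl⟩ := (Twisted.of _).surjective x
    induction x with
    | zero => simp
    | add x y hx hy => simp only [map_add, hx, hy]
    | tmul a b => simp [map_tmul, Superalgebra.parity_parity]

theorem par_tmul (a : A) (b : B) : par (tmul a b) = tmul (par a) (par b) := rfl

/-- The associativity of the super tensor product. -/
def assoc : SuperTensor (SuperTensor A B) C →ₐ[ℂ] SuperTensor A (SuperTensor B C) :=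
  AlgHom.ofLinearMap ((Twisted.of _).toLinearMap ∘ₗ
      (Twisted.of (tensorTwisting B C)).toLinearMap.lTensor A ∘ₗ
      (TensorProduct.assoc ℂ A B C).toLinearMap ∘ₗ
      (Twisted.of (tensorTwisting A B)).symm.toLinearMap.rTensor C ∘ₗ
      (Twisted.of (tensorTwisting (SuperTensor A B) C)).symm.toLinearMap)
    rfl
    (fun x y => by
      obtain ⟨x, rfl⟩ := (Twisted.of _).surjective x
      obtain ⟨y, rfl⟩ := (Twisted.of _).surjective y
      set f := (Twisted.of _).toLinearMap ∘ₗ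
        (Twisted.of (tensorTwisting B C)).toLinearMap.lTensor A ∘ₗ
        (TensorProduct.assoc ℂ A B C).toLinearMap ∘ₗ
        (Twisted.of (tensorTwisting A B)).symm.toLinearMap.rTensor C ∘ₗ
        (Twisted.of (tensorTwisting (SuperTensor A B) C)).symm.toLinearMap with hf
      have hf (a : A) (b : B) (c : C) : f (tmul (tmul a b) c) = tmul a (tmul b c) := rfl
      -- Only the values of `f` on pure tensors are kept. On these both bracketings produce the same
      -- three signs, from b past a', c past a' and c past b'.
      clear_value f
      induction x with
      | zero => simp
      | add x y hx hy => simp only [map_add, add_mul, hx, hy]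
      | tmul x c =>
        induction y with
        | zero => simp
        | add x y hx hy => simp only [map_add, mul_add, hx, hy]
        | tmul y c' =>
          obtain ⟨x, rfl⟩ := (Twisted.of _).surjective x
          obtain ⟨y, rfl⟩ := (Twisted.of _).surjective y
          induction x with
          | zero => simp
          | add x y hx hy => simp only [map_add, TensorProduct.add_tmul, add_mul, hx, hy]
          | tmul a b =>
            induction y with
            | zero => simp
            | add x y hx hy => simp only [map_add, TensorProduct.add_tmul, mul_add, hx, hy]
            | tmul a' b' =>
              change f (tmul (tmul a b) c * tmul (tmul a' b') c') =
                f (tmul (tmul a b) c) * f (tmul (tmul a' b') c')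
              simp only [tmul_mul_tmul, par_tmul, smul_tmul, tmul_smul, add_tmul, tmul_add,
                sub_tmul, tmul_sub, map_add, map_sub, map_smul, hf, map_mul,
                Superalgebra.parity_parity]
              module)

theorem assoc_tmul (a : A) (b : B) (c : C) : assoc (tmul (tmul a b) c) = tmul a (tmul b c) := rfl

end SuperTensor

end SuperTensor

/-! ### Super-Hopf algebras from homomorphisms -/

namespace SuperOpposite

variable {A : Type*} [Ring A] [Algebra ℂ A] [Superalgebra A]

/-- The canonical map to the super opposite algebra. -/
def op : A ≃ₗ[ℂ] SuperOpposite A := (MulOpposite.opLinearEquiv ℂ).trans (Twisted.of _)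

theorem op_one : op (1 : A) = 1 := rfl

theorem op_mul_op (a b : A) : op a * op b =
    op ((1 / 2 : ℂ) • (b * a + par b * a + b * par a - par b * par a)) := rfl

theorem op_mul_op_left {a : A} (b : A) (ha : par a = a) : op a * op b = op (b * a) := by
  rw [op_mul_op, ha]; congr 1; module

theorem op_mul_op_right (a : A) {b : A} (hb : par b = b) : op a * op b = op (b * a) := by
  rw [op_mul_op, hb]; congr 1; module

theorem op_mul_op_odd {a b : A} (ha : par a = -a) (hb : par b = -b) :
    op a * op b = -op (b * a) := by
  rw [op_mul_op, ha, hb, ← map_neg]; congr 1; simp only [neg_mul, mul_neg, neg_neg]; module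

/-- The parity as an automorphism of the super opposite algebra. -/
def parity : SuperOpposite A →ₐ[ℂ] SuperOpposite A :=
  Twisted.map (AlgHom.op par) (fun _ => rfl) (fun _ => rfl)

theorem parity_op (a : A) : parity (op a) = op (par a) := rfl

variable (S : A →ₐ[ℂ] SuperOpposite A)

/-- The linear map underlying a super-anti-homomorphism. -/
def lin : A →ₗ[ℂ] A := op.symm.toLinearMap ∘ₗ S.toLinearMap

theorem op_lin (a : A) : op (lin S a) = S a := op.apply_symm_apply (S a)

theorem lin_eq {a b : A} (h : S a = op b) : lin S a = b := op.symm_apply_eq.2 h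

variable {S}

theorem lin_mul (a b : A) : lin S (a * b) = (1 / 2 : ℂ) • (lin S b * lin S a
    + par (lin S b) * lin S a + lin S b * par (lin S a) - par (lin S b) * par (lin S a)) :=
  lin_eq S (by rw [map_mul, ← op_lin, ← op_lin, op_mul_op])


/-- Write F for the map a ⊗ b ↦ S(a)b. On homogeneous elements F(s(c ⊗ d)) = ±S(c)F(s)d with sign
exponent |c||s|: one part comes from the super product, the other from S reversing ac. If F(s) is a
scalar it moves out. The sign is written through `par s`, which is why the hypothesis is needed at
`par s` as well. -/
theorem mul_rTensor_mul (hS : ∀ a, lin S (par a) = par (lin S a)) (s t : SuperTensor A A) (r : ℂ)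
    (hs : LinearMap.mul' ℂ A ((lin S).rTensor A ((Twisted.of _).symm s)) = algebraMap ℂ A r)
    (hs' : LinearMap.mul' ℂ A ((lin S).rTensor A ((Twisted.of _).symm (par s))) =
      algebraMap ℂ A r) :
    LinearMap.mul' ℂ A ((lin S).rTensor A ((Twisted.of _).symm (s * t))) =
      r • LinearMap.mul' ℂ A ((lin S).rTensor A ((Twisted.of _).symm t)) := by
  obtain ⟨t, rfl⟩ := (Twisted.of _).surjective t
  induction t with
  | zero => simp
  | add t t' h h' => simp only [map_add, mul_add, h, h', smul_add]
  | tmul c d =>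
    set F : SuperTensor A A →ₗ[ℂ] A := LinearMap.mul' ℂ A ∘ₗ (lin S).rTensor A ∘ₗ
      (Twisted.of _).symm.toLinearMap with hF
    have hF' (a b : A) : F (SuperTensor.tmul a b) = lin S a * b := rfl
    change F s = _ at hs
    change F (par s) = _ at hs'
    change F (s * SuperTensor.tmul c d) = r • F (SuperTensor.tmul c d)
    clear_value F
    have key : F (s * SuperTensor.tmul c d) = (1 / 2 : ℂ) • (lin S c * F s * d
        + lin S (par c) * F s * d + lin S c * F (par s) * d - lin S (par c) * F (par s) * d) := by
      clear hs hs'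
      obtain ⟨s, rfl⟩ := (Twisted.of _).surjective s
      induction s with
      | zero => simp
      | add s s' h h' => simp only [map_add, add_mul, mul_add, h, h']; module
      | tmul a b =>
        change F (SuperTensor.tmul a b * SuperTensor.tmul c d) = (1 / 2 : ℂ) •
          (lin S c * F (SuperTensor.tmul a b) * d + lin S (par c) * F (SuperTensor.tmul a b) * d
            + lin S c * F (par (SuperTensor.tmul a b)) * d
            - lin S (par c) * F (par (SuperTensor.tmul a b)) * d)
        simp only [SuperTensor.tmul_mul_tmul, SuperTensor.par_tmul, map_smul, map_add, map_sub,
          hF', lin_mul, hS, Superalgebra.parity_parity, smul_mul_assoc, add_mul, sub_mul, mul_assoc]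
        module
    rw [key, hs, hs', hF', Algebra.algebraMap_eq_smul_one]
    simp only [mul_smul_comm, smul_mul_assoc, mul_one]
    module

/-- The mirror image: for a ⊗ b ↦ aS(b) it is the right factor that collapses to a scalar in the
middle. -/
theorem mul_lTensor_mul (hS : ∀ a, lin S (par a) = par (lin S a)) (s t : SuperTensor A A) (r : ℂ)
    (ht : LinearMap.mul' ℂ A ((lin S).lTensor A ((Twisted.of _).symm t)) = algebraMap ℂ A r)
    (ht' : LinearMap.mul' ℂ A ((lin S).lTensor A ((Twisted.of _).symm (par t))) =
      algebraMap ℂ A r) :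
    LinearMap.mul' ℂ A ((lin S).lTensor A ((Twisted.of _).symm (s * t))) =
      r • LinearMap.mul' ℂ A ((lin S).lTensor A ((Twisted.of _).symm s)) := by
  obtain ⟨s, rfl⟩ := (Twisted.of _).surjective s
  induction s with
  | zero => simp
  | add t t' h h' => simp only [map_add, add_mul, h, h', smul_add]
  | tmul c d =>
    set F : SuperTensor A A →ₗ[ℂ] A := LinearMap.mul' ℂ A ∘ₗ (lin S).lTensor A ∘ₗ
      (Twisted.of _).symm.toLinearMap with hF
    have hF' (a b : A) : F (SuperTensor.tmul a b) = a * lin S b := rfl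
    change F t = _ at ht
    change F (par t) = _ at ht'
    change F (SuperTensor.tmul c d * t) = r • F (SuperTensor.tmul c d)
    clear_value F
    have key : F (SuperTensor.tmul c d * t) = (1 / 2 : ℂ) • (c * F t * lin S d
        + c * F t * lin S (par d) + c * F (par t) * lin S d - c * F (par t) * lin S (par d)) := by
      clear ht ht'
      obtain ⟨t, rfl⟩ := (Twisted.of _).surjective t
      induction t with
      | zero => simp
      | add s s' h h' => simp only [map_add, add_mul, mul_add, h, h']; module
      | tmul a b =>
        change F (SuperTensor.tmul c d * SuperTensor.tmul a b) = (1 / 2 : ℂ) •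
          (c * F (SuperTensor.tmul a b) * lin S d + c * F (SuperTensor.tmul a b) * lin S (par d)
            + c * F (par (SuperTensor.tmul a b)) * lin S d
            - c * F (par (SuperTensor.tmul a b)) * lin S (par d))
        simp only [SuperTensor.tmul_mul_tmul, SuperTensor.par_tmul, map_smul, map_add, map_sub,
          hF', lin_mul, hS, Superalgebra.parity_parity, mul_smul_comm, mul_add, mul_sub, mul_assoc]
        module
    rw [key, ht, ht', hF', Algebra.algebraMap_eq_smul_one]
    simp only [mul_smul_comm, smul_mul_assoc, mul_one]
    module

/-- The antipode axioms at an element, for a coproduct with values in the super tensor square. -/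
def AntipodeAt (Δ : A →ₐ[ℂ] SuperTensor A A) (ε : A →ₐ[ℂ] ℂ) (S : A →ₐ[ℂ] SuperOpposite A)
    (a : A) : Prop :=
  LinearMap.mul' ℂ A ((lin S).rTensor A ((Twisted.of _).symm (Δ a))) = algebraMap ℂ A (ε a) ∧
    LinearMap.mul' ℂ A ((lin S).lTensor A ((Twisted.of _).symm (Δ a))) = algebraMap ℂ A (ε a)

namespace AntipodeAt

variable {Δ : A →ₐ[ℂ] SuperTensor A A} {ε : A →ₐ[ℂ] ℂ} 

theorem algebraMap (c : ℂ) : AntipodeAt Δ ε S (algebraMap ℂ A c) := by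
  have h : lin S 1 = 1 := lin_eq S (by rw [map_one, op_one])
  have h1 : (Twisted.of (tensorTwisting A A)).symm 1 = 1 ⊗ₜ 1 := rfl
  simp [AntipodeAt, h, h1, Algebra.algebraMap_eq_smul_one]

theorem add {a b : A} (ha : AntipodeAt Δ ε S a) (hb : AntipodeAt Δ ε S b) :
    AntipodeAt Δ ε S (a + b) := by
  simp [AntipodeAt, ha.1, ha.2, hb.1, hb.2]

/-- The product rule uses the antipode axioms at `par a` too; they follow from those at `a` because
Δ, ε and S are even. -/
theorem parity (hΔ : ∀ a, Δ (par a) = par (Δ a)) (hε : ∀ a, ε (par a) = ε a)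
    (hS : ∀ a, lin S (par a) = par (lin S a)) {a : A} (ha : AntipodeAt Δ ε S a) :
    AntipodeAt Δ ε S (par a) := by
  have h1 (t : SuperTensor A A) : LinearMap.mul' ℂ A ((lin S).rTensor A
      ((Twisted.of _).symm (par t))) =
      par (LinearMap.mul' ℂ A ((lin S).rTensor A ((Twisted.of _).symm t))) := by
    obtain ⟨t, rfl⟩ := (Twisted.of _).surjective t
    induction t with
    | zero => simp
    | add s t hs ht => simp only [map_add, hs, ht]
    | tmul a b =>
      change lin S (par a) * par b = par (lin S a * b)
      rw [hS, map_mul]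
  have h2 (t : SuperTensor A A) : LinearMap.mul' ℂ A ((lin S).lTensor A
      ((Twisted.of _).symm (par t))) =
      par (LinearMap.mul' ℂ A ((lin S).lTensor A ((Twisted.of _).symm t))) := by
    obtain ⟨t, rfl⟩ := (Twisted.of _).surjective t
    induction t with
    | zero => simp
    | add s t hs ht => simp only [map_add, hs, ht]
    | tmul a b =>
      change par a * lin S (par b) = par (a * lin S b)
      rw [hS, map_mul]
  rw [AntipodeAt, hΔ, hε, h1, h2, ha.1, ha.2, AlgHom.commutes]
  exact ⟨rfl, rfl⟩

/-- Together with the closure under sums and scalars, this makes the elements at which the axioms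
hold a subalgebra, so generators suffice. -/
theorem mul (hΔ : ∀ a, Δ (par a) = par (Δ a)) (hε : ∀ a, ε (par a) = ε a)
    (hS : ∀ a, lin S (par a) = par (lin S a)) {a b : A} (ha : AntipodeAt Δ ε S a)
    (hb : AntipodeAt Δ ε S b) : AntipodeAt Δ ε S (a * b) := by
  have ha' := ha.parity hΔ hε hS
  have hb' := hb.parity hΔ hε hS
  rw [AntipodeAt, hΔ, hε] at ha' hb'
  constructor
  · rw [map_mul, mul_rTensor_mul hS _ _ _ ha.1 ha'.1, hb.1, map_mul, map_mul, Algebra.smul_def]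
  · rw [map_mul, mul_lTensor_mul hS _ _ _ hb.2 hb'.2, ha.2, map_mul, mul_comm, map_mul,
      Algebra.smul_def]

end AntipodeAt

end SuperOpposite

/-- A super-Hopf algebra from a coproduct, a counit and an antipode that are homomorphisms. -/
def SuperHopfAlgebra.ofAlgHom {A : Type*} [Ring A] [Algebra ℂ A] [Superalgebra A]
    (Δ : A →ₐ[ℂ] SuperTensor A A) (ε : A →ₐ[ℂ] ℂ) (S : A →ₐ[ℂ] SuperOpposite A)
    (hΔ : ∀ a, Δ (par a) = par (Δ a)) (hε : ∀ a, ε (par a) = ε a)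
    (hS : ∀ a, S (par a) = SuperOpposite.parity (S a))
    (coassoc : ∀ a, SuperTensor.assoc (SuperTensor.map Δ (AlgHom.id ℂ A) hΔ (fun _ => rfl) (Δ a)) =
      SuperTensor.map (AlgHom.id ℂ A) Δ (fun _ => rfl) hΔ (Δ a))
    (rTensor_counit : ∀ a, ε.toLinearMap.rTensor A ((Twisted.of _).symm (Δ a)) = 1 ⊗ₜ a)
    (lTensor_counit : ∀ a, ε.toLinearMap.lTensor A ((Twisted.of _).symm (Δ a)) = a ⊗ₜ 1)
    (antipode : ∀ a, SuperOpposite.AntipodeAt Δ ε S a) : SuperHopfAlgebra A where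
  parity := par
  parity_parity := Superalgebra.parity_parity
  comul := (Twisted.of _).symm.toLinearMap ∘ₗ Δ.toLinearMap
  counit := ε.toLinearMap
  antipode := SuperOpposite.lin S
  comul_parity a := congrArg (Twisted.of _).symm (hΔ a)
  counit_parity := hε
  antipode_parity a := SuperOpposite.lin_eq S
    (by rw [hS, ← SuperOpposite.op_lin, SuperOpposite.parity_op])
  coassoc a := by
    -- `f` is the identity of the underlying spaces. The associator and the maps Δ ⊗ id, id ⊗ Δ are
    -- the same linear maps on twisted and untwisted tensor powers, so coassociativity transfers
    -- through `f`.
    let f : SuperTensor A (SuperTensor A A) →ₗ[ℂ] A ⊗[ℂ] (A ⊗[ℂ] A) :=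
      (Twisted.of _).symm.toLinearMap.lTensor A ∘ₗ (Twisted.of _).symm.toLinearMap
    have h1 (t : A ⊗[ℂ] A) : TensorProduct.assoc ℂ A A A
        (((Twisted.of _).symm.toLinearMap ∘ₗ Δ.toLinearMap).rTensor A t) =
        f (SuperTensor.assoc (SuperTensor.map Δ (AlgHom.id ℂ A) hΔ (fun _ => rfl)
          (Twisted.of _ t))) := by
      induction t with
      | zero => simp
      | add s t hs ht => simp only [map_add, hs, ht]
      | tmul a b =>
        change TensorProduct.assoc ℂ A A A ((Twisted.of _).symm (Δ a) ⊗ₜ b) =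
          f (SuperTensor.assoc (SuperTensor.tmul (Δ a) b))
        obtain ⟨s, hs⟩ := (Twisted.of _).surjective (Δ a)
        rw [← hs]
        clear hs
        induction s with
        | zero => simp only [map_zero, TensorProduct.zero_tmul, SuperTensor.zero_tmul]
        | add s t hs ht =>
          simp only [map_add, TensorProduct.add_tmul, SuperTensor.add_tmul, hs, ht]
        | tmul c d => rfl
    have h2 (t : A ⊗[ℂ] A) : ((Twisted.of _).symm.toLinearMap ∘ₗ Δ.toLinearMap).lTensor A t =
        f (SuperTensor.map (AlgHom.id ℂ A) Δ (fun _ => rfl) hΔ (Twisted.of _ t)) := by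
      induction t with
      | zero => simp
      | add s t hs ht => simp only [map_add, hs, ht]
      | tmul a b => rfl
    exact (h1 _).trans ((congrArg f (coassoc a)).trans (h2 _).symm)
  rTensor_counit := rTensor_counit
  lTensor_counit := lTensor_counit
  counit_one := map_one ε
  counit_mul := map_mul ε
  comul_one := map_one Δ
  -- The product of `SuperTensor A A` unfolds to `superMul par`.
  comul_mul := map_mul Δ
  mul_antipode_rTensor a := (antipode a).1
  mul_antipode_lTensor a := (antipode a).2

/-! ### The super-Hopf algebra `U_q gl(1|1)` -/

namespace Gl

variable {ℏ : ℂ}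

section Relations

theorem mk_rel {a b : FreeAlgebra ℂ GlGen} (h : GlRel ℏ a b) :
    RingQuot.mkAlgHom ℂ (GlRel ℏ) a = RingQuot.mkAlgHom ℂ (GlRel ℏ) b :=
  RingQuot.mkAlgHom_rel ℂ h

theorem C_N : C ℏ * N ℏ = N ℏ * C ℏ := by
  have h := mk_rel (GlRel.C_N (ℏ := ℏ))
  rwa [map_mul, map_mul] at h

theorem C_eta : C ℏ * eta ℏ = eta ℏ * C ℏ := by
  have h := mk_rel (GlRel.C_eta (ℏ := ℏ))
  rwa [map_mul, map_mul] at h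

theorem C_etaP : C ℏ * etaP ℏ = etaP ℏ * C ℏ := by
  have h := mk_rel (GlRel.C_etaP (ℏ := ℏ))
  rwa [map_mul, map_mul] at h

theorem N_eta : N ℏ * eta ℏ = eta ℏ * N ℏ - eta ℏ := by
  have h := mk_rel (GlRel.N_eta (ℏ := ℏ))
  rwa [map_sub, map_mul, map_mul, map_neg, sub_eq_iff_eq_add', ← sub_eq_add_neg] at h

theorem N_etaP : N ℏ * etaP ℏ = etaP ℏ * N ℏ + etaP ℏ := by
  have h := mk_rel (GlRel.N_etaP (ℏ := ℏ))
  rwa [map_sub, map_mul, map_mul, sub_eq_iff_eq_add'] at h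

theorem eta_etaP : eta ℏ * etaP ℏ = -(etaP ℏ * eta ℏ) +
    (Complex.exp ℏ - (Complex.exp ℏ)⁻¹)⁻¹ • (E ℏ ℏ 0 - E ℏ (-ℏ) 0) := by
  have h := mk_rel (GlRel.eta_etaP (ℏ := ℏ))
  rw [map_add, map_mul, map_mul, map_smul, map_sub] at h
  rw [eq_neg_add_iff_add_eq, add_comm]
  exact h

theorem eta_eta : eta ℏ * eta ℏ = 0 := by
  have h := mk_rel (GlRel.eta_eta (ℏ := ℏ))
  rwa [map_mul, map_zero] at h

theorem etaP_etaP : etaP ℏ * etaP ℏ = 0 := by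
  have h := mk_rel (GlRel.etaP_etaP (ℏ := ℏ))
  rwa [map_mul, map_zero] at h

theorem E_zero : E ℏ 0 0 = 1 := by
  have h := mk_rel (GlRel.E_zero (ℏ := ℏ))
  rwa [map_one] at h

theorem E_add (c n c' n' : ℂ) : E ℏ c n * E ℏ c' n' = E ℏ (c + c') (n + n') := by
  have h := mk_rel (GlRel.E_add (ℏ := ℏ) c n c' n')
  rwa [map_mul] at h

theorem E_C (c n : ℂ) : E ℏ c n * C ℏ = C ℏ * E ℏ c n := by
  have h := mk_rel (GlRel.E_C (ℏ := ℏ) c n)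
  rwa [map_mul, map_mul] at h

theorem E_N (c n : ℂ) : E ℏ c n * N ℏ = N ℏ * E ℏ c n := by
  have h := mk_rel (GlRel.E_N (ℏ := ℏ) c n)
  rwa [map_mul, map_mul] at h

theorem E_eta (c n : ℂ) : E ℏ c n * eta ℏ = Complex.exp (-n) • (eta ℏ * E ℏ c n) := by
  have h := mk_rel (GlRel.E_eta (ℏ := ℏ) c n)
  rwa [map_mul, map_smul, map_mul] at h

theorem E_etaP (c n : ℂ) : E ℏ c n * etaP ℏ = Complex.exp n • (etaP ℏ * E ℏ c n) := by
  have h := mk_rel (GlRel.E_etaP (ℏ := ℏ) c n)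
  rwa [map_mul, map_smul, map_mul] at h

theorem E_comm (c n c' n' : ℂ) : E ℏ c n * E ℏ c' n' = E ℏ c' n' * E ℏ c n := by
  rw [E_add, E_add, add_comm c, add_comm n]

theorem hom_ext {B : Type*} [Semiring B] [Algebra ℂ B] {f f' : Gl ℏ →ₐ[ℂ] B}
    (h : ∀ s, f (gen ℏ s) = f' (gen ℏ s)) : f = f' :=
  RingQuot.ringQuot_ext' ℂ f f' (FreeAlgebra.hom_ext (funext h))

theorem induction {P : Gl ℏ → Prop} (hc : ∀ c : ℂ, P (algebraMap ℂ _ c))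
    (hgen : ∀ s, P (gen ℏ s)) (hmul : ∀ a b, P a → P b → P (a * b))
    (hadd : ∀ a b, P a → P b → P (a + b)) (a : Gl ℏ) : P a := by
  obtain ⟨a, rfl⟩ := RingQuot.mkAlgHom_surjective ℂ (GlRel ℏ) a
  let mk : FreeAlgebra ℂ GlGen →ₐ[ℂ] Gl ℏ := RingQuot.mkAlgHom ℂ (GlRel ℏ)
  change P (mk a)
  induction a using FreeAlgebra.induction with
  | grade0 c =>
    have h := hc c
    rwa [← mk.commutes c] at h
  | grade1 s => exact hgen s
  | mul a b ha hb =>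
    rw [map_mul]; exact hmul _ _ ha hb
  | add a b ha hb =>
    rw [map_add]; exact hadd _ _ ha hb

end Relations

section Lift

variable {B : Type*} [Semiring B] [Algebra ℂ B] (f : GlGen → B)
  (hf : ∀ ⦃a b⦄, GlRel ℏ a b → FreeAlgebra.lift ℂ f a = FreeAlgebra.lift ℂ f b)

/-- Homomorphisms from `U_q gl(1|1)`. -/
def lift : Gl ℏ →ₐ[ℂ] B := RingQuot.liftAlgHom ℂ ⟨FreeAlgebra.lift ℂ f, hf⟩

theorem lift_gen (s : GlGen) : lift f hf (gen ℏ s) = f s :=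
  (RingQuot.liftAlgHom_mkAlgHom_apply ℂ _ hf _).trans (FreeAlgebra.lift_ι_apply _ _)

end Lift

variable (ℏ) in
/-- The parity on generators. -/
def parityGen : GlGen → Gl ℏ
  | .eta => -eta ℏ
  | .etaP => -etaP ℏ
  | s => gen ℏ s

/-- The relations are homogeneous: each side changes by the same sign when η and η⁺ change sign. -/
theorem parity_rel ⦃a b : FreeAlgebra ℂ GlGen⦄ (h : GlRel ℏ a b) :
    FreeAlgebra.lift ℂ (parityGen ℏ) a = FreeAlgebra.lift ℂ (parityGen ℏ) b := by
  have hC : gen ℏ .C = C ℏ := rfl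
  have hN : gen ℏ .N = N ℏ := rfl
  have hE (c n : ℂ) : gen ℏ (.E c n) = E ℏ c n := rfl
  cases h <;> simp only [map_sub, map_add, map_mul, map_smul, map_neg, map_zero, map_one,
    GlGen.free, FreeAlgebra.lift_ι_apply, parityGen, hC, hN, hE, mul_neg, neg_mul, neg_neg, C_N,
    C_eta, C_etaP, N_eta, N_etaP, eta_etaP, eta_eta, etaP_etaP, E_zero, E_add, E_C, E_N, E_eta,
    E_etaP, smul_neg] <;> abel

instance : Superalgebra (Gl ℏ) where
  parity := lift (parityGen ℏ) parity_rel
  parity_parity a := by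
    refine DFunLike.congr_fun (f := (lift (parityGen ℏ) parity_rel).comp
      (lift (parityGen ℏ) parity_rel)) (g := AlgHom.id ℂ (Gl ℏ)) (hom_ext fun s => ?_) a
    have h := lift_gen (parityGen ℏ) parity_rel
    have h1 : lift (parityGen ℏ) parity_rel (eta ℏ) = -eta ℏ := h .eta
    have h2 : lift (parityGen ℏ) parity_rel (etaP ℏ) = -etaP ℏ := h .etaP
    cases s <;> simp only [AlgHom.comp_apply, h, parityGen, AlgHom.id_apply, map_neg, h1, h2,
      neg_neg] <;> rfl

theorem par_C : par (C ℏ) = C ℏ := lift_gen _ _ .C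
theorem par_N : par (N ℏ) = N ℏ := lift_gen _ _ .N
theorem par_eta : par (eta ℏ) = -eta ℏ := lift_gen _ _ .eta
theorem par_etaP : par (etaP ℏ) = -etaP ℏ := lift_gen _ _ .etaP
theorem par_E (c n : ℂ) : par (E ℏ c n) = E ℏ c n := lift_gen _ _ (.E c n)

open SuperTensor

variable (ℏ) in
/-- The coproduct on generators. -/
def comulGen : GlGen → SuperTensor (Gl ℏ) (Gl ℏ)
  | .C => tmul (C ℏ) 1 + tmul 1 (C ℏ)
  | .N => tmul (N ℏ) 1 + tmul 1 (N ℏ)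
  | .eta => tmul (eta ℏ) (E ℏ ℏ (-ℏ)) + tmul (E ℏ 0 (-ℏ)) (eta ℏ)
  | .etaP => tmul (etaP ℏ) (E ℏ 0 ℏ) + tmul (E ℏ (-ℏ) ℏ) (etaP ℏ)
  | .E c n => tmul (E ℏ c n) (E ℏ c n)

theorem comul_rel ⦃a b : FreeAlgebra ℂ GlGen⦄ (h : GlRel ℏ a b) :
    FreeAlgebra.lift ℂ (comulGen ℏ) a = FreeAlgebra.lift ℂ (comulGen ℏ) b := by
  cases h <;> simp only [map_sub, map_add, map_mul, map_smul, map_neg, map_zero, map_one,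
      GlGen.free, FreeAlgebra.lift_ι_apply, comulGen, add_mul, mul_add]
  -- The mixed terms of Δ(η)Δ(η⁺) and Δ(η⁺)Δ(η) cancel: both are e^{-ℏ} times the same tensor, with
  -- opposite signs because two odd elements pass each other in one of them. The rest telescopes, as
  -- (K - K⁻¹) ⊗ K + K⁻¹ ⊗ (K - K⁻¹) = K ⊗ K - K⁻¹ ⊗ K⁻¹ with K = q^C.
  case eta_etaP =>
    rw [tmul_mul_tmul_left _ _ _ (par_E _ _), tmul_mul_tmul_left _ _ _ (par_E _ _),
      tmul_mul_tmul_odd _ _ par_eta par_etaP, tmul_mul_tmul_right _ _ _ (par_E _ _),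
      tmul_mul_tmul_left _ _ _ (par_E _ _), tmul_mul_tmul_left _ _ _ (par_E _ _),
      tmul_mul_tmul_odd _ _ par_etaP par_eta, tmul_mul_tmul_right _ _ _ (par_E _ _)]
    simp only [eta_etaP, E_etaP, E_eta, E_add, tmul_smul, smul_tmul, tmul_add, tmul_sub, add_tmul,
      sub_tmul, tmul_neg, neg_tmul]
    simp
    module
  case eta_eta =>
    rw [tmul_mul_tmul_left _ _ _ (par_E _ _), tmul_mul_tmul_left _ _ _ (par_E _ _),
      tmul_mul_tmul_odd _ _ par_eta par_eta, tmul_mul_tmul_right _ _ _ (par_E _ _)]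
    simp only [eta_eta, E_eta, tmul_smul, smul_tmul, zero_tmul, tmul_zero, neg_neg]
    module
  case etaP_etaP =>
    rw [tmul_mul_tmul_left _ _ _ (par_E _ _), tmul_mul_tmul_left _ _ _ (par_E _ _),
      tmul_mul_tmul_odd _ _ par_etaP par_etaP, tmul_mul_tmul_right _ _ _ (par_E _ _)]
    simp only [etaP_etaP, E_etaP, tmul_smul, smul_tmul, zero_tmul, tmul_zero, neg_neg]
    module
  case E_zero => rw [E_zero, one_def]
  all_goals
    simp only [tmul_mul_tmul, map_one, par_C, par_N, par_E, par_eta, par_etaP, one_mul, mul_one,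
      mul_neg, neg_mul, C_N, C_eta, C_etaP, N_eta, N_etaP, E_C, E_N, E_add, E_eta, E_etaP,
      tmul_add, tmul_sub, add_tmul, sub_tmul, tmul_neg, neg_tmul, tmul_smul, smul_tmul]
  case E_eta c n =>
    -- The exponents are brought to a common order so that equal exponentials are recognised as the
    -- same atom.
    rw [add_comm ℏ c, add_comm (-ℏ) n, add_comm 0 c]
    module
  case E_etaP c n =>
    rw [add_comm 0 c, add_comm ℏ n, add_comm (-ℏ) c]
    module
  all_goals module

/-- The counit on generators. -/
def counitGen : GlGen → ℂ
  | .E _ _ => 1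
  | _ => 0

theorem counit_rel ⦃a b : FreeAlgebra ℂ GlGen⦄ (h : GlRel ℏ a b) :
    FreeAlgebra.lift ℂ counitGen a = FreeAlgebra.lift ℂ counitGen b := by
  cases h <;> simp [GlGen.free, counitGen]

variable (ℏ) in
/-- The antipode on generators. -/
def antipodeGen : GlGen → Gl ℏ
  | .C => -C ℏ
  | .N => -N ℏ
  -- The values solve the antipode axiom: S(η)q^{C-N} + q^N η = 0 gives S(η) = -q^N η q^{N-C}, and
  -- q^N η = e^{-ℏ} η q^N. Likewise S(η⁺)q^N + q^{C-N} η⁺ = 0 gives the next line.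
  | .eta => -Complex.exp (-ℏ) • (eta ℏ * E ℏ (-ℏ) (2 * ℏ))
  | .etaP => -Complex.exp (-ℏ) • (etaP ℏ * E ℏ ℏ (-(2 * ℏ)))
  | .E c n => E ℏ (-c) (-n)

open SuperOpposite in
theorem antipode_rel ⦃a b : FreeAlgebra ℂ GlGen⦄ (h : GlRel ℏ a b) :
    FreeAlgebra.lift ℂ (fun s => op (antipodeGen ℏ s)) a =
      FreeAlgebra.lift ℂ (fun s => op (antipodeGen ℏ s)) b := by
  cases h <;> simp only [map_sub, map_add, map_mul, map_smul, map_neg, map_zero, map_one,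
      GlGen.free, FreeAlgebra.lift_ι_apply, antipodeGen]
  case E_zero => rw [neg_zero, E_zero, op_one]
  case eta_etaP =>
    have h1 : etaP ℏ * E ℏ ℏ (-(2 * ℏ)) * (eta ℏ * E ℏ (-ℏ) (2 * ℏ)) =
        Complex.exp (2 * ℏ) • (etaP ℏ * eta ℏ) := by
      rw [mul_assoc, ← mul_assoc (E _ _ _), E_eta, smul_mul_assoc, mul_smul_comm, mul_assoc (eta ℏ),
        E_add, add_neg_cancel, neg_add_cancel, E_zero, mul_one, neg_neg]
    have h2 : eta ℏ * E ℏ (-ℏ) (2 * ℏ) * (etaP ℏ * E ℏ ℏ (-(2 * ℏ))) =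
        Complex.exp (2 * ℏ) • (eta ℏ * etaP ℏ) := by
      rw [mul_assoc, ← mul_assoc (E _ _ _), E_etaP, smul_mul_assoc, mul_smul_comm,
        mul_assoc (etaP ℏ), E_add, add_neg_cancel, neg_add_cancel, E_zero, mul_one]
    -- The scalars of the two antipodes cancel the factor e^{2ℏ} from reordering, so the
    -- anticommutator of the images is minus that of η and η⁺, the sign being that of the super
    -- opposite product. On the other side q^C - q^{-C} also changes sign under the antipode.
    have hq : -Complex.exp (-ℏ) * -Complex.exp (-ℏ) * Complex.exp (2 * ℏ) = 1 := by
      rw [neg_mul_neg, ← Complex.exp_add, ← Complex.exp_add, ← Complex.exp_zero]; congr 1; ring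
    rw [smul_mul_smul_comm, smul_mul_smul_comm,
      op_mul_op_odd (by rw [map_mul, par_eta, par_E, neg_mul])
        (by rw [map_mul, par_etaP, par_E, neg_mul]),
      op_mul_op_odd (by rw [map_mul, par_etaP, par_E, neg_mul])
        (by rw [map_mul, par_eta, par_E, neg_mul]), h1, h2, map_smul, map_smul, smul_neg, smul_neg,
      smul_smul, smul_smul, hq, one_smul, one_smul, eta_etaP]
    simp only [map_smul, map_add, map_neg, map_sub, neg_zero, neg_neg]
    module
  case eta_eta =>
    have h : eta ℏ * E ℏ (-ℏ) (2 * ℏ) * (eta ℏ * E ℏ (-ℏ) (2 * ℏ)) = 0 := by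
      rw [mul_assoc, ← mul_assoc (E _ _ _), E_eta, smul_mul_assoc, mul_smul_comm, mul_assoc (eta ℏ),
        ← mul_assoc (eta ℏ), eta_eta, zero_mul, smul_zero]
    rw [smul_mul_smul_comm, op_mul_op_odd (by rw [map_mul, par_eta, par_E, neg_mul])
        (by rw [map_mul, par_eta, par_E, neg_mul]), h, map_zero, neg_zero, smul_zero]
  case etaP_etaP =>
    have h : etaP ℏ * E ℏ ℏ (-(2 * ℏ)) * (etaP ℏ * E ℏ ℏ (-(2 * ℏ))) = 0 := by
      rw [mul_assoc, ← mul_assoc (E _ _ _), E_etaP, smul_mul_assoc, mul_smul_comm,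
        mul_assoc (etaP ℏ), ← mul_assoc (etaP ℏ), etaP_etaP, zero_mul, smul_zero]
    rw [smul_mul_smul_comm, op_mul_op_odd (by rw [map_mul, par_etaP, par_E, neg_mul])
        (by rw [map_mul, par_etaP, par_E, neg_mul]), h, map_zero, neg_zero, smul_zero]
  case E_eta c n =>
    rw [smul_mul_assoc, mul_smul_comm, op_mul_op_left _ (par_E _ _), op_mul_op_right _ (par_E _ _),
      mul_assoc, E_comm _ _ (-c), ← mul_assoc, ← mul_assoc, E_eta, smul_mul_assoc, map_smul,
      smul_comm, smul_smul (Complex.exp _) (Complex.exp _), ← Complex.exp_add]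
    simp
  case E_etaP c n =>
    rw [smul_mul_assoc, mul_smul_comm, op_mul_op_left _ (par_E _ _), op_mul_op_right _ (par_E _ _),
      mul_assoc, E_comm _ _ (-c), ← mul_assoc, ← mul_assoc, E_etaP, smul_mul_assoc, map_smul,
      smul_comm, smul_smul (Complex.exp _) (Complex.exp _), ← Complex.exp_add]
    simp
  case E_add => rw [op_mul_op_left _ (par_E _ _), E_add, neg_add_rev, neg_add_rev]
  case C_N => simp [op_mul_op, par_C, par_N, C_N]
  case E_C => simp [op_mul_op, par_E, par_C, E_C]
  case E_N => simp [op_mul_op, par_E, par_N, E_N]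
  all_goals
    simp only [op_mul_op_left _ par_C, op_mul_op_right _ par_C, op_mul_op_left _ par_N,
      op_mul_op_right _ par_N, neg_mul, mul_neg, mul_smul_comm, smul_mul_assoc, mul_assoc, E_C, E_N]
    simp only [← mul_assoc, C_eta, C_etaP, N_eta, N_etaP, add_mul, sub_mul, map_add, map_sub,
      map_neg, smul_add, smul_sub]
    try module

variable (ℏ) in
/-- The coproduct of `U_q gl(1|1)`. -/
def comulHom : Gl ℏ →ₐ[ℂ] SuperTensor (Gl ℏ) (Gl ℏ) := lift (comulGen ℏ) comul_rel

variable (ℏ) in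
/-- The counit of `U_q gl(1|1)`. -/
def counitHom : Gl ℏ →ₐ[ℂ] ℂ := lift counitGen counit_rel

variable (ℏ) in
/-- The antipode of `U_q gl(1|1)`. -/
def antipodeHom : Gl ℏ →ₐ[ℂ] SuperOpposite (Gl ℏ) :=
  lift (fun s => SuperOpposite.op (antipodeGen ℏ s)) antipode_rel

theorem comulHom_C : comulHom ℏ (C ℏ) = tmul (C ℏ) 1 + tmul 1 (C ℏ) := lift_gen _ _ .C
theorem comulHom_N : comulHom ℏ (N ℏ) = tmul (N ℏ) 1 + tmul 1 (N ℏ) := lift_gen _ _ .N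
theorem comulHom_eta : comulHom ℏ (eta ℏ) =
    tmul (eta ℏ) (E ℏ ℏ (-ℏ)) + tmul (E ℏ 0 (-ℏ)) (eta ℏ) := lift_gen _ _ .eta
theorem comulHom_etaP : comulHom ℏ (etaP ℏ) =
    tmul (etaP ℏ) (E ℏ 0 ℏ) + tmul (E ℏ (-ℏ) ℏ) (etaP ℏ) := lift_gen _ _ .etaP
theorem comulHom_E (c n : ℂ) : comulHom ℏ (E ℏ c n) = tmul (E ℏ c n) (E ℏ c n) :=
  lift_gen _ _ (.E c n)

theorem counitHom_C : counitHom ℏ (C ℏ) = 0 := lift_gen _ _ .C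
theorem counitHom_N : counitHom ℏ (N ℏ) = 0 := lift_gen _ _ .N
theorem counitHom_eta : counitHom ℏ (eta ℏ) = 0 := lift_gen _ _ .eta
theorem counitHom_etaP : counitHom ℏ (etaP ℏ) = 0 := lift_gen _ _ .etaP
theorem counitHom_E (c n : ℂ) : counitHom ℏ (E ℏ c n) = 1 := lift_gen _ _ (.E c n)

theorem lin_antipodeHom (s : GlGen) :
    SuperOpposite.lin (antipodeHom ℏ) (gen ℏ s) = antipodeGen ℏ s :=
  SuperOpposite.lin_eq _ (lift_gen _ _ s)

theorem gen_cases {P : Gl ℏ → Prop} (hC : P (C ℏ)) (hN : P (N ℏ)) (heta : P (eta ℏ))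
    (hetaP : P (etaP ℏ)) (hE : ∀ c n, P (E ℏ c n)) (s : GlGen) : P (gen ℏ s) := by
  cases s
  exacts [hC, hN, heta, hetaP, hE _ _]

theorem hom_ext' {B : Type*} [Semiring B] [Algebra ℂ B] {f f' : Gl ℏ →ₐ[ℂ] B}
    (hC : f (C ℏ) = f' (C ℏ)) (hN : f (N ℏ) = f' (N ℏ)) (heta : f (eta ℏ) = f' (eta ℏ))
    (hetaP : f (etaP ℏ) = f' (etaP ℏ)) (hE : ∀ c n, f (E ℏ c n) = f' (E ℏ c n)) (a : Gl ℏ) :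
    f a = f' a :=
  DFunLike.congr_fun (hom_ext (gen_cases (P := fun a => f a = f' a) hC hN heta hetaP hE)) a

theorem comulHom_par (a : Gl ℏ) : comulHom ℏ (par a) = par (comulHom ℏ a) := by
  refine hom_ext' (f := (comulHom ℏ).comp par) (f' := par.comp (comulHom ℏ)) ?_ ?_ ?_ ?_
    (fun c n => ?_) a <;>
  simp only [AlgHom.comp_apply, par_C, par_N, par_eta, par_etaP, par_E, comulHom_C, comulHom_N,
    comulHom_eta, comulHom_etaP, comulHom_E, map_add, map_neg, par_tmul, map_one, tmul_neg,
    neg_tmul, neg_add]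

theorem counitHom_par (a : Gl ℏ) : counitHom ℏ (par a) = counitHom ℏ a := by
  refine hom_ext' (f := (counitHom ℏ).comp par) (f' := counitHom ℏ) ?_ ?_ ?_ ?_
    (fun c n => ?_) a <;>
  simp only [AlgHom.comp_apply, par_C, par_N, par_eta, par_etaP, par_E, counitHom_eta,
    counitHom_etaP, map_neg, neg_zero]

theorem antipodeHom_par (a : Gl ℏ) :
    antipodeHom ℏ (par a) = SuperOpposite.parity (antipodeHom ℏ a) := by
  have h (s : GlGen) : antipodeHom ℏ (gen ℏ s) = SuperOpposite.op (antipodeGen ℏ s) :=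
    lift_gen _ _ s
  refine hom_ext' (f := (antipodeHom ℏ).comp par)
    (f' := SuperOpposite.parity.comp (antipodeHom ℏ)) ?_ ?_ ?_ ?_ (fun c n => ?_) a <;>
  simp only [AlgHom.comp_apply, par_C, par_N, par_eta, par_etaP, par_E, map_neg] <;>
  simp only [C, N, eta, etaP, E, h, SuperOpposite.parity_op] <;>
  simp only [antipodeGen, map_neg, map_smul, map_mul, par_C, par_N, par_eta, par_etaP, par_E,
    neg_mul, smul_neg]

theorem antipodeAt_gen (s : GlGen) :
    SuperOpposite.AntipodeAt (comulHom ℏ) (counitHom ℏ) (antipodeHom ℏ) (gen ℏ s) := by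
  have h1 : SuperOpposite.lin (antipodeHom ℏ) 1 = 1 :=
    SuperOpposite.lin_eq _ (by rw [map_one, SuperOpposite.op_one])
  have hC : SuperOpposite.lin (antipodeHom ℏ) (C ℏ) = -C ℏ := lin_antipodeHom .C
  have hN : SuperOpposite.lin (antipodeHom ℏ) (N ℏ) = -N ℏ := lin_antipodeHom .N
  have heta : SuperOpposite.lin (antipodeHom ℏ) (eta ℏ) =
    -Complex.exp (-ℏ) • (eta ℏ * E ℏ (-ℏ) (2 * ℏ)) := lin_antipodeHom .eta
  have hetaP : SuperOpposite.lin (antipodeHom ℏ) (etaP ℏ) =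
    -Complex.exp (-ℏ) • (etaP ℏ * E ℏ ℏ (-(2 * ℏ))) := lin_antipodeHom .etaP
  have hE (c n : ℂ) : SuperOpposite.lin (antipodeHom ℏ) (E ℏ c n) = E ℏ (-c) (-n) :=
    lin_antipodeHom (.E c n)
  have e1 : 2 * ℏ + -ℏ = ℏ := by ring
  have e2 : -(2 * ℏ) + ℏ = -ℏ := by ring
  have e3 : -ℏ + 2 * ℏ = ℏ := by ring
  have e4 : ℏ + -(2 * ℏ) = -ℏ := by ring
  refine gen_cases ?_ ?_ ?_ ?_ (fun c n => ?_) s <;>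
  simp only [SuperOpposite.AntipodeAt, comulHom_C, comulHom_N, comulHom_eta, comulHom_etaP,
    comulHom_E, counitHom_C, counitHom_N, counitHom_eta, counitHom_etaP, counitHom_E, map_add,
    LinearEquiv.symm_apply_apply, LinearMap.rTensor_tmul, LinearMap.lTensor_tmul,
    LinearMap.mul'_apply, h1, hC, hN, heta, hetaP, hE, map_zero, map_one, E_add, neg_neg, neg_zero,
    mul_one, one_mul, neg_add_cancel, add_neg_cancel, E_zero, and_self, smul_mul_assoc,
    mul_smul_comm, mul_assoc, e1, e2] <;>
  simp only [← mul_assoc, E_eta, E_etaP, smul_mul_assoc, smul_smul, neg_mul, ← Complex.exp_add,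
    neg_neg, neg_add_cancel, add_neg_cancel, Complex.exp_zero, neg_smul, one_smul, true_and] <;>
  simp only [mul_assoc, E_add, e3, e4, zero_add, add_zero, add_neg_cancel,
    neg_add_cancel, and_self]

variable (ℏ) in
/-- The super-Hopf algebra `U_q gl(1|1)`. -/
def superHopf : SuperHopfAlgebra (Gl ℏ) :=
  SuperHopfAlgebra.ofAlgHom (comulHom ℏ) (counitHom ℏ) (antipodeHom ℏ) comulHom_par counitHom_par
    antipodeHom_par
    (by
      have h1 (a b : Gl ℏ) : map (comulHom ℏ) (AlgHom.id ℂ (Gl ℏ)) comulHom_par (fun _ => rfl)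
        (tmul a b) = tmul (comulHom ℏ a) b := rfl
      have h2 (a b : Gl ℏ) : map (AlgHom.id ℂ (Gl ℏ)) (comulHom ℏ) (fun _ => rfl) comulHom_par
        (tmul a b) = tmul a (comulHom ℏ b) := rfl
      refine hom_ext' (f := (assoc.comp (map (comulHom ℏ) (AlgHom.id ℂ (Gl ℏ)) comulHom_par
          fun _ => rfl)).comp (comulHom ℏ))
        (f' := (map (AlgHom.id ℂ (Gl ℏ)) (comulHom ℏ) (fun _ => rfl) comulHom_par).comp
          (comulHom ℏ)) ?_ ?_ ?_ ?_ (fun c n => ?_) <;>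
      simp only [AlgHom.comp_apply, comulHom_C, comulHom_N, comulHom_eta, comulHom_etaP,
        comulHom_E, map_add, h1, h2, map_one, one_def, add_tmul, tmul_add, assoc_tmul,
        add_assoc])
    (fun a => by
      -- Because ε ∘ `par` = ε, the map ε ⊗ id does not see the signs of the super product and is an
      -- algebra homomorphism on the super tensor square. The counit axiom becomes an equality of
      -- homomorphisms, checked on generators.
      refine hom_ext' (f := (Twisted.lift (Algebra.TensorProduct.map (counitHom ℏ)
          (AlgHom.id ℂ (Gl ℏ))) (.inl fun x => ?_)).comp (comulHom ℏ))
        (f' := Algebra.TensorProduct.includeRight) ?_ ?_ ?_ ?_ (fun c n => ?_) a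
      · induction x with
        | zero => simp
        | add x y hx hy => simp only [map_add, hx, hy]
        | tmul a b => simp [counitHom_par]
      all_goals
        simp only [AlgHom.comp_apply, comulHom_C, comulHom_N, comulHom_eta, comulHom_etaP,
          comulHom_E, map_add, Twisted.lift_of, Algebra.TensorProduct.map_tmul, map_one,
          counitHom_C, counitHom_N, counitHom_eta, counitHom_etaP, counitHom_E,
          TensorProduct.zero_tmul, zero_add, AlgHom.id_apply,
          Algebra.TensorProduct.includeRight_apply])
    (fun a => by
      refine hom_ext' (f := (Twisted.lift (Algebra.TensorProduct.map (AlgHom.id ℂ (Gl ℏ))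
          -- For id ⊗ ε it is the parity of the second leg that is invisible.
          (counitHom ℏ)) (.inr fun x => ?_)).comp (comulHom ℏ))
        (f' := Algebra.TensorProduct.includeLeft) ?_ ?_ ?_ ?_ (fun c n => ?_) a
      · induction x with
        | zero => simp
        | add x y hx hy => simp only [map_add, hx, hy]
        | tmul a b => simp [counitHom_par]
      all_goals
        simp only [AlgHom.comp_apply, comulHom_C, comulHom_N, comulHom_eta, comulHom_etaP,
          comulHom_E, map_add, Twisted.lift_of, Algebra.TensorProduct.map_tmul, map_one,
          counitHom_C, counitHom_N, counitHom_eta, counitHom_etaP, counitHom_E,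
          TensorProduct.tmul_zero, add_zero, AlgHom.id_apply,
          Algebra.TensorProduct.includeLeft_apply])
    (induction (SuperOpposite.AntipodeAt.algebraMap) antipodeAt_gen
      (fun _ _ => SuperOpposite.AntipodeAt.mul comulHom_par counitHom_par fun a =>
        SuperOpposite.lin_eq _ (by
          rw [antipodeHom_par, ← SuperOpposite.op_lin, SuperOpposite.parity_op]))
      (fun _ _ => SuperOpposite.AntipodeAt.add))

theorem isStandard_superHopf : IsStandard (superHopf ℏ) where
  parity_C := par_C
  parity_N := par_N
  parity_E := par_E
  parity_eta := par_eta
  parity_etaP := par_etaP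
  comul_C := comulHom_C
  comul_N := comulHom_N
  comul_E := comulHom_E
  comul_eta := by
    rw [qpow, qpow, mul_one, mul_zero, mul_neg, mul_one]; exact comulHom_eta
  comul_etaP := by
    rw [qpow, qpow, mul_one, mul_zero, mul_neg, mul_one]; exact comulHom_etaP

end Gl

/-! ### Exponentials in complex Banach algebras -/

section Exp

variable {B : Type*} [NormedRing B] [NormedAlgebra ℂ B] [CompleteSpace B]

theorem exp_add_of_commute_complex {a b : B} (h : Commute a b) :
    NormedSpace.exp (a + b) = NormedSpace.exp a * NormedSpace.exp b :=
  letI := NormedAlgebra.restrictScalars ℚ ℂ B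
  NormedSpace.exp_add_of_commute h

theorem isUnit_exp_complex (a : B) : IsUnit (NormedSpace.exp a) :=
  letI := NormedAlgebra.restrictScalars ℚ ℂ B
  NormedSpace.isUnit_exp a

/-- An intertwiner of a and b intertwines all powers, hence the exponentials. This is the tool that
moves root vectors past exponential factors, and also the one that evaluates exponentials on
eigenvectors. -/
theorem exp_mul_eq_of_mul_eq {x a b : B} (h : x * a = b * x) :
    x * NormedSpace.exp a = NormedSpace.exp b * x :=
  letI := NormedAlgebra.restrictScalars ℚ ℂ B
  SemiconjBy.exp_right (show SemiconjBy x a b from h)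

theorem map_exp_complex {B' : Type*} [NormedRing B'] [NormedAlgebra ℂ B'] [CompleteSpace B']
    (f : B →ₐ[ℂ] B') (hf : Continuous f) (a : B) :
    f (NormedSpace.exp a) = NormedSpace.exp (f a) :=
  letI := NormedAlgebra.restrictScalars ℚ ℂ B
  letI := NormedAlgebra.restrictScalars ℚ ℂ B'
  NormedSpace.map_exp f hf a

end Exp

/-! ### Universal `R`-matrices of super-Hopf algebras with one pair of root vectors -/

namespace SuperHopfAlgebra

variable {A : Type*} [Ring A] [Algebra ℂ A]

/-- Generators of a super-Hopf algebra: commuting primitive elements `hᵢ`, group-like elements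
`E s` that stand for `exp (∑ sᵢ hᵢ)`, and skew primitive root vectors `X`, `Y` of weights `±α` and
square zero, both even (`ε = 1`) or both odd (`ε = -1`). -/
structure RootDatum (D : SuperHopfAlgebra A) (ι : Type*) [Fintype ι] where
  h : ι → A
  E : (ι → ℂ) → A
  X : A
  Y : A
  α : ι → ℂ
  k₁ : ι → ℂ
  k₂ : ι → ℂ
  ε : ℂ
  q : ℂ
  sign : ε = 1 ∨ ε = -1
  q_ne_zero : q ≠ 0
  q_sq_ne_one : q ^ 2 ≠ 1
  parity_h : ∀ i, D.parity (h i) = h i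
  parity_E : ∀ s, D.parity (E s) = E s
  parity_X : D.parity X = ε • X
  parity_Y : D.parity Y = ε • Y
  comul_h : ∀ i, D.comul (h i) = h i ⊗ₜ 1 + 1 ⊗ₜ h i
  comul_E : ∀ s, D.comul (E s) = E s ⊗ₜ E s
  comul_X : D.comul X = X ⊗ₜ E k₁ + E (-k₂) ⊗ₜ X
  comul_Y : D.comul Y = Y ⊗ₜ E k₂ + E (-k₁) ⊗ₜ Y
  h_h : ∀ i j, h i * h j = h j * h i
  E_h : ∀ s i, E s * h i = h i * E s
  h_X : ∀ i, h i * X = X * h i + α i • X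
  h_Y : ∀ i, h i * Y = Y * h i - α i • Y
  E_zero : E 0 = 1
  E_add : ∀ s t, E s * E t = E (s + t)
  E_X : ∀ s, E s * X = Complex.exp (∑ i, α i * s i) • (X * E s)
  E_Y : ∀ s, E s * Y = Complex.exp (-∑ i, α i * s i) • (Y * E s)
  exp_k₂ : Complex.exp (∑ i, α i * k₂ i) = -ε * q⁻¹
  X_X : X * X = 0
  Y_Y : Y * Y = 0
  X_Y : X * Y = ε • (Y * X) + (q - q⁻¹)⁻¹ • (E (k₁ + k₂) - E (-(k₁ + k₂)))
  adjoin : Algebra.adjoin ℂ (Set.range h ∪ Set.range E ∪ {X, Y}) = ⊤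

/-- One sign rule for even and for odd root vectors, so that the ordinary and the super case are a
single calculation. -/
theorem SuperCommute.comm_sign {B : Type*} [Ring B] [Algebra ℂ B] {D : SuperHopfAlgebra A}
    {x y : A →ₐ[ℂ] B} (h : D.SuperCommute x y) {ε : ℂ} (hε : ε = 1 ∨ ε = -1) {a b : A}
    (ha : D.parity a = ε • a) (hb : D.parity b = ε • b) : y b * x a = ε • (x a * y b) := by
  rcases hε with rfl | rfl
  · rw [one_smul, h.even_left a b (by rw [ha, one_smul])]
  · rw [h.odd_odd a b (by rw [ha, neg_one_smul]) (by rw [hb, neg_one_smul]), neg_one_smul, neg_neg]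

namespace RootDatum

variable {D : SuperHopfAlgebra A} {ι : Type*} [Fintype ι] (G : D.RootDatum ι)

/-- The homomorphisms that send `E s` to `exp (∑ sᵢ hᵢ)`. -/
def IsPoint : PointClass A := fun _ _ _ _ x =>
  ∀ s, x (G.E s) = NormedSpace.exp (∑ i, s i • x (G.h i))

/-- The normalized root vector `E k₂ X`. -/
def e : A := G.E G.k₂ * G.X

/-- The normalized root vector `E (-k₂) Y`. -/
def f : A := G.E (-G.k₂) * G.Y

theorem ε_mul_ε : G.ε * G.ε = 1 := by rcases G.sign with h | h <;> simp [h]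

theorem ε_ne_zero : G.ε ≠ 0 := by rcases G.sign with h | h <;> simp [h]

theorem E_comm (s t : ι → ℂ) : G.E s * G.E t = G.E t * G.E s := by
  rw [G.E_add, G.E_add, add_comm]

theorem X_E (s : ι → ℂ) : G.X * G.E s = Complex.exp (-∑ i, G.α i * s i) • (G.E s * G.X) := by
  rw [G.E_X, smul_smul, ← Complex.exp_add, neg_add_cancel, Complex.exp_zero, one_smul]

theorem Y_E (s : ι → ℂ) : G.Y * G.E s = Complex.exp (∑ i, G.α i * s i) • (G.E s * G.Y) := by
  rw [G.E_Y, smul_smul, ← Complex.exp_add, add_neg_cancel, Complex.exp_zero, one_smul]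

theorem parity_e : D.parity G.e = G.ε • G.e := by
  rw [e, map_mul, G.parity_E, G.parity_X, mul_smul_comm]

theorem parity_f : D.parity G.f = G.ε • G.f := by
  rw [f, map_mul, G.parity_E, G.parity_Y, mul_smul_comm]

theorem e_E (s : ι → ℂ) : G.e * G.E s = Complex.exp (-∑ i, G.α i * s i) • (G.E s * G.e) := by
  rw [e, mul_assoc, G.X_E, mul_smul_comm, ← mul_assoc, ← mul_assoc, G.E_comm]

theorem f_E (s : ι → ℂ) : G.f * G.E s = Complex.exp (∑ i, G.α i * s i) • (G.E s * G.f) := by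
  rw [f, mul_assoc, G.Y_E, mul_smul_comm, ← mul_assoc, ← mul_assoc, G.E_comm]

theorem h_e (i : ι) : G.h i * G.e = G.e * G.h i + G.α i • G.e := by
  rw [e, ← mul_assoc, ← G.E_h, mul_assoc, G.h_X, mul_add, mul_smul_comm, mul_assoc]

theorem h_f (i : ι) : G.h i * G.f = G.f * G.h i - G.α i • G.f := by
  rw [f, ← mul_assoc, ← G.E_h, mul_assoc, G.h_Y, mul_sub, mul_smul_comm, mul_assoc]

theorem e_e : G.e * G.e = 0 := by
  nth_rewrite 2 [e]
  rw [← mul_assoc, e_E, smul_mul_assoc, e, mul_assoc, mul_assoc, G.X_X, mul_zero, mul_zero,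
    smul_zero]

theorem f_f : G.f * G.f = 0 := by
  nth_rewrite 2 [f]
  rw [← mul_assoc, f_E, smul_mul_assoc, f, mul_assoc, mul_assoc, G.Y_Y, mul_zero, mul_zero,
    smul_zero]

theorem e_X : G.e * G.X = 0 := by rw [e, mul_assoc, G.X_X, mul_zero]

theorem f_Y : G.f * G.Y = 0 := by rw [f, mul_assoc, G.Y_Y, mul_zero]

theorem X_e : G.X * G.e = 0 := by
  rw [e, ← mul_assoc, G.X_E, smul_mul_assoc, mul_assoc, G.X_X, mul_zero, smul_zero]

theorem Y_f : G.Y * G.f = 0 := by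
  rw [f, ← mul_assoc, G.Y_E, smul_mul_assoc, mul_assoc, G.Y_Y, mul_zero, smul_zero]

theorem exp_neg_k₂ : Complex.exp (∑ i, G.α i * (-G.k₂) i) = -G.ε * G.q := by
  have h := G.q_ne_zero
  have h' := G.ε_ne_zero
  have h2 := G.ε_mul_ε
  simp only [Pi.neg_apply, mul_neg, Finset.sum_neg_distrib, Complex.exp_neg, G.exp_k₂]
  field_simp
  linear_combination h2

theorem e_E_neg_k₂ : G.e * G.E (-G.k₂) = (-G.ε * G.q⁻¹) • G.X := by
  rw [e_E, Complex.exp_neg, exp_neg_k₂, e, ← mul_assoc, G.E_add, neg_add_cancel, G.E_zero, one_mul]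
  congr 1
  have h' := G.ε_ne_zero
  have h2 := G.ε_mul_ε
  have h := G.q_ne_zero
  field_simp
  linear_combination h2

theorem f_E_k₂ : G.f * G.E G.k₂ = (-G.ε * G.q⁻¹) • G.Y := by
  rw [f_E, G.exp_k₂, f, ← mul_assoc, G.E_add, add_neg_cancel, G.E_zero, one_mul]

/-- This fixes the coefficient 1 - q² of e ⊗ f: combined with the factor q⁻¹ from reordering, it
cancels the denominator q - q⁻¹ in the relation between X and Y. -/
theorem scalar_aux : (1 - G.q ^ 2) * G.q⁻¹ * (G.q - G.q⁻¹)⁻¹ = -1 := by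
  have h := G.q_ne_zero
  have h1 : G.q - G.q⁻¹ ≠ 0 := fun h0 => G.q_sq_ne_one (by field_simp at h0; linear_combination h0)
  rw [mul_inv_eq_iff_eq_mul₀ h1]
  field_simp
  ring

theorem X_f : G.X * G.f = (-G.ε * G.q⁻¹) • (G.E (-G.k₂) * G.X * G.Y) := by
  rw [f, ← mul_assoc, G.X_E, Complex.exp_neg, exp_neg_k₂, smul_mul_assoc]
  congr 1
  have h' := G.ε_ne_zero
  have h2 := G.ε_mul_ε
  have h := G.q_ne_zero
  field_simp
  linear_combination h2

theorem Y_e : G.Y * G.e = (-G.ε * G.q⁻¹) • (G.E G.k₂ * G.Y * G.X) := by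
  rw [e, ← mul_assoc, G.Y_E, G.exp_k₂, smul_mul_assoc]

/-- The combination left in the second leg when the nilpotent factor passes the coproduct of X. The
terms with both root vectors cancel, and `scalar_aux` leaves a difference of group-like elements,
which corrects the Cartan factor beside X. -/
theorem commutator_X_f : (1 - G.q ^ 2) • ((-G.ε * G.q⁻¹) • (G.f * G.X) - G.ε • (G.X * G.f)) =
    G.E (-(G.k₁ + G.k₂ + G.k₂)) - G.E G.k₁ := by
  have h1 : G.E (-G.k₂) * G.E (G.k₁ + G.k₂) = G.E G.k₁ := by rw [G.E_add]; congr 1; abel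
  have h2 : G.E (-G.k₂) * G.E (-(G.k₁ + G.k₂)) = G.E (-(G.k₁ + G.k₂ + G.k₂)) := by
    rw [G.E_add]; congr 1; abel
  rw [X_f, mul_assoc, G.X_Y, f, mul_add, mul_smul_comm, mul_smul_comm, mul_sub, h1, h2,
    mul_assoc]
  have h3 := G.ε_mul_ε
  have h4 := G.scalar_aux
  match_scalars
  · linear_combination (1 - G.q ^ 2) * G.q⁻¹ * G.ε * h3
  · linear_combination G.ε * G.ε * h4 - h3
  · linear_combination -G.ε * G.ε * h4 + h3

/-- The analogue for the coproduct of Y, where the combination appears in the first leg. -/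
theorem commutator_e_Y : (1 - G.q ^ 2) • ((-G.q⁻¹) • (G.e * G.Y) - G.Y * G.e) =
    G.E (G.k₁ + G.k₂ + G.k₂) - G.E (-G.k₁) := by
  have h1 : G.E G.k₂ * G.E (-(G.k₁ + G.k₂)) = G.E (-G.k₁) := by rw [G.E_add]; congr 1; abel
  have h2 : G.E G.k₂ * G.E (G.k₁ + G.k₂) = G.E (G.k₁ + G.k₂ + G.k₂) := by
    rw [G.E_add]; congr 1; abel
  rw [Y_e, e, mul_assoc, G.X_Y, mul_add, mul_smul_comm, mul_smul_comm, mul_sub, h1, h2,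
    mul_assoc]
  have h3 := G.ε_mul_ε
  have h4 := G.scalar_aux
  match_scalars
  · ring
  · linear_combination -h4
  · linear_combination h4

/-- Multiplication by E(k₂) trivialises one of the two group-like factors in the coproduct of X; f
is normalised in the same way. The coproduct identities of the R-matrix then need only the element
E(k₁+k₂) and its inverse. -/
theorem comul_e : D.comul G.e = G.e ⊗ₜ G.E (G.k₁ + G.k₂) + 1 ⊗ₜ G.e := by
  rw [e, D.comul_mul, G.comul_E, G.comul_X, superMul_add_right,
    superMul_even_left _ _ _ _ _ (G.parity_E _), superMul_even_left _ _ _ _ _ (G.parity_E _),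
    G.E_add, G.E_add, add_neg_cancel, G.E_zero, add_comm G.k₂]

theorem comul_f : D.comul G.f = G.f ⊗ₜ 1 + G.E (-(G.k₁ + G.k₂)) ⊗ₜ G.f := by
  rw [f, D.comul_mul, G.comul_E, G.comul_Y, superMul_add_right,
    superMul_even_left _ _ _ _ _ (G.parity_E _), superMul_even_left _ _ _ _ _ (G.parity_E _),
    G.E_add, G.E_add, neg_add_cancel, G.E_zero, neg_add_rev]

end RootDatum

end SuperHopfAlgebra

/-! ### Root data evaluated at super-commuting pairs -/

namespace SuperHopfAlgebra.RootDatum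

variable {A : Type*} [Ring A] [Algebra ℂ A] {D : SuperHopfAlgebra A} {ι : Type*} [Fintype ι]
  (G : D.RootDatum ι)

section Eval

variable {B : Type*} [Ring B] [Algebra ℂ B]

/-- The bilinear expression `∑ βᵢⱼ hᵢ ⊗ hⱼ` evaluated at `x, y`. -/
def form (β : ι → ι → ℂ) (x y : A →ₐ[ℂ] B) : B :=
  ∑ i, ∑ j, β i j • (x (G.h i) * y (G.h j))

/-- `1 ⊗ 1 + (1 - q²) E(k₂) X ⊗ E(-k₂) Y` evaluated at `x, y`. -/
def theta (x y : A →ₐ[ℂ] B) : B := 1 + (1 - G.q ^ 2) • (x G.e * y G.f)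

/-- The linear combination `∑ sᵢ hᵢ`. -/
def lin (s : ι → ℂ) : A := ∑ i, s i • G.h i

theorem map_lin (x : A →ₐ[ℂ] B) (s : ι → ℂ) : x (G.lin s) = ∑ i, s i • x (G.h i) := by
  simp [lin]

theorem lin_X (s : ι → ℂ) : G.lin s * G.X = G.X * G.lin s + (∑ i, G.α i * s i) • G.X := by
  simp only [lin, Finset.sum_mul, Finset.mul_sum, smul_mul_assoc, mul_smul_comm, G.h_X, smul_add,
    Finset.sum_add_distrib, smul_smul, Finset.sum_smul, mul_comm]

theorem lin_Y (s : ι → ℂ) : G.lin s * G.Y = G.Y * G.lin s - (∑ i, G.α i * s i) • G.Y := by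
  simp only [lin, Finset.sum_mul, Finset.mul_sum, smul_mul_assoc, mul_smul_comm, G.h_Y, smul_sub,
    Finset.sum_sub_distrib, smul_smul, Finset.sum_smul, mul_comm]

variable {G} {x y z : A →ₐ[ℂ] B} {β : ι → ι → ℂ}

/-- Grouping by the second index puts the first leg in the form ∑ sᵢhᵢ, whose commutator with a root
vector is a multiple of that vector. -/
theorem form_eq_left (x y : A →ₐ[ℂ] B) :
    G.form β x y = ∑ j, x (G.lin fun i => β i j) * y (G.h j) := by
  rw [form, Finset.sum_comm]
  simp only [map_lin, Finset.sum_mul, smul_mul_assoc]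

/-- By [∑ sᵢhᵢ, X] = (∑ αᵢsᵢ)X, commuting with X ⊗ 1 contracts the first index of β with α, and the
hypothesis `hβ` identifies the contraction with k₁ + k₂. This is the only place where β and the root
data are linked for X; the next lemma does it for Y. -/
theorem form_mul_left_X (hβ : ∀ j, ∑ i, G.α i * β i j = (G.k₁ + G.k₂) j)
    (h : D.SuperCommute x y) :
    G.form β x y * x G.X = x G.X * (G.form β x y + y (G.lin (G.k₁ + G.k₂))) := by
  have h1 (j : ι) : x (G.lin fun i => β i j) * y (G.h j) * x G.X =
      x G.X * (x (G.lin fun i => β i j) * y (G.h j)) +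
        x G.X * ((G.k₁ + G.k₂) j • y (G.h j)) := by
    rw [mul_assoc, ← h.even_right _ _ (G.parity_h j), ← mul_assoc, ← map_mul, lin_X, hβ, map_add,
      map_mul, map_smul, add_mul, mul_assoc, smul_mul_assoc, mul_smul_comm]
  rw [form_eq_left, Finset.sum_mul, Finset.sum_congr rfl fun j _ => h1 j, Finset.sum_add_distrib,
    ← Finset.mul_sum, ← Finset.mul_sum, map_lin, ← mul_add]

theorem form_mul_left_Y (hβ : ∀ j, ∑ i, G.α i * β i j = (G.k₁ + G.k₂) j)
    (h : D.SuperCommute x y) :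
    G.form β x y * x G.Y = x G.Y * (G.form β x y - y (G.lin (G.k₁ + G.k₂))) := by
  have h1 (j : ι) : x (G.lin fun i => β i j) * y (G.h j) * x G.Y =
      x G.Y * (x (G.lin fun i => β i j) * y (G.h j)) -
        x G.Y * ((G.k₁ + G.k₂) j • y (G.h j)) := by
    rw [mul_assoc, ← h.even_right _ _ (G.parity_h j), ← mul_assoc, ← map_mul, lin_Y, hβ, map_sub,
      map_mul, map_smul, sub_mul, mul_assoc, smul_mul_assoc, mul_smul_comm]
  rw [form_eq_left, Finset.sum_mul, Finset.sum_congr rfl fun j _ => h1 j, Finset.sum_sub_distrib,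
    ← Finset.mul_sum, ← Finset.mul_sum, map_lin, ← mul_sub]

/-- With β symmetric the two legs play equal roles, so statements about root vectors in the first
leg also serve for the second. -/
theorem form_swap (hsymm : ∀ i j, β i j = β j i) (h : D.SuperCommute x y) :
    G.form β x y = G.form β y x := by
  rw [form, form, Finset.sum_comm]
  refine Finset.sum_congr rfl fun j _ => Finset.sum_congr rfl fun i _ => ?_
  rw [hsymm, h.even_left _ _ (G.parity_h i)]

theorem commute_form_h_left (h : D.SuperCommute x y) (i : ι) :
    Commute (G.form β x y) (x (G.h i)) := by
  refine Commute.sum_left _ _ _ fun k _ => Commute.sum_left _ _ _ fun j _ =>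
    Commute.smul_left (Commute.mul_left ?_ ?_) _
  · rw [Commute, SemiconjBy, ← map_mul, ← map_mul, G.h_h]
  · exact (h.even_left _ _ (G.parity_h i)).symm

theorem commute_form_h_right (h : D.SuperCommute x y) (i : ι) :
    Commute (G.form β x y) (y (G.h i)) := by
  refine Commute.sum_left _ _ _ fun k _ => Commute.sum_left _ _ _ fun j _ =>
    Commute.smul_left (Commute.mul_left ?_ ?_) _
  · exact h.even_right _ _ (G.parity_h i)
  · rw [Commute, SemiconjBy, ← map_mul, ← map_mul, G.h_h]

theorem commute_form_E_left (h : D.SuperCommute x y) (s : ι → ℂ) :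
    Commute (G.form β x y) (x (G.E s)) := by
  refine Commute.sum_left _ _ _ fun k _ => Commute.sum_left _ _ _ fun j _ =>
    Commute.smul_left (Commute.mul_left ?_ ?_) _
  · rw [Commute, SemiconjBy, ← map_mul, ← map_mul, G.E_h]
  · exact (h.even_left _ _ (G.parity_E s)).symm

theorem commute_form_E_right (h : D.SuperCommute x y) (s : ι → ℂ) :
    Commute (G.form β x y) (y (G.E s)) := by
  refine Commute.sum_left _ _ _ fun k _ => Commute.sum_left _ _ _ fun j _ =>
    Commute.smul_left (Commute.mul_left ?_ ?_) _
  · exact h.even_right _ _ (G.parity_E s)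
  · rw [Commute, SemiconjBy, ← map_mul, ← map_mul, G.E_h]

theorem commute_form_lin_right (h : D.SuperCommute x y) (s : ι → ℂ) :
    Commute (G.form β x y) (y (G.lin s)) := by
  rw [map_lin]
  exact Commute.sum_right _ _ _ fun i _ => (commute_form_h_right h i).smul_right _

/-- The hᵢ are even, so super-commutation with them is ordinary commutation whatever the parity of
`a`. -/
theorem commute_form_of_even (hx : D.SuperCommute x y) (hz : D.SuperCommute x z) (a : A) :
    Commute (G.form β y z) (x a) := by
  refine Commute.sum_left _ _ _ fun k _ => Commute.sum_left _ _ _ fun j _ =>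
    Commute.smul_left (Commute.mul_left ?_ ?_) _
  · exact (hx.even_right _ _ (G.parity_h k)).symm
  · exact (hz.even_right _ _ (G.parity_h j)).symm

/-- Products of evaluations of root vectors. -/
theorem mul_mul_mul_comm_sign (h : D.SuperCommute x y) {b c : A} (a d : A)
    (hb : D.parity b = G.ε • b) (hc : D.parity c = G.ε • c) :
    x a * y b * (x c * y d) = G.ε • (x (a * c) * y (b * d)) := by
  rw [mul_assoc, ← mul_assoc (y b), h.comm_sign G.sign hc hb, map_mul, map_mul]
  simp only [smul_mul_assoc, mul_smul_comm, mul_assoc]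

theorem mul_mul_mul_comm_left (h : D.SuperCommute x y) {b : A} (a c d : A)
    (hb : D.parity b = b) : x a * y b * (x c * y d) = x (a * c) * y (b * d) := by
  rw [mul_assoc, ← mul_assoc (y b), ← h.even_right _ _ hb, map_mul, map_mul]
  simp only [mul_assoc]

theorem mul_mul_mul_comm_right (h : D.SuperCommute x y) {c : A} (a b d : A)
    (hc : D.parity c = c) : x a * y b * (x c * y d) = x (a * c) * y (b * d) := by
  rw [mul_assoc, ← mul_assoc (y b), ← h.even_left _ _ hc, map_mul, map_mul]
  simp only [mul_assoc]

/-- The element n = (1 - q²) e ⊗ f has square zero, as e² = 0, so 1 + n and 1 - n are inverse to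
each other. -/
theorem theta_mul_theta_neg (h : D.SuperCommute x y) :
    G.theta x y * (1 - (1 - G.q ^ 2) • (x G.e * y G.f)) = 1 ∧
      (1 - (1 - G.q ^ 2) • (x G.e * y G.f)) * G.theta x y = 1 := by
  have h0 : x G.e * y G.f * (x G.e * y G.f) = 0 := by
    rw [mul_mul_mul_comm_sign h _ _ G.parity_f G.parity_e, e_e, map_zero, zero_mul, smul_zero]
  constructor <;>
  · simp only [theta, mul_sub, sub_mul, mul_add, add_mul, smul_mul_assoc, mul_smul_comm, h0,
      one_mul, mul_one]
    module

theorem isUnit_theta (h : D.SuperCommute x y) : IsUnit (G.theta x y) :=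
  ⟨⟨_, _, (theta_mul_theta_neg h).1, (theta_mul_theta_neg h).2⟩, rfl⟩

/-- The first half of the intertwining property. The right-hand factor is the opposite coproduct of
X conjugated by the exponential factor, so the nilpotent factor does only the purely algebraic part.
Two of the four products with e ⊗ f vanish by X² = 0, and the other two combine through
`commutator_X_f`. -/
theorem theta_mul_X (h : D.SuperCommute x y) :
    G.theta x y * (x G.X * y (G.E G.k₁) + x (G.E (-G.k₂)) * y G.X) =
      (x (G.E (-G.k₂)) * y G.X + x G.X * y (G.E (-(G.k₁ + G.k₂ + G.k₂)))) * G.theta x y := by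
  have h1 : x G.e * y G.f * (x G.X * y (G.E G.k₁)) = 0 := by
    rw [mul_mul_mul_comm_sign h _ _ G.parity_f G.parity_X, e_X, map_zero, zero_mul, smul_zero]
  have h2 : x G.e * y G.f * (x (G.E (-G.k₂)) * y G.X) =
      (-G.ε * G.q⁻¹) • (x G.X * y (G.f * G.X)) := by
    rw [mul_mul_mul_comm_right h _ _ _ (G.parity_E _), e_E_neg_k₂, map_smul, smul_mul_assoc]
  have h3 : x (G.E (-G.k₂)) * y G.X * (x G.e * y G.f) = G.ε • (x G.X * y (G.X * G.f)) := by
    rw [mul_mul_mul_comm_sign h _ _ G.parity_X G.parity_e, e, ← mul_assoc, G.E_add,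
      neg_add_cancel, G.E_zero, one_mul]
  have h4 : x G.X * y (G.E (-(G.k₁ + G.k₂ + G.k₂))) * (x G.e * y G.f) = 0 := by
    rw [mul_mul_mul_comm_left h _ _ _ (G.parity_E _), X_e, map_zero, zero_mul]
  have h5 := congrArg (fun a => x G.X * y a) G.commutator_X_f
  simp only [map_smul, map_sub, mul_sub, mul_smul_comm] at h5
  simp only [theta, add_mul, mul_add, one_mul, mul_one, smul_mul_assoc, mul_smul_comm, h1, h2, h3,
    h4, smul_zero, add_zero, zero_add]
  linear_combination (norm := module) h5

theorem theta_mul_Y (h : D.SuperCommute x y) :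
    G.theta x y * (x G.Y * y (G.E G.k₂) + x (G.E (-G.k₁)) * y G.Y) =
      (x (G.E (G.k₁ + G.k₂ + G.k₂)) * y G.Y + x G.Y * y (G.E G.k₂)) * G.theta x y := by
  have h1 : x G.e * y G.f * (x G.Y * y (G.E G.k₂)) = (-G.q⁻¹) • (x (G.e * G.Y) * y G.Y) := by
    rw [mul_mul_mul_comm_sign h _ _ G.parity_f G.parity_Y, f_E_k₂, map_smul, mul_smul_comm,
      smul_smul]
    congr 1
    linear_combination (-G.q⁻¹) * G.ε_mul_ε
  have h2 : x G.e * y G.f * (x (G.E (-G.k₁)) * y G.Y) = 0 := by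
    rw [mul_mul_mul_comm_right h _ _ _ (G.parity_E _), f_Y, map_zero, mul_zero]
  have h3 : x (G.E (G.k₁ + G.k₂ + G.k₂)) * y G.Y * (x G.e * y G.f) = 0 := by
    rw [mul_mul_mul_comm_sign h _ _ G.parity_Y G.parity_e, Y_f, map_zero, mul_zero, smul_zero]
  have h4 : x G.Y * y (G.E G.k₂) * (x G.e * y G.f) = x (G.Y * G.e) * y G.Y := by
    rw [mul_mul_mul_comm_left h _ _ _ (G.parity_E _), f, ← mul_assoc (G.E _), G.E_add,
      add_neg_cancel, G.E_zero, one_mul]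
  have h5 := congrArg (fun a => x a * y G.Y) G.commutator_e_Y
  simp only [map_smul, map_sub, sub_mul, smul_mul_assoc] at h5
  simp only [theta, add_mul, mul_add, one_mul, mul_one, smul_mul_assoc, mul_smul_comm, h1, h2, h3,
    h4, smul_zero, add_zero, zero_add]
  linear_combination (norm := module) h5

/-- The weights α of e and -α of f cancel, so e ⊗ f commutes with the coproduct of every hᵢ. The
same holds for the group-like elements below. -/
theorem theta_mul_h (h : D.SuperCommute x y) (i : ι) :
    G.theta x y * (x (G.h i) + y (G.h i)) = (x (G.h i) + y (G.h i)) * G.theta x y := by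
  have h1 : x G.e * y G.f * x (G.h i) = x (G.h i) * (x G.e * y G.f) - G.α i • (x G.e * y G.f) := by
    rw [mul_assoc, ← h.even_left _ _ (G.parity_h i), ← mul_assoc, ← map_mul,
      ← add_sub_cancel_right (G.e * G.h i) (G.α i • G.e), ← h_e, map_sub, map_mul, map_smul,
      sub_mul, smul_mul_assoc, mul_assoc]
  have h2 : x G.e * y G.f * y (G.h i) = y (G.h i) * (x G.e * y G.f) + G.α i • (x G.e * y G.f) := by
    rw [mul_assoc, ← map_mul, ← sub_add_cancel (G.f * G.h i) (G.α i • G.f), ← h_f, map_add,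
      map_mul, map_smul, mul_add, mul_smul_comm, ← mul_assoc, ← mul_assoc,
      h.even_right _ _ (G.parity_h i)]
  simp only [theta, add_mul, mul_add, one_mul, mul_one, smul_mul_assoc, mul_smul_comm, h1, h2]
  module

theorem theta_mul_E (h : D.SuperCommute x y) (s : ι → ℂ) :
    G.theta x y * (x (G.E s) * y (G.E s)) = x (G.E s) * y (G.E s) * G.theta x y := by
  have h1 : x G.e * y G.f * (x (G.E s) * y (G.E s)) =
      x (G.E s) * y (G.E s) * (x G.e * y G.f) := by
    rw [mul_mul_mul_comm_right h _ _ _ (G.parity_E s),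
      mul_mul_mul_comm_left h _ _ _ (G.parity_E s), e_E, f_E, map_smul, map_smul,
      smul_mul_smul_comm, ← Complex.exp_add, neg_add_cancel, Complex.exp_zero, one_smul]
  simp only [theta, add_mul, mul_add, one_mul, mul_one, smul_mul_assoc, mul_smul_comm, h1]

theorem conv_X (h : D.SuperCommute x y) :
    h.conv G.X = x G.X * y (G.E G.k₁) + x (G.E (-G.k₂)) * y G.X := by
  rw [h.conv_apply, G.comul_X, map_add, evalPair_tmul, evalPair_tmul]

theorem conv_Y (h : D.SuperCommute x y) :
    h.conv G.Y = x G.Y * y (G.E G.k₂) + x (G.E (-G.k₁)) * y G.Y := by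
  rw [h.conv_apply, G.comul_Y, map_add, evalPair_tmul, evalPair_tmul]

theorem conv_h (h : D.SuperCommute x y) (i : ι) : h.conv (G.h i) = x (G.h i) + y (G.h i) := by
  simp [h.conv_apply, G.comul_h]

theorem conv_E (h : D.SuperCommute x y) (s : ι → ℂ) :
    h.conv (G.E s) = x (G.E s) * y (G.E s) := by
  rw [h.conv_apply, G.comul_E, evalPair_tmul]

theorem conv_e (h : D.SuperCommute x y) :
    h.conv G.e = x G.e * y (G.E (G.k₁ + G.k₂)) + y G.e := by
  rw [h.conv_apply, G.comul_e, map_add, evalPair_tmul, evalPair_tmul, map_one, one_mul]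

theorem conv_f (h : D.SuperCommute x y) :
    h.conv G.f = x G.f + x (G.E (-(G.k₁ + G.k₂))) * y G.f := by
  rw [h.conv_apply, G.comul_f, map_add, evalPair_tmul, evalPair_tmul, map_one, mul_one]

theorem commute_form_form_left (hxy : D.SuperCommute x y) (hxz : D.SuperCommute x z)
    (hyz : D.SuperCommute y z) : Commute (G.form β x z) (G.form β y z) := by
  refine Commute.sum_right _ _ _ fun k _ => Commute.sum_right _ _ _ fun j _ =>
    Commute.smul_right (Commute.mul_right ?_ (commute_form_h_right hxz j)) _
  exact commute_form_of_even hxy.symm hyz _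

theorem commute_form_form_right (hxy : D.SuperCommute x y) (hxz : D.SuperCommute x z)
    (hyz : D.SuperCommute y z) : Commute (G.form β x z) (G.form β x y) := by
  refine Commute.sum_right _ _ _ fun k _ => Commute.sum_right _ _ _ fun j _ =>
    Commute.smul_right (Commute.mul_right (commute_form_h_left hxz k) ?_) _
  exact commute_form_of_even hxy.symm hyz _

end Eval

/-! ### Exponential factors and the R-matrix identities in Banach algebras -/

section Banach

variable {B : Type*} [NormedRing B] [NormedAlgebra ℂ B] [CompleteSpace B] 

/-- `exp (∑ βᵢⱼ hᵢ ⊗ hⱼ) (1 ⊗ 1 + (1 - q²) E(k₂) X ⊗ E(-k₂) Y)` evaluated at `x, y`. -/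
def R (β : ι → ι → ℂ) (x y : A →ₐ[ℂ] B) : B := NormedSpace.exp (G.form β x y) * G.theta x y

variable {G} {x y z : A →ₐ[ℂ] B} {β : ι → ι → ℂ}

/-- The form is shifted by an element commuting with it when X passes, so its exponential acquires a
factor, namely the exponential that represents E(k₁+k₂) in the second leg. -/
theorem exp_form_mul_left_X (hβ : ∀ j, ∑ i, G.α i * β i j = (G.k₁ + G.k₂) j)
    (h : D.SuperCommute x y) (hy : ∀ s, y (G.E s) = NormedSpace.exp (y (G.lin s))) :
    NormedSpace.exp (G.form β x y) * x G.X =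
      x G.X * (NormedSpace.exp (G.form β x y) * y (G.E (G.k₁ + G.k₂))) := by
  rw [hy, ← exp_add_of_commute_complex (commute_form_lin_right h _),
    exp_mul_eq_of_mul_eq (form_mul_left_X hβ h).symm]

theorem exp_form_mul_left_Y (hβ : ∀ j, ∑ i, G.α i * β i j = (G.k₁ + G.k₂) j)
    (h : D.SuperCommute x y) (hy : ∀ s, y (G.E s) = NormedSpace.exp (y (G.lin s))) :
    NormedSpace.exp (G.form β x y) * x G.Y =
      x G.Y * (NormedSpace.exp (G.form β x y) * y (G.E (-(G.k₁ + G.k₂)))) := by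
  have h1 : y (G.lin (-(G.k₁ + G.k₂))) = -y (G.lin (G.k₁ + G.k₂)) := by
    simp [lin, -neg_add_rev]
  rw [hy, h1, ← exp_add_of_commute_complex (commute_form_lin_right h _).neg_right,
    ← sub_eq_add_neg, exp_mul_eq_of_mul_eq (form_mul_left_Y hβ h).symm]

/-- `X ⊗ 1` moved to the right of the exponential. -/
theorem X_mul_exp_form (hβ : ∀ j, ∑ i, G.α i * β i j = (G.k₁ + G.k₂) j)
    (h : D.SuperCommute x y) (hy : ∀ s, y (G.E s) = NormedSpace.exp (y (G.lin s))) :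
    x G.X * NormedSpace.exp (G.form β x y) =
      NormedSpace.exp (G.form β x y) * (x G.X * y (G.E (-(G.k₁ + G.k₂)))) := by
  rw [← mul_assoc, exp_form_mul_left_X hβ h hy, mul_assoc, mul_assoc, ← map_mul, G.E_add,
    add_neg_cancel, G.E_zero, map_one, mul_one]

theorem Y_mul_exp_form (hβ : ∀ j, ∑ i, G.α i * β i j = (G.k₁ + G.k₂) j)
    (h : D.SuperCommute x y) (hy : ∀ s, y (G.E s) = NormedSpace.exp (y (G.lin s))) :
    x G.Y * NormedSpace.exp (G.form β x y) =
      NormedSpace.exp (G.form β x y) * (x G.Y * y (G.E (G.k₁ + G.k₂))) := by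
  rw [← mul_assoc, exp_form_mul_left_Y hβ h hy, mul_assoc, mul_assoc, ← map_mul, G.E_add,
    neg_add_cancel, G.E_zero, map_one, mul_one]

theorem IsPoint.exp_lin {B : Type} [NormedRing B] [NormedAlgebra ℂ B] [CompleteSpace B]
    {y : A →ₐ[ℂ] B} (hy : G.IsPoint B y) (s : ι → ℂ) :
    y (G.E s) = NormedSpace.exp (y (G.lin s)) := by
  rw [hy, map_lin]

theorem R_intertwine_X (hsymm : ∀ i j, β i j = β j i)
    (hβ : ∀ j, ∑ i, G.α i * β i j = (G.k₁ + G.k₂) j)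
    (h : D.SuperCommute x y) (hx : ∀ s, x (G.E s) = NormedSpace.exp (x (G.lin s)))
    (hy : ∀ s, y (G.E s) = NormedSpace.exp (y (G.lin s))) :
    G.R β x y * h.conv G.X = h.symm.conv G.X * G.R β x y := by
  have e1 : G.E (-(G.k₁ + G.k₂)) * G.E G.k₁ = G.E (-G.k₂) := by rw [G.E_add]; congr 1; abel
  have e2 : G.E (-G.k₂) * G.E (-(G.k₁ + G.k₂)) = G.E (-(G.k₁ + G.k₂ + G.k₂)) := by
    rw [G.E_add]; congr 1; abel
  -- Here X lies in the leg of `y`; `form_swap` exchanges the legs, so that `X_mul_exp_form` applies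
  -- to the pair y, x.
  have h1 : y G.X * x (G.E G.k₁) * NormedSpace.exp (G.form β x y) =
      NormedSpace.exp (G.form β x y) * (x (G.E (-G.k₂)) * y G.X) := by
    rw [mul_assoc, ← (commute_form_E_left h _).exp_left.eq, ← mul_assoc, form_swap hsymm h,
      X_mul_exp_form hβ h.symm hx, mul_assoc, mul_assoc, ← map_mul, e1,
      h.even_left _ _ (G.parity_E _)]
  have h2 : y (G.E (-G.k₂)) * x G.X * NormedSpace.exp (G.form β x y) =
      NormedSpace.exp (G.form β x y) * (x G.X * y (G.E (-(G.k₁ + G.k₂ + G.k₂)))) := by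
    rw [mul_assoc, X_mul_exp_form hβ h hy, ← mul_assoc,
      ← (commute_form_E_right h _).exp_left.eq, mul_assoc, ← mul_assoc (y _),
      ← h.even_right _ _ (G.parity_E _), mul_assoc, ← map_mul, e2]
  rw [R, mul_assoc, conv_X, conv_X, theta_mul_X h, ← mul_assoc, ← mul_assoc]
  congr 1
  rw [mul_add, add_mul, h1, h2]

theorem R_intertwine_Y (hsymm : ∀ i j, β i j = β j i)
    (hβ : ∀ j, ∑ i, G.α i * β i j = (G.k₁ + G.k₂) j)
    (h : D.SuperCommute x y) (hx : ∀ s, x (G.E s) = NormedSpace.exp (x (G.lin s)))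
    (hy : ∀ s, y (G.E s) = NormedSpace.exp (y (G.lin s))) :
    G.R β x y * h.conv G.Y = h.symm.conv G.Y * G.R β x y := by
  have e1 : G.E (G.k₁ + G.k₂) * G.E G.k₂ = G.E (G.k₁ + G.k₂ + G.k₂) := G.E_add _ _
  have e2 : G.E (-G.k₁) * G.E (G.k₁ + G.k₂) = G.E G.k₂ := by
    rw [G.E_add]; congr 1; abel
  have h1 : y G.Y * x (G.E G.k₂) * NormedSpace.exp (G.form β x y) =
      NormedSpace.exp (G.form β x y) * (x (G.E (G.k₁ + G.k₂ + G.k₂)) * y G.Y) := by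
    rw [mul_assoc, ← (commute_form_E_left h _).exp_left.eq, ← mul_assoc, form_swap hsymm h,
      Y_mul_exp_form hβ h.symm hx, mul_assoc, mul_assoc, ← map_mul, e1,
      h.even_left _ _ (G.parity_E _)]
  have h2 : y (G.E (-G.k₁)) * x G.Y * NormedSpace.exp (G.form β x y) =
      NormedSpace.exp (G.form β x y) * (x G.Y * y (G.E G.k₂)) := by
    rw [mul_assoc, Y_mul_exp_form hβ h hy, ← mul_assoc,
      ← (commute_form_E_right h _).exp_left.eq, mul_assoc, ← mul_assoc (y _),
      ← h.even_right _ _ (G.parity_E _), mul_assoc, ← map_mul, e2]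
  rw [R, mul_assoc, conv_Y, conv_Y, theta_mul_Y h, ← mul_assoc, ← mul_assoc]
  congr 1
  rw [mul_add, add_mul, h1, h2]

theorem R_intertwine (hsymm : ∀ i j, β i j = β j i)
    (hβ : ∀ j, ∑ i, G.α i * β i j = (G.k₁ + G.k₂) j)
    (h : D.SuperCommute x y) (hx : ∀ s, x (G.E s) = NormedSpace.exp (x (G.lin s)))
    (hy : ∀ s, y (G.E s) = NormedSpace.exp (y (G.lin s))) (a : A) :
    G.R β x y * h.conv a = h.symm.conv a * G.R β x y := by
  -- Both convolutions are algebra homomorphisms, so the elements satisfying the identity form a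
  -- subalgebra; generators are enough.
  have ha : a ∈ Algebra.adjoin ℂ (Set.range G.h ∪ Set.range G.E ∪ {G.X, G.Y}) := by
    rw [G.adjoin]; trivial
  induction ha using Algebra.adjoin_induction with
  | mem a ha =>
    rcases ha with (⟨i, rfl⟩ | ⟨s, rfl⟩) | rfl | rfl
    · rw [conv_h, conv_h, R, mul_assoc, theta_mul_h h, ← mul_assoc, ← mul_assoc, add_comm (y _)]
      congr 1
      exact ((commute_form_h_left h i).add_right (commute_form_h_right h i)).exp_left
    · rw [conv_E, conv_E, R, mul_assoc, theta_mul_E h, ← h.even_right _ _ (G.parity_E _),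
        ← mul_assoc, ← mul_assoc (x _ * y _)]
      congr 1
      exact ((commute_form_E_left h s).mul_right (commute_form_E_right h s)).exp_left
    · exact R_intertwine_X hsymm hβ h hx hy
    · exact R_intertwine_Y hsymm hβ h hx hy
  | algebraMap c => rw [AlgHom.commutes, AlgHom.commutes, Algebra.commutes]
  | add a b _ _ ha hb => rw [map_add, map_add, mul_add, add_mul, ha, hb]
  | mul a b _ _ ha hb => rw [map_mul, map_mul, ← mul_assoc, ha, mul_assoc, hb, mul_assoc]

/-- The form is additive in its first argument, so the exponentials agree once the one for y, z is
moved left past e ⊗ 1 ⊗ f. That move inserts E(k₁+k₂) in the middle leg, exactly the factor in the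
coproduct of e. The product of the two nilpotent terms contains f² = 0 in the third leg. -/
theorem R_conv_left (hβ : ∀ j, ∑ i, G.α i * β i j = (G.k₁ + G.k₂) j)
    (hsymm : ∀ i j, β i j = β j i) (hxy : D.SuperCommute x y) (hxz : D.SuperCommute x z)
    (hyz : D.SuperCommute y z) (hy : ∀ s, y (G.E s) = NormedSpace.exp (y (G.lin s))) :
    G.R β hxy.conv z = G.R β x z * G.R β y z := by
  have h1 : G.form β hxy.conv z = G.form β x z + G.form β y z := by
    simp only [form, conv_h, add_mul, smul_add, Finset.sum_add_distrib]
  have h2 : z G.f * NormedSpace.exp (G.form β y z) =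
      NormedSpace.exp (G.form β y z) * (y (G.E (G.k₁ + G.k₂)) * z G.f) := by
    rw [f, map_mul, mul_assoc, form_swap hsymm hyz, Y_mul_exp_form hβ hyz.symm hy, ← mul_assoc,
      ← (commute_form_E_left hyz.symm _).exp_left.eq, mul_assoc, ← mul_assoc (z _) (z _),
      ← map_mul z, ← hyz.even_left _ _ (G.parity_E _)]
  have h3 : x G.e * z G.f * NormedSpace.exp (G.form β y z) =
      NormedSpace.exp (G.form β y z) * (x G.e * y (G.E (G.k₁ + G.k₂)) * z G.f) := by
    rw [mul_assoc, h2, ← mul_assoc, ← (commute_form_of_even hxy hxz _).exp_left.eq]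
    simp only [mul_assoc]
  have h4 : x G.e * y (G.E (G.k₁ + G.k₂)) * z G.f * (y G.e * z G.f) = 0 := by
    rw [mul_assoc, ← mul_assoc (z _), hyz.comm_sign G.sign G.parity_e G.parity_f, smul_mul_assoc,
      mul_assoc (y _), ← map_mul, f_f, map_zero, mul_zero, smul_zero, mul_zero]
  rw [R, R, R, h1, exp_add_of_commute_complex (commute_form_form_left hxy hxz hyz), theta, conv_e,
    mul_assoc, mul_assoc]
  congr 1
  simp only [theta, add_mul, mul_add, one_mul, mul_one, smul_add, smul_mul_assoc, mul_smul_comm,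
    ← mul_assoc]
  rw [h3]
  simp only [mul_assoc] at h4 ⊢
  rw [h4]
  simp only [mul_zero, smul_zero, add_zero]
  abel

/-- The same with the roles of e and f exchanged: moving the exponential for x, y past e inserts
E(-(k₁+k₂)), as in the coproduct of f, and the cross term contains e² = 0. -/
theorem R_conv_right (hβ : ∀ j, ∑ i, G.α i * β i j = (G.k₁ + G.k₂) j)
    (hxy : D.SuperCommute x y) (hxz : D.SuperCommute x z)
    (hyz : D.SuperCommute y z) (hy : ∀ s, y (G.E s) = NormedSpace.exp (y (G.lin s))) :
    G.R β x hyz.conv = G.R β x z * G.R β x y := by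
  have h1 : G.form β x hyz.conv = G.form β x z + G.form β x y := by
    simp only [form, conv_h, mul_add, smul_add, Finset.sum_add_distrib]
    exact add_comm _ _
  have h2 : x G.e * NormedSpace.exp (G.form β x y) =
      NormedSpace.exp (G.form β x y) * (x G.e * y (G.E (-(G.k₁ + G.k₂)))) := by
    rw [e, map_mul, mul_assoc, X_mul_exp_form hβ hxy hy, ← mul_assoc,
      ← (commute_form_E_left hxy _).exp_left.eq]
    simp only [mul_assoc]
  have h3 : x G.e * z G.f * NormedSpace.exp (G.form β x y) =
      NormedSpace.exp (G.form β x y) * (x G.e * y (G.E (-(G.k₁ + G.k₂))) * z G.f) := by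
    rw [mul_assoc, ← (commute_form_of_even hxz.symm hyz.symm _).exp_left.eq, ← mul_assoc, h2,
      mul_assoc]
  have h4 : x G.e * y (G.E (-(G.k₁ + G.k₂))) * z G.f * (x G.e * y G.f) = 0 := by
    rw [mul_assoc, ← mul_assoc (z _), hxz.comm_sign G.sign G.parity_e G.parity_f, smul_mul_assoc,
      mul_smul_comm, mul_assoc (x _), ← mul_assoc (y _), ← mul_assoc (y _), ← hxy.even_right _ _ (G.parity_E _), mul_assoc (x _), mul_assoc (x _),
      ← mul_assoc (x _), ← map_mul, e_e, map_zero, zero_mul, smul_zero]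
  rw [R, R, R, h1, exp_add_of_commute_complex (commute_form_form_right hxy hxz hyz), theta, conv_f,
    mul_assoc, mul_assoc]
  congr 1
  simp only [theta, add_mul, mul_add, one_mul, mul_one, smul_add, smul_mul_assoc, mul_smul_comm,
    ← mul_assoc]
  rw [h3]
  simp only [mul_assoc] at h4 ⊢
  rw [h4]
  simp only [mul_zero, smul_zero, add_zero]
  abel

end Banach

variable {G} {β : ι → ι → ℂ}

/-- Symmetry and the contraction condition are all that is asked of β. Any symmetric change of β
that contracts to zero with α gives another R-matrix. -/
theorem isUniversalR (hsymm : ∀ i j, β i j = β j i)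
    (hβ : ∀ j, ∑ i, G.α i * β i j = (G.k₁ + G.k₂) j) :
    D.IsUniversalR G.IsPoint (fun _ _ _ _ x y _ => G.R β x y) where
  natural B B' _ _ _ _ _ _ f x y h hf _ _ := by
    simp only [R, map_mul, map_exp_complex f hf, form, theta, map_sum, map_smul, map_add, map_one,
      AlgHom.comp_apply]
  even B _ _ _ x y h _ _ := by
    -- The R-matrix is even because e and f occur together and ε² = 1.
    have h1 : (G.ε • x G.e) * (G.ε • y G.f) = x G.e * y G.f := by
      rw [smul_mul_smul_comm, G.ε_mul_ε, one_smul]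
    simp only [R, form, theta, AlgHom.comp_apply, G.parity_h, parity_e, parity_f, map_smul, h1]
  isUnit B _ _ _ x y h _ _ := (isUnit_exp_complex _).mul (isUnit_theta h)
  intertwine B _ _ _ x y h hx hy := R_intertwine hsymm hβ h hx.exp_lin hy.exp_lin
  comul_left B _ _ _ x y z hxy hxz hyz _ hy _ := R_conv_left hβ hsymm hxy hxz hyz hy.exp_lin
  comul_right B _ _ _ x y z hxy hxz hyz _ hy _ := R_conv_right hβ hxy hxz hyz hy.exp_lin

end SuperHopfAlgebra.RootDatum

/-! ### Elements of Banach algebras with `exp (2πi a) = 1` -/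

section IntegerSpectrum

variable {B : Type*} [NormedRing B] [NormedAlgebra ℂ B]

theorem exp_algebraMap_complex (z : ℂ) :
    NormedSpace.exp (z • (1 : B)) = Complex.exp z • (1 : B) := by
  rw [← Algebra.algebraMap_eq_smul_one, ← Algebra.algebraMap_eq_smul_one, Complex.exp_eq_exp_ℂ]
  exact (NormedSpace.algebraMap_exp_comm (𝕂 := ℂ) z).symm

variable [CompleteSpace B]

theorem exp_add_smul_one (a : B) (z : ℂ) :
    NormedSpace.exp (a + z • 1) = Complex.exp z • NormedSpace.exp a := by
  rw [exp_add_of_commute_complex ((Commute.one_right a).smul_right z), exp_algebraMap_complex,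
    mul_smul_comm, mul_one]

/-- The eigenvector equation says that `e` intertwines the scalar z with a. -/
theorem exp_mul_of_mul_eq_smul {a e : B} {z : ℂ} (h : a * e = z • e) :
    NormedSpace.exp a * e = Complex.exp z • e := by
  rw [← exp_mul_eq_of_mul_eq (x := e) (a := z • 1) (by rw [mul_smul_comm, mul_one, h]),
    exp_algebraMap_complex, mul_smul_comm, mul_one]

/-- The `n`-th Fourier coefficient of `t ↦ exp (2πi t a)`. -/
def fourierProjection (a : B) (n : ℤ) : B :=
  ∫ t : ℝ in (0 : ℝ)..1, NormedSpace.exp (t • ((2 * Real.pi * Complex.I) • (a + (-n : ℂ) • (1 : B))))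

/-- With b = 2πi(a - n), the fundamental theorem of calculus gives b ∫₀¹ e^{tb} dt = e^b - 1. This
vanishes, because e^{2πia} = 1 and n is an integer. -/
theorem mul_fourierProjection {a : B}
    (ha : NormedSpace.exp ((2 * Real.pi * Complex.I) • a) = 1) (n : ℤ) :
    a * fourierProjection a n = (n : ℂ) • fourierProjection a n := by
  set b := (2 * Real.pi * Complex.I) • (a + (-n : ℂ) • (1 : B)) with hb
  have hexp : NormedSpace.exp b = 1 := by
    rw [hb, smul_add, smul_smul, exp_add_smul_one, ha,
      show 2 * Real.pi * Complex.I * (-n : ℂ) = ((-n : ℤ) : ℂ) * (2 * Real.pi * Complex.I) by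
        push_cast; ring, Complex.exp_int_mul_two_pi_mul_I, one_smul]
  have hd (t : ℝ) : HasDerivAt (fun u : ℝ => NormedSpace.exp (u • b))
      (b * NormedSpace.exp (t • b)) t := hasDerivAt_exp_smul_const' b t
  have hc : Continuous fun u : ℝ => NormedSpace.exp (u • b) :=
    continuous_iff_continuousAt.2 fun t => (hd t).continuousAt
  have h0 : b * fourierProjection a n = 0 := by
    have h1 := intervalIntegral.integral_eq_sub_of_hasDerivAt (a := 0) (b := 1) (fun t _ => hd t)
      ((continuous_const.mul hc).intervalIntegrable _ _)
    rw [one_smul, zero_smul, hexp, NormedSpace.exp_zero, sub_self] at h1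
    rw [← h1]
    exact ((ContinuousLinearMap.mul ℝ B b).intervalIntegral_comp_comm
      (hc.intervalIntegrable _ _)).symm
  rw [hb, smul_mul_assoc, smul_eq_zero_iff_right Complex.two_pi_I_ne_zero, add_mul,
    smul_mul_assoc, one_mul, neg_smul, ← sub_eq_add_neg, sub_eq_zero] at h0
  exact h0

/-- A nonzero coefficient would satisfy an eigenvector equation with eigenvalue n, but such
eigenvalues are bounded by the norm of a. -/
theorem fourierProjection_eq_zero {a : B}
    (ha : NormedSpace.exp ((2 * Real.pi * Complex.I) • a) = 1) {n : ℤ} (hn : ‖a‖ < |(n : ℝ)|) :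
    fourierProjection a n = 0 := by
  by_contra h
  have h1 := norm_mul_le a (fourierProjection a n)
  rw [mul_fourierProjection ha, norm_smul, Complex.norm_intCast] at h1
  exact absurd (le_of_mul_le_mul_right h1 (norm_pos_iff.2 h)) (not_le.2 hn)

/-- Continuous functionals separate points, so it is enough to test with one, φ. The function t ↦
φ(e^{2πita}) is continuous and 1-periodic, with Fourier coefficients φ applied to the projections.
Only finitely many are nonzero, so the Fourier series converges pointwise, and its value at 0 is
φ(1). -/
theorem sum_fourierProjection {a : B}
    (ha : NormedSpace.exp ((2 * Real.pi * Complex.I) • a) = 1) {s : Finset ℤ}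
    (hs : ∀ n ∉ s, fourierProjection a n = 0) : ∑ n ∈ s, fourierProjection a n = 1 := by
  have : Fact ((0 : ℝ) < 1) := ⟨zero_lt_one⟩
  set b := (2 * Real.pi * Complex.I) • a with hb
  have hc' (b : B) : Continuous fun u : ℝ => NormedSpace.exp (u • b) :=
    continuous_iff_continuousAt.2 fun t => (hasDerivAt_exp_smul_const b t).continuousAt
  have hper : Function.Periodic (fun u : ℝ => NormedSpace.exp (u • b)) 1 := fun u => by
    beta_reduce
    rw [add_smul, one_smul, exp_add_of_commute_complex ((Commute.refl b).smul_left u), ha, mul_one]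
  rw [SeparatingDual.eq_iff_forall_dual_eq (R := ℂ)]
  intro φ
  let F : C(AddCircle (1 : ℝ), ℂ) := ⟨fun t => φ (hper.lift t),
    φ.continuous.comp (continuous_coinduced_dom.2 (hc' b))⟩
  have hF (t : ℝ) : F t = φ (NormedSpace.exp (t • b)) := rfl
  have hcoeff (n : ℤ) : fourierCoeff F n = φ (fourierProjection a n) := by
    rw [fourierCoeff_eq_intervalIntegral F n 0, fourierProjection,
      ← φ.intervalIntegral_comp_comm ((hc' _).intervalIntegrable _ _)]
    simp only [zero_add, div_one, one_smul]
    refine intervalIntegral.integral_congr fun t _ => ?_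
    simp only [hF, fourier_coe_apply]
    -- The summand -n of the exponent splits off as e^{-2πint}, the Fourier kernel.
    rw [smul_add (2 * Real.pi * Complex.I : ℂ), ← hb, smul_smul, smul_add,
      ← Complex.coe_smul t (_ • (1 : B)), smul_smul, exp_add_smul_one, map_smul]
    congr 2
    push_cast
    ring
  have hsum := has_pointwise_sum_fourier_series_of_summable (f := F)
    (summable_of_ne_finset_zero (s := s) fun n hn => by rw [hcoeff, hs n hn, map_zero]) 0
  have h0 := hsum.unique (hasSum_sum_of_ne_finset_zero (s := s) fun n hn => by
    rw [hcoeff, hs n hn, map_zero, zero_smul])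
  have h1 : F 0 = φ 1 := by
    have h := hF 0
    rwa [zero_smul, NormedSpace.exp_zero] at h
  rw [map_sum, ← h1, h0]
  refine Finset.sum_congr rfl fun n _ => ?_
  rw [hcoeff, fourier_eval_zero, smul_eq_mul, mul_one]

/-- An element with `exp (2πi a) = 1` is diagonalizable with integer eigenvalues. -/
theorem exists_sum_eq_one_of_exp_eq_one {a : B}
    (ha : NormedSpace.exp ((2 * Real.pi * Complex.I) • a) = 1) :
    ∃ (s : Finset ℤ) (e : ℤ → B), (∀ n, a * e n = (n : ℂ) • e n) ∧ ∑ n ∈ s, e n = 1 := by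
  refine ⟨Finset.Icc (-⌈‖a‖⌉) ⌈‖a‖⌉, fourierProjection a, mul_fourierProjection ha,
    sum_fourierProjection ha fun n hn => fourierProjection_eq_zero ha ?_⟩
  rw [Finset.mem_Icc, ← abs_le, not_le, Int.lt_iff_add_one_le] at hn
  have h1 := Int.le_ceil ‖a‖
  have h2 : ((⌈‖a‖⌉ + 1 : ℤ) : ℝ) ≤ ((|n| : ℤ) : ℝ) := Int.cast_le.2 hn
  push_cast at h2
  linarith

/-- As a - b kills e, the exponential of a - b fixes e, and e^a = e^b e^{a-b}. -/
theorem exp_mul_eq_exp_mul {a b e : B} (hab : Commute a b) (h : a * e = b * e) :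
    NormedSpace.exp a * e = NormedSpace.exp b * e := by
  have h1 : NormedSpace.exp (a - b) * e = e := by
    rw [exp_mul_of_mul_eq_smul (z := 0) (by rw [sub_mul, h, sub_self, zero_smul]),
      Complex.exp_zero, one_smul]
  conv_lhs => rw [← add_sub_cancel b a, exp_add_of_commute_complex
    (hab.symm.sub_right (Commute.refl b)), mul_assoc, h1]

theorem exp_zsmul_eq_one {a : B} (ha : NormedSpace.exp a = 1) (k : ℤ) :
    NormedSpace.exp (k • a) = 1 := by
  have h (n : ℕ) : NormedSpace.exp (n • a) = 1 := by
    let _ := NormedAlgebra.restrictScalars ℚ ℂ B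
    rw [NormedSpace.exp_nsmul, ha, one_pow]
  obtain ⟨n, rfl | rfl⟩ := k.eq_nat_or_neg
  · rw [natCast_zsmul, h]
  · have h1 := exp_add_of_commute_complex ((Commute.refl (n • a)).neg_right)
    rwa [add_neg_cancel, NormedSpace.exp_zero, h, one_mul, ← natCast_zsmul, ← neg_zsmul,
      eq_comm] at h1

/-- If `a`, `b` commute and have integer eigenvalues then `(-1)^{ab} = 1 - 2 p_a p_b` where `p_a` is
the projection to the odd eigenvalues of `a`. -/
theorem exp_pi_I_mul_eq {a b : B} (hab : Commute a b)
    (ha : NormedSpace.exp ((2 * Real.pi * Complex.I) • a) = 1)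
    (hb : NormedSpace.exp ((2 * Real.pi * Complex.I) • b) = 1) :
    NormedSpace.exp (-(Real.pi * Complex.I) • (a * b)) = 1 - (2 : ℂ) •
      (((1 / 2 : ℂ) • (1 - NormedSpace.exp ((Real.pi * Complex.I) • a))) *
        ((1 / 2 : ℂ) • (1 - NormedSpace.exp ((Real.pi * Complex.I) • b)))) := by
  -- Only b is diagonalised. The identity is proved after multiplication by each eigenvector e n,
  -- and the sum over n gives it back because these sum to 1.
  obtain ⟨s, e, he, hs⟩ := exists_sum_eq_one_of_exp_eq_one hb
  have hz (k : ℤ) : NormedSpace.exp ((k : ℂ) • (2 * Real.pi * Complex.I) • a) = 1 := by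
    rw [Int.cast_smul_eq_zsmul]
    exact exp_zsmul_eq_one ha k
  have key (n : ℤ) : NormedSpace.exp (-(Real.pi * Complex.I) • (a * b)) * e n =
      (1 - (2 : ℂ) • (((1 / 2 : ℂ) • (1 - NormedSpace.exp ((Real.pi * Complex.I) • a))) *
        ((1 / 2 : ℂ) • (1 - NormedSpace.exp ((Real.pi * Complex.I) • b))))) * e n := by
    -- On the eigenvalue n of b, the product ab acts as na.
    have h1 : NormedSpace.exp (-(Real.pi * Complex.I) • (a * b)) * e n =
        NormedSpace.exp ((-(Real.pi * Complex.I) * n) • a) * e n := by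
      refine exp_mul_eq_exp_mul (((Commute.refl a).mul_left hab.symm).smul_left _ |>.smul_right _) ?_
      rw [smul_mul_assoc, mul_assoc, he, mul_smul_comm, smul_smul, smul_mul_assoc]
    have h2 : NormedSpace.exp ((Real.pi * Complex.I) • b) * e n =
        Complex.exp (n * (Real.pi * Complex.I)) • e n :=
      exp_mul_of_mul_eq_smul (by rw [smul_mul_assoc, he, smul_smul, mul_comm])
    have h3 (u : B) : (1 - (2 : ℂ) • (((1 / 2 : ℂ) • (1 - u)) *
        ((1 / 2 : ℂ) • (1 - NormedSpace.exp ((Real.pi * Complex.I) • b))))) * e n =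
        e n - ((1 / 2 : ℂ) * (1 - Complex.exp (n * (Real.pi * Complex.I)))) • ((1 - u) * e n) := by
      rw [sub_mul, smul_mul_smul_comm, smul_smul, smul_mul_assoc, mul_assoc (1 - u),
        sub_mul 1 (NormedSpace.exp ((Real.pi * Complex.I) • b)), h2, one_mul,
        mul_sub, mul_smul_comm]
      module
    rw [h1, h3]
    -- For n even both sides act as 1. For n = 2k + 1 the left side is e^{-2πi(k+1)a} e^{πia} =
    -- e^{πia}, and on the right p_b acts as 1, leaving 1 - (1 - e^{πia}).
    rcases Int.even_or_odd' n with ⟨k, rfl | rfl⟩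
    · rw [show -(Real.pi * Complex.I) * ((2 * k : ℤ) : ℂ) =
        ((-k : ℤ) : ℂ) * (2 * Real.pi * Complex.I) by push_cast; ring, ← smul_smul, hz,
        show ((2 * k : ℤ) : ℂ) * (Real.pi * Complex.I) = k * (2 * Real.pi * Complex.I) by
          push_cast; ring, Complex.exp_int_mul_two_pi_mul_I, sub_self, mul_zero, zero_smul,
        sub_zero, one_mul]
    · rw [show -(Real.pi * Complex.I) * ((2 * k + 1 : ℤ) : ℂ) =
        ((-(k + 1) : ℤ) : ℂ) * (2 * Real.pi * Complex.I) + Real.pi * Complex.I by push_cast; ring,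
        add_smul, ← smul_smul, exp_add_of_commute_complex
          (((Commute.refl a).smul_left _ |>.smul_left _).smul_right _), hz,
        show ((2 * k + 1 : ℤ) : ℂ) * (Real.pi * Complex.I) =
          k * (2 * Real.pi * Complex.I) + Real.pi * Complex.I by
          push_cast; ring, Complex.exp_add, Complex.exp_int_mul_two_pi_mul_I,
        Complex.exp_pi_mul_I]
      simp only [one_mul, sub_mul]
      module
  have h := Finset.sum_congr (rfl : s = s) fun n _ => key n
  rwa [← Finset.mul_sum, ← Finset.mul_sum, hs, mul_one, mul_one] at h

end IntegerSpectrum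

/-! ### Descent of universal `R`-matrices to quotients -/

namespace SuperHopfAlgebra

variable {A A' : Type*} [Ring A] [Algebra ℂ A] [Ring A'] [Algebra ℂ A']
  {D : SuperHopfAlgebra A} {D' : SuperHopfAlgebra A'} {f : A →ₐ[ℂ] A'}

theorem IsHom.superCommute (hf : D.IsHom D' f) {B : Type*} [Ring B] [Algebra ℂ B]
    {x y : A' →ₐ[ℂ] B} (h : D'.SuperCommute x y) : D.SuperCommute (x.comp f) (y.comp f) where
  even_left a _ ha := h.even_left _ _ ((hf.parity a).symm.trans (congrArg f ha))
  even_right _ b hb := h.even_right _ _ ((hf.parity b).symm.trans (congrArg f hb))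
  odd_odd a b ha hb := h.odd_odd _ _
    ((hf.parity a).symm.trans ((congrArg f ha).trans (map_neg f a)))
    ((hf.parity b).symm.trans ((congrArg f hb).trans (map_neg f b)))

/-- Convolution is defined by the coproduct, which f respects; this lets each identity of an
R-matrix be pulled back along f. -/
theorem IsHom.conv_comp (hf : D.IsHom D' f) {B : Type*} [Ring B] [Algebra ℂ B]
    {x y : A' →ₐ[ℂ] B} (h : D'.SuperCommute x y) : h.conv.comp f = (hf.superCommute h).conv := by
  ext a
  rw [AlgHom.comp_apply, h.conv_apply, (hf.superCommute h).conv_apply, ← hf.comul]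
  induction D.comul a with
  | zero => simp
  | add s t hs ht => simp only [map_add, hs, ht]
  | tmul a b => simp

/-- A pair family also takes a proof about its two arguments, so these cannot be rewritten directly.
-/
theorem PairFamily.congr (R : D.PairFamily) {B : Type} [NormedRing B] [NormedAlgebra ℂ B]
    [CompleteSpace B] {x x' y y' : A →ₐ[ℂ] B} (hx : x = x') (hy : y = y') (h : D.SuperCommute x y)
    (h' : D.SuperCommute x' y') : R B x y h = R B x' y' h' := by
  subst hx hy; rfl

/-- A universal `R`-matrix descends along a surjective homomorphism. -/
theorem IsUniversalR.of_isHom (hf : D.IsHom D' f) (hsurj : Function.Surjective f)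
    {P : PointClass A} {R : D.PairFamily} (hR : D.IsUniversalR P R) :
    D'.IsUniversalR (fun B _ _ _ x => P B (x.comp f))
      (fun B _ _ _ x y h => R B (x.comp f) (y.comp f) (hf.superCommute h)) where
  natural B B' _ _ _ _ _ _ φ x y h hφ hx hy :=
    hR.natural B B' φ _ _ (hf.superCommute h) hφ hx hy
  even B _ _ _ x y h hx hy := by
    have hp (x : A' →ₐ[ℂ] B) : (x.comp D'.parity).comp f = (x.comp f).comp D.parity := by
      ext a; simp [hf.parity]
    rw [← hR.even B _ _ (hf.superCommute h) hx hy]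
    exact PairFamily.congr R (hp x) (hp y) _ _
  isUnit B _ _ _ x y h hx hy := hR.isUnit B _ _ _ hx hy
  intertwine B _ _ _ x y h hx hy a := by
    -- The only use of surjectivity: the intertwining property quantifies over all elements of the
    -- target.
    obtain ⟨a, rfl⟩ := hsurj a
    have h1 := DFunLike.congr_fun (hf.conv_comp h) a
    have h2 := DFunLike.congr_fun (hf.conv_comp h.symm) a
    rw [AlgHom.comp_apply] at h1 h2
    rw [h1, h2]
    exact hR.intertwine B _ _ (hf.superCommute h) hx hy a
  comul_left B _ _ _ x y z hxy hxz hyz hx hy hz := by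
    rw [← hR.comul_left B _ _ _ (hf.superCommute hxy) (hf.superCommute hxz) (hf.superCommute hyz)
      hx hy hz]
    exact PairFamily.congr R (hf.conv_comp hxy) rfl _ _
  comul_right B _ _ _ x y z hxy hxz hyz hx hy hz := by
    rw [← hR.comul_right B _ _ _ (hf.superCommute hxy) (hf.superCommute hxz) (hf.superCommute hyz)
      hx hy hz]
    exact PairFamily.congr R rfl (hf.conv_comp hyz) _ _

end SuperHopfAlgebra

/-! ### The universal `R`-matrix of `U_q gl(1|1)` -/

namespace Gl

variable {ℏ : ℂ}

theorem adjoin_gen : Algebra.adjoin ℂ (Set.range ![C ℏ, N ℏ] ∪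
    Set.range (fun s : Fin 2 → ℂ => E ℏ (s 0) (s 1)) ∪ {eta ℏ, etaP ℏ}) = ⊤ := by
  rw [eq_top_iff]
  rintro a -
  refine induction (P := fun a => a ∈ Algebra.adjoin ℂ _) (fun c => Subalgebra.algebraMap_mem _ c)
    (gen_cases ?_ ?_ ?_ ?_ fun c n => ?_)
    (fun _ _ => mul_mem) (fun _ _ => add_mem) a <;>
  refine Algebra.subset_adjoin ?_
  · exact .inl (.inl ⟨0, rfl⟩)
  · exact .inl (.inl ⟨1, rfl⟩)
  · exact .inr (.inl rfl)
  · exact .inr (.inr rfl)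
  · exact .inl (.inr ⟨![c, n], rfl⟩)

variable (ℏ) in
/-- The generators of `U_q gl(1|1)` as a root datum. -/
def rootDatum (hq : Complex.exp ℏ ^ 2 ≠ 1) : (superHopf ℏ).RootDatum (Fin 2) where
  h := ![C ℏ, N ℏ]
  E s := E ℏ (s 0) (s 1)
  X := eta ℏ
  Y := etaP ℏ
  -- In the basis C, N: C is central and η lowers N by one. The vectors k₁ and k₂ are those of
  -- q^{C-N} and q^N, read off from the coproducts of η and η⁺.
  α := ![0, -1]
  k₁ := ![ℏ, -ℏ]
  k₂ := ![0, ℏ]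
  ε := -1
  q := Complex.exp ℏ
  sign := .inr rfl
  q_ne_zero := Complex.exp_ne_zero ℏ
  q_sq_ne_one := hq
  parity_h := Fin.forall_fin_two.2 ⟨par_C, par_N⟩
  parity_E _ := par_E _ _
  parity_X := by rw [neg_one_smul]; exact par_eta
  parity_Y := by rw [neg_one_smul]; exact par_etaP
  comul_h := Fin.forall_fin_two.2 ⟨comulHom_C, comulHom_N⟩
  comul_E _ := comulHom_E _ _
  comul_X := by
    refine comulHom_eta.trans ?_
    simp
    rfl
  comul_Y := by
    refine comulHom_etaP.trans ?_
    simp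
    rfl
  h_h := by simp [Fin.forall_fin_two, C_N]
  E_h s := by simp [Fin.forall_fin_two, E_C, E_N]
  h_X := by simp [Fin.forall_fin_two, C_eta, N_eta, sub_eq_add_neg]
  h_Y := by simp [Fin.forall_fin_two, C_etaP, N_etaP]
  E_zero := E_zero
  E_add _ _ := E_add _ _ _ _
  E_X s := by simp [E_eta]
  E_Y s := by simp [E_etaP]
  exp_k₂ := by simp [Complex.exp_neg]
  X_X := eta_eta
  Y_Y := etaP_etaP
  X_Y := by simp [eta_etaP]
  adjoin := adjoin_gen

theorem isUniversalR (hq : Complex.exp ℏ ^ 2 ≠ 1) :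
    (superHopf ℏ).IsUniversalR (Gl.IsPoint ℏ) (fun _ _ _ _ x y _ => Gl.R ℏ x y) := by
  have h := SuperHopfAlgebra.RootDatum.isUniversalR (G := rootDatum ℏ hq)
    -- The form is -ℏ(C ⊗ N + N ⊗ C). Its contraction with α = (0, -1) is (ℏ, 0), the exponent of
    -- q^C, which is k₁ + k₂.
    (β := ![![0, -ℏ], ![-ℏ, 0]]) (by simp [Fin.forall_fin_two])
    (by simp [Fin.forall_fin_two, rootDatum])
  have hP : (rootDatum ℏ hq).IsPoint = Gl.IsPoint ℏ := by
    funext B _ _ _ x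
    refine propext ⟨fun hx c n => ?_, fun hx s => ?_⟩
    · simpa [rootDatum] using hx ![c, n]
    · simpa [rootDatum] using hx (s 0) (s 1)
  rw [hP] at h
  convert h using 1
  funext B _ _ _ x y _
  simp [SuperHopfAlgebra.RootDatum.R, SuperHopfAlgebra.RootDatum.form,
    SuperHopfAlgebra.RootDatum.theta, SuperHopfAlgebra.RootDatum.e,
    SuperHopfAlgebra.RootDatum.f, rootDatum, Gl.R, qpow, add_comm]

end Gl

/-! ### The universal `R`-matrices of `U_q(H₁, H₂, X^±)` -/

namespace Uq

variable {ℏ : ℂ}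

theorem adjoin_gen : Algebra.adjoin ℂ (Set.range ![H1 ℏ, H2 ℏ] ∪
    Set.range (fun s : Fin 2 → ℂ => E ℏ (s 0) (s 1)) ∪ {Xp ℏ, Xm ℏ}) = ⊤ := by
  rw [eq_top_iff]
  rintro a -
  refine induction (P := fun a => a ∈ Algebra.adjoin ℂ _) (fun c => Subalgebra.algebraMap_mem _ c)
    (fun s => Algebra.subset_adjoin ?_) (fun _ _ => mul_mem) (fun _ _ => add_mem) a
  cases s with
  | H1 => exact .inl (.inl ⟨0, rfl⟩)
  | H2 => exact .inl (.inl ⟨1, rfl⟩)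
  | Xp => exact .inr (.inl rfl)
  | Xm => exact .inr (.inr rfl)
  | E z w => exact .inl (.inr ⟨![z, w], rfl⟩)

variable (ℏ) in
/-- The generators of `U_q(H₁, H₂, X^±)` as a root datum. -/
def rootDatum (hq : Complex.exp ℏ ^ 2 ≠ 1) :
    (SuperHopfAlgebra.ofHopf (Uq ℏ)).RootDatum (Fin 2) where
  h := ![H1 ℏ, H2 ℏ]
  E s := E ℏ (s 0) (s 1)
  X := Xp ℏ
  Y := Xm ℏ
  α := ![2, -2]
  k₁ := ![ℏ / 2, 0]
  -- The summand iπ/2 supplies the sign in E(k₂)X = -q⁻¹ X E(k₂), which an even root vector of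
  -- square zero needs here.
  k₂ := ![0, Complex.I * Real.pi / 2 + ℏ / 2]
  ε := 1
  q := Complex.exp ℏ
  sign := .inl rfl
  q_ne_zero := Complex.exp_ne_zero ℏ
  q_sq_ne_one := hq
  parity_h _ := rfl
  parity_E _ := rfl
  parity_X := (one_smul _ _).symm
  parity_Y := (one_smul _ _).symm
  comul_h := Fin.forall_fin_two.2 ⟨comulHom_gen ℏ .H1, comulHom_gen ℏ .H2⟩
  comul_E _ := comulHom_gen ℏ (.E _ _)
  comul_X := by
    refine (comulHom_gen ℏ .Xp).trans ?_
    simp [comulGen, K1, K2inv]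
  comul_Y := by
    refine (comulHom_gen ℏ .Xm).trans ?_
    simp [comulGen, K1inv, K2]
  h_h := by simp [Fin.forall_fin_two, H1_H2]
  E_h s := by simp [Fin.forall_fin_two, E_H1, E_H2]
  h_X := by simp [Fin.forall_fin_two, H1_Xp, H2_Xp]
  h_Y := by simp [Fin.forall_fin_two, H1_Xm, H2_Xm, sub_eq_add_neg]
  E_zero := E_zero ℏ
  E_add _ _ := E_add ℏ _ _ _ _
  E_X s := by
    rw [E_Xp]; congr 2; simp; ring
  E_Y s := by
    rw [E_Xm]; congr 2; simp; ring
  exp_k₂ := by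
    rw [neg_one_mul, ← exp_aux2]; congr 1; simp; ring
  X_X := Xp_Xp ℏ
  Y_Y := Xm_Xm ℏ
  X_Y := by simp [Xp_Xm, K1, K2, K1inv, K2inv, E_add]
  adjoin := adjoin_gen

theorem rootDatum_isPoint (hq : Complex.exp ℏ ^ 2 ≠ 1) :
    (rootDatum ℏ hq).IsPoint = Uq.IsPoint ℏ := by
  funext B _ _ _ x
  refine propext ⟨fun hx c n => ?_, fun hx s => ?_⟩
  · simpa [rootDatum] using hx ![c, n]
  · simpa [rootDatum] using hx (s 0) (s 1)

/-- The two exponentials have commuting exponents and merge into one form, diagonal in H₁, H₂. -/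
theorem R_eq (hq : Complex.exp ℏ ^ 2 ≠ 1) {B : Type} [NormedRing B] [NormedAlgebra ℂ B]
    [CompleteSpace B] {x y : Uq ℏ →ₐ[ℂ] B}
    (h : (SuperHopfAlgebra.ofHopf (Uq ℏ)).SuperCommute x y) :
    Uq.R ℏ x y = (rootDatum ℏ hq).R
      ![![ℏ / 4, 0], ![0, -(ℏ / 4) - Complex.I * Real.pi / 4]] x y := by
  have hc (a b : Uq ℏ) : Commute (x a) (y b) := h.even_left a b rfl
  have h1 : Commute (x (H1 ℏ)) (x (H2 ℏ)) := by rw [Commute, SemiconjBy, ← map_mul, H1_H2, map_mul]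
  have h2 : Commute (y (H1 ℏ)) (y (H2 ℏ)) := by rw [Commute, SemiconjBy, ← map_mul, H1_H2, map_mul]
  have h3 : Commute (x (H2 ℏ) * y (H2 ℏ)) (x (H1 ℏ) * y (H1 ℏ)) :=
    ((h1.symm.mul_right (hc _ _)).mul_left ((hc _ _).symm.mul_right h2.symm))
  rw [Uq.R, ← exp_add_of_commute_complex
    (((h3.sub_right (Commute.refl _)).smul_right _).smul_left _)]
  simp [SuperHopfAlgebra.RootDatum.R, SuperHopfAlgebra.RootDatum.form,
    SuperHopfAlgebra.RootDatum.theta, SuperHopfAlgebra.RootDatum.e,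
    SuperHopfAlgebra.RootDatum.f, rootDatum, K2, K2inv]
  congr 2
  module

theorem isUniversalR (hq : Complex.exp ℏ ^ 2 ≠ 1) :
    (SuperHopfAlgebra.ofHopf (Uq ℏ)).IsUniversalR (Uq.IsPoint ℏ)
      (fun _ _ _ _ x y _ => Uq.R ℏ x y) := by
  have h := SuperHopfAlgebra.RootDatum.isUniversalR (G := rootDatum ℏ hq)
    (β := ![![ℏ / 4, 0], ![0, -(ℏ / 4) - Complex.I * Real.pi / 4]]) (by simp [Fin.forall_fin_two])
    (Fin.forall_fin_two.2 ⟨by simp [rootDatum]; ring, by simp [rootDatum]; ring⟩)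
  rw [rootDatum_isPoint] at h
  convert h using 1
  funext B _ _ _ x y h
  exact R_eq hq h

/-- C = (H₁ + H₂)/2 has weight zero, so subtracting ℏ C ⊗ C from β keeps it symmetric and does not
affect its contraction with α. The general theorem applies to the new β as well. -/
theorem isUniversalR' (hq : Complex.exp ℏ ^ 2 ≠ 1) :
    (SuperHopfAlgebra.ofHopf (Uq ℏ)).IsUniversalR (Uq.IsPoint ℏ)
      (fun _ _ _ _ x y _ => Uq.qCCinv ℏ x y * Uq.R ℏ x y) := by
  have h := SuperHopfAlgebra.RootDatum.isUniversalR (G := rootDatum ℏ hq)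
    (β := ![![0, -(ℏ / 4)], ![-(ℏ / 4), -(ℏ / 2) - Complex.I * Real.pi / 4]])
    (by simp [Fin.forall_fin_two])
    (Fin.forall_fin_two.2 ⟨by simp [rootDatum]; ring, by simp [rootDatum]; ring⟩)
  rw [rootDatum_isPoint] at h
  convert h using 1
  funext B _ _ _ x y h
  have hC : C ℏ = (1 / 2 : ℂ) • (rootDatum ℏ hq).h 0 + (1 / 2 : ℂ) • (rootDatum ℏ hq).h 1 := by
    simp [C, rootDatum]
  have hx : Commute (SuperHopfAlgebra.RootDatum.form (rootDatum ℏ hq)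
      ![![ℏ / 4, 0], ![0, -(ℏ / 4) - Complex.I * Real.pi / 4]] x y) (x (C ℏ)) := by
    rw [hC, map_add, map_smul, map_smul]
    exact ((SuperHopfAlgebra.RootDatum.commute_form_h_left h 0).smul_right _).add_right
      ((SuperHopfAlgebra.RootDatum.commute_form_h_left h 1).smul_right _)
  have hy : Commute (SuperHopfAlgebra.RootDatum.form (rootDatum ℏ hq)
      ![![ℏ / 4, 0], ![0, -(ℏ / 4) - Complex.I * Real.pi / 4]] x y) (y (C ℏ)) := by
    rw [hC, map_add, map_smul, map_smul]
    exact ((SuperHopfAlgebra.RootDatum.commute_form_h_right h 0).smul_right _).add_right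
      ((SuperHopfAlgebra.RootDatum.commute_form_h_right h 1).smul_right _)
  rw [R_eq hq h, SuperHopfAlgebra.RootDatum.R, SuperHopfAlgebra.RootDatum.R, qCCinv, ← mul_assoc,
    ← exp_add_of_commute_complex ((hx.mul_right hy).symm.smul_left _)]
  congr 2
  simp [SuperHopfAlgebra.RootDatum.form, rootDatum, C, mul_add, add_mul]
  module

end Uq

namespace UqQuot

variable {ℏ : ℂ}

theorem isHom_proj : (SuperHopfAlgebra.ofHopf (Uq ℏ)).IsHom
    (SuperHopfAlgebra.ofHopf (UqQuot ℏ)) (proj ℏ) where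
  parity _ := rfl
  comul a := (comulHom_proj ℏ a).symm
  counit a := counitHom_proj ℏ a
  antipode a := (congrArg MulOpposite.unop (antipodeHom_proj ℏ a)).symm

theorem isUniversalR (hq : Complex.exp ℏ ^ 2 ≠ 1) :
    (SuperHopfAlgebra.ofHopf (UqQuot ℏ)).IsUniversalR (UqQuot.IsPoint ℏ) (UqQuot.R ℏ) :=
  .of_isHom isHom_proj (proj_surjective ℏ) (Uq.isUniversalR hq)

theorem isUniversalR' (hq : Complex.exp ℏ ^ 2 ≠ 1) :
    (SuperHopfAlgebra.ofHopf (UqQuot ℏ)).IsUniversalR (UqQuot.IsPoint ℏ) (UqQuot.R' ℏ) :=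
  .of_isHom isHom_proj (proj_surjective ℏ) (Uq.isUniversalR' hq)

end UqQuot

/-! ### Constructions with super-Hopf algebras -/

theorem map_superMul {A A' : Type*} [Ring A] [Algebra ℂ A] [Ring A'] [Algebra ℂ A']
    {σ : A →ₐ[ℂ] A} {σ' : A' →ₐ[ℂ] A'} (f : A →ₐ[ℂ] A') (hf : ∀ a, f (σ a) = σ' (f a))
    (s t : A ⊗[ℂ] A) : TensorProduct.map f.toLinearMap f.toLinearMap (superMul σ s t) =
      superMul σ' (TensorProduct.map f.toLinearMap f.toLinearMap s)
        (TensorProduct.map f.toLinearMap f.toLinearMap t) := by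
  induction s with
  | zero => simp [superMul_zero_left]
  | add s s' hs hs' => simp only [superMul_add_left, map_add, hs, hs']
  | tmul a b =>
    induction t with
    | zero => simp [superMul_zero_right]
    | add t t' hs hs' => simp only [superMul_add_right, map_add, hs, hs']
    | tmul c d => simp [superMul_tmul, hf]

namespace SuperHopfAlgebra

variable {A A' : Type*} [Ring A] [Algebra ℂ A] [Ring A'] [Algebra ℂ A']

/-- A homomorphism compatible with the parity, the coproduct and the counit is compatible with the
antipode. -/
theorem IsHom.of_bialgebra {D : SuperHopfAlgebra A} {D' : SuperHopfAlgebra A'} {f : A →ₐ[ℂ] A'}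
    (parity : ∀ a, f (D.parity a) = D'.parity (f a))
    (comul : ∀ a, TensorProduct.map f.toLinearMap f.toLinearMap (D.comul a) = D'.comul (f a))
    (counit : ∀ a, D'.counit (f a) = D.counit a) : D.IsHom D' f where
  parity := parity
  comul := comul
  counit := counit
  antipode a := by
    let L : A →ₗ[ℂ] A' := f.toLinearMap ∘ₗ D.antipode
    let M : A →ₗ[ℂ] A' := D'.antipode ∘ₗ f.toLinearMap
    -- `L` is a left and `M` a right convolution inverse of f. Applying `T` to the twofold coproduct
    -- computes the triple convolution of L, f and M; coassociativity lets it be bracketed in two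
    -- ways, which give M and L.
    let T : A ⊗[ℂ] (A ⊗[ℂ] A) →ₗ[ℂ] A' :=
      LinearMap.mul' ℂ A' ∘ₗ TensorProduct.map L
        (LinearMap.mul' ℂ A' ∘ₗ TensorProduct.map f.toLinearMap M)
    have hL (t : A ⊗[ℂ] A) : LinearMap.mul' ℂ A' (TensorProduct.map L f.toLinearMap t) =
        f (LinearMap.mul' ℂ A (D.antipode.rTensor A t)) := by
      induction t with
      | zero => simp
      | add s t hs ht => simp only [map_add, hs, ht]
      | tmul a b => simp [L]
    have hM (t : A ⊗[ℂ] A) : LinearMap.mul' ℂ A' (TensorProduct.map f.toLinearMap M t) =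
        LinearMap.mul' ℂ A' (D'.antipode.lTensor A'
          (TensorProduct.map f.toLinearMap f.toLinearMap t)) := by
      induction t with
      | zero => simp
      | add s t hs ht => simp only [map_add, hs, ht]
      | tmul a b => simp [M]
    have h1 (t : A ⊗[ℂ] A) : T (D.comul.lTensor A t) =
        LinearMap.mul' ℂ A' (TensorProduct.map L (Algebra.linearMap ℂ A')
          (D.counit.lTensor A t)) := by
      induction t with
      | zero => simp
      | add s t hs ht => simp only [map_add, hs, ht]
      | tmul a b =>
        simp only [T, LinearMap.comp_apply, LinearMap.lTensor_tmul, TensorProduct.map_tmul, hM,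
          comul, D'.mul_antipode_lTensor, counit, Algebra.linearMap_apply]
    have h2 (t : A ⊗[ℂ] A) : T (TensorProduct.assoc ℂ A A A (D.comul.rTensor A t)) =
        LinearMap.mul' ℂ A' (TensorProduct.map (Algebra.linearMap ℂ A') M
          (D.counit.rTensor A t)) := by
      induction t with
      | zero => simp
      | add s t hs ht => simp only [map_add, hs, ht]
      | tmul a b =>
        have h3 (u : A ⊗[ℂ] A) : T (TensorProduct.assoc ℂ A A A (u ⊗ₜ b)) =
            LinearMap.mul' ℂ A' (TensorProduct.map L f.toLinearMap u) * M b := by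
          induction u with
          | zero => simp
          | add s t hs ht => simp only [map_add, TensorProduct.add_tmul, hs, ht, add_mul]
          | tmul c d => simp [T, mul_assoc]
        rw [LinearMap.rTensor_tmul, h3, hL, D.mul_antipode_rTensor, AlgHom.commutes]
        simp
    have h := h1 (D.comul a)
    rw [← D.coassoc, h2, D.rTensor_counit, D.lTensor_counit] at h
    simpa [L, M] using h.symm

/-- The transport of a super-Hopf algebra structure along an isomorphism of algebras. -/
def transport (D : SuperHopfAlgebra A) (e : A ≃ₐ[ℂ] A') : SuperHopfAlgebra A' :=
  have hc (f : A →ₗ[ℂ] A ⊗[ℂ] A) (t : A ⊗[ℂ] A) :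
      (TensorProduct.map e.toLinearMap e.toLinearMap ∘ₗ f ∘ₗ e.symm.toLinearMap).rTensor A'
        (TensorProduct.map e.toLinearMap e.toLinearMap t) =
      TensorProduct.map (TensorProduct.map e.toLinearMap e.toLinearMap) e.toLinearMap
        (f.rTensor A t) := by
    induction t with
    | zero => simp
    | add s t hs ht => simp only [map_add, hs, ht]
    | tmul a b => simp
  have hc' (f : A →ₗ[ℂ] A ⊗[ℂ] A) (t : A ⊗[ℂ] A) :
      (TensorProduct.map e.toLinearMap e.toLinearMap ∘ₗ f ∘ₗ e.symm.toLinearMap).lTensor A'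
        (TensorProduct.map e.toLinearMap e.toLinearMap t) =
      TensorProduct.map e.toLinearMap (TensorProduct.map e.toLinearMap e.toLinearMap)
        (f.lTensor A t) := by
    induction t with
    | zero => simp
    | add s t hs ht => simp only [map_add, hs, ht]
    | tmul a b => simp
  { parity := ((e : A →ₐ[ℂ] A').comp D.parity).comp (e.symm : A' →ₐ[ℂ] A)
    parity_parity := fun a => by simp [D.parity_parity]
    comul := TensorProduct.map e.toLinearMap e.toLinearMap ∘ₗ D.comul ∘ₗ e.symm.toLinearMap
    counit := D.counit ∘ₗ e.symm.toLinearMap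
    antipode := e.toLinearMap ∘ₗ D.antipode ∘ₗ e.symm.toLinearMap
    comul_parity := fun a => by
      simp only [LinearMap.comp_apply, AlgHom.comp_apply, AlgEquiv.toLinearMap_apply,
        AlgEquiv.coe_toAlgHom, AlgEquiv.symm_apply_apply, D.comul_parity]
      generalize D.comul (e.symm a) = t
      induction t with
      | zero => simp
      | add s t hs ht => simp only [map_add, hs, ht]
      | tmul a b => simp
    counit_parity := fun a => by simp [D.counit_parity]
    antipode_parity := fun a => by simp [D.antipode_parity]
    coassoc := fun a => by
      have h := congrArg (TensorProduct.map e.toLinearMap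
        (TensorProduct.map e.toLinearMap e.toLinearMap)) (D.coassoc (e.symm a))
      rw [LinearMap.comp_apply, LinearMap.comp_apply, hc, hc', AlgEquiv.toLinearMap_apply]
      refine Eq.trans ?_ h
      generalize D.comul.rTensor A (D.comul (e.symm a)) = t
      induction t with
      | zero => simp
      | add s t hs ht => simp only [map_add, hs, ht]
      | tmul u c =>
        induction u with
        | zero => simp
        | add s t hs ht => simp only [map_add, TensorProduct.add_tmul, hs, ht]
        | tmul a b => simp
    rTensor_counit := fun a => by
      have h := congrArg (TensorProduct.map LinearMap.id e.toLinearMap)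
        (D.rTensor_counit (e.symm a))
      rw [TensorProduct.map_tmul, LinearMap.id_apply, AlgEquiv.toLinearMap_apply,
        AlgEquiv.apply_symm_apply] at h
      rw [← h, LinearMap.comp_apply, LinearMap.comp_apply, AlgEquiv.toLinearMap_apply]
      generalize D.comul (e.symm a) = t
      induction t with
      | zero => simp
      | add s t hs ht => simp only [map_add, hs, ht]
      | tmul a b => simp
    lTensor_counit := fun a => by
      have h := congrArg (TensorProduct.map e.toLinearMap LinearMap.id)
        (D.lTensor_counit (e.symm a))
      rw [TensorProduct.map_tmul, LinearMap.id_apply, AlgEquiv.toLinearMap_apply,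
        AlgEquiv.apply_symm_apply] at h
      rw [← h, LinearMap.comp_apply, LinearMap.comp_apply, AlgEquiv.toLinearMap_apply]
      generalize D.comul (e.symm a) = t
      induction t with
      | zero => simp
      | add s t hs ht => simp only [map_add, hs, ht]
      | tmul a b => simp
    counit_one := by simp [D.counit_one]
    counit_mul := fun a b => by simp [D.counit_mul]
    comul_one := by simp [D.comul_one, Algebra.TensorProduct.one_def]
    comul_mul := fun a b => by
      simp only [LinearMap.comp_apply, AlgEquiv.toLinearMap_apply, map_mul, D.comul_mul]
      exact map_superMul (e : A →ₐ[ℂ] A') (fun a => by simp) _ _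
    mul_antipode_rTensor := fun a => by
      have h := congrArg e (D.mul_antipode_rTensor (e.symm a))
      rw [AlgEquiv.commutes] at h
      refine Eq.trans ?_ h
      simp only [LinearMap.comp_apply, AlgEquiv.toLinearMap_apply]
      generalize D.comul (e.symm a) = t
      induction t with
      | zero => simp
      | add s t hs ht => simp only [map_add, hs, ht]
      | tmul a b => simp
    mul_antipode_lTensor := fun a => by
      have h := congrArg e (D.mul_antipode_lTensor (e.symm a))
      rw [AlgEquiv.commutes] at h
      refine Eq.trans ?_ h
      simp only [LinearMap.comp_apply, AlgEquiv.toLinearMap_apply]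
      generalize D.comul (e.symm a) = t
      induction t with
      | zero => simp
      | add s t hs ht => simp only [map_add, hs, ht]
      | tmul a b => simp }

theorem isHom_transport (D : SuperHopfAlgebra A) (e : A ≃ₐ[ℂ] A') :
    D.IsHom (D.transport e) (e : A →ₐ[ℂ] A') where
  parity a := by simp [transport]
  comul a := by
    simp only [transport, LinearMap.comp_apply, AlgEquiv.toLinearMap_apply, AlgEquiv.coe_toAlgHom,
      AlgEquiv.symm_apply_apply]
    rfl
  counit a := by simp [transport]
  antipode a := by simp [transport]

end SuperHopfAlgebra

/-! ### The isomorphism between the quotients -/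

namespace Uq

variable {ℏ : ℂ}

/-- Homomorphisms from `U_q(H₁, H₂, X^±)`. -/
def lift {B : Type*} [Semiring B] [Algebra ℂ B] (f : UqGen → B)
    (hf : ∀ ⦃a b⦄, UqRel ℏ a b → FreeAlgebra.lift ℂ f a = FreeAlgebra.lift ℂ f b) : Uq ℏ →ₐ[ℂ] B :=
  RingQuot.liftAlgHom ℂ ⟨FreeAlgebra.lift ℂ f, hf⟩

theorem lift_gen {B : Type*} [Semiring B] [Algebra ℂ B] (f : UqGen → B)
    (hf : ∀ ⦃a b⦄, UqRel ℏ a b → FreeAlgebra.lift ℂ f a = FreeAlgebra.lift ℂ f b) (s : UqGen) :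
    lift f hf (gen ℏ s) = f s :=
  (RingQuot.liftAlgHom_mkAlgHom_apply ℂ _ hf _).trans (FreeAlgebra.lift_ι_apply _ _)

theorem Xp_g : Xp ℏ * g ℏ = -(g ℏ * Xp ℏ) := by
  rw [g, E_Xp, show 2 * (0 - Complex.I * Real.pi / 2) = -(Real.pi * Complex.I) by ring,
    Complex.exp_neg, Complex.exp_pi_mul_I]
  simp

theorem Xm_g : Xm ℏ * g ℏ = -(g ℏ * Xm ℏ) := by
  rw [g, E_Xm, show -(2 * (0 - Complex.I * Real.pi / 2)) = Real.pi * Complex.I by ring,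
    Complex.exp_pi_mul_I]
  simp

end Uq

namespace UqQuot

variable {ℏ : ℂ}

/-- As g² = e^{iπH₂}, the coefficient of H₂ in an exponential matters in the quotient only modulo
πi. -/
theorem proj_E_add (z w : ℂ) :
    proj ℏ (Uq.E ℏ z (w + Real.pi * Complex.I)) = proj ℏ (Uq.E ℏ z w) := by
  have h : Uq.E ℏ z (w + Real.pi * Complex.I) = Uq.E ℏ z w * (Uq.g ℏ * Uq.g ℏ) := by
    rw [Uq.g, Uq.E_add, Uq.E_add]; congr 1 <;> ring
  have h2 := g_mul_g ℏ
  rw [g, ← map_mul] at h2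
  rw [h, map_mul, h2, mul_one]

end UqQuot

namespace GlQuot

variable {ℏ : ℂ}

theorem proj_surjective : Function.Surjective (proj ℏ) := RingQuot.mkAlgHom_surjective ℂ _

theorem proj_E_two_pi : proj ℏ (Gl.E ℏ 0 (2 * Real.pi * Complex.I)) = 1 := by
  rw [← map_one (proj ℏ)]
  exact RingQuot.mkAlgHom_rel ℂ ⟨rfl, rfl⟩

theorem proj_E_add (c n : ℂ) :
    proj ℏ (Gl.E ℏ c (n + 2 * Real.pi * Complex.I)) = proj ℏ (Gl.E ℏ c n) := by
  rw [← mul_one (proj ℏ (Gl.E ℏ c n)), ← proj_E_two_pi, ← map_mul, Gl.E_add, add_zero]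

/-- Homomorphisms on the quotient. -/
def lift {B : Type*} [Semiring B] [Algebra ℂ B] (f : Gl ℏ →ₐ[ℂ] B)
    (hf : f (Gl.E ℏ 0 (2 * Real.pi * Complex.I)) = 1) : GlQuot ℏ →ₐ[ℂ] B :=
  RingQuot.liftAlgHom ℂ ⟨f, by rintro a b ⟨rfl, rfl⟩; rw [hf, map_one]⟩

theorem lift_proj {B : Type*} [Semiring B] [Algebra ℂ B] (f : Gl ℏ →ₐ[ℂ] B)
    (hf : f (Gl.E ℏ 0 (2 * Real.pi * Complex.I)) = 1) (a : Gl ℏ) : lift f hf (proj ℏ a) = f a :=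
  RingQuot.liftAlgHom_mkAlgHom_apply ℂ _ _ _

theorem hom_ext {B : Type*} [Semiring B] [Algebra ℂ B] {f f' : GlQuot ℏ →ₐ[ℂ] B}
    (h : ∀ s, f (proj ℏ (Gl.gen ℏ s)) = f' (proj ℏ (Gl.gen ℏ s))) : f = f' :=
  RingQuot.ringQuot_ext' ℂ f f' (Gl.hom_ext h)

end GlQuot

namespace UqQuot

variable {ℏ : ℂ}

section ToGl

open Gl

variable (ℏ) in
/-- The images in `U_q gl(1|1)` of the generators of `U_q(H₁, H₂, X^±)`. -/
def genToGl : UqGen → Gl ℏ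
  | .H1 => (2 : ℂ) • (C ℏ - N ℏ)
  | .H2 => (2 : ℂ) • N ℏ
  | .Xp => eta ℏ
  -- This inverts η⁺ = X⁻g, since g becomes e^{iπN} and is its own inverse in the quotient. The next
  -- line rewrites zH₁ + wH₂ with H₁ = 2(C - N) and H₂ = 2N.
  | .Xm => etaP ℏ * E ℏ 0 (Real.pi * Complex.I)
  | .E z w => E ℏ (2 * z) (2 * w - 2 * z)

/-- Only the commutator of X⁺ and X⁻ needs the relation e^{2πiN} = 1; the other relations already
hold in `Gl ℏ`. -/
theorem toGl_rel ⦃a b : FreeAlgebra ℂ UqGen⦄ (h : UqRel ℏ a b) :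
    FreeAlgebra.lift ℂ (fun s => GlQuot.proj ℏ (genToGl ℏ s)) a =
      FreeAlgebra.lift ℂ (fun s => GlQuot.proj ℏ (genToGl ℏ s)) b := by
  cases h <;> simp only [map_sub, map_mul, map_smul, map_zero, map_one, UqGen.free,
      FreeAlgebra.lift_ι_apply] <;>
    simp only [← map_sub, ← map_mul, ← map_smul, ← map_zero (GlQuot.proj ℏ),
      ← map_one (GlQuot.proj ℏ)]
  case Xp_Xm =>
    -- The factor e^{iπN} anticommutes with η, which turns the commutator into the anticommutator of
    -- η and η⁺. The second exponential is written with -πi + 2πi so that the quotient relation can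
    -- turn e^{iπN} into e^{-iπN}.
    have h1 : genToGl ℏ .Xp * genToGl ℏ .Xm - genToGl ℏ .Xm * genToGl ℏ .Xp =
        (Complex.exp ℏ - (Complex.exp ℏ)⁻¹)⁻¹ • (E ℏ ℏ (Real.pi * Complex.I) -
          E ℏ (-ℏ) (-(Real.pi * Complex.I) + 2 * Real.pi * Complex.I)) := by
      rw [show -(Real.pi * Complex.I) + 2 * Real.pi * Complex.I = Real.pi * Complex.I by ring]
      simp only [genToGl]
      rw [mul_assoc, E_eta, Complex.exp_neg, Complex.exp_pi_mul_I, inv_neg, inv_one, neg_one_smul,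
        mul_neg, sub_neg_eq_add, ← mul_assoc, ← mul_assoc, ← add_mul, eta_etaP, add_assoc,
        neg_add_eq_sub, add_sub_cancel_right, smul_mul_assoc, sub_mul, E_add, E_add]
      simp
    rw [h1, map_smul, map_smul, map_sub, GlQuot.proj_E_add, map_sub]
    simp only [genToGl, E_add]
    congr 3 <;> congr 1 <;> ring_nf
  case E_zero => rw [genToGl, ← E_zero]; congr 2 <;> ring
  case E_add => simp only [genToGl, E_add]; congr 2 <;> ring
  case Xp_Xp => simp only [genToGl, eta_eta]
  case Xm_Xm =>
    simp only [genToGl]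
    rw [mul_assoc, ← mul_assoc (E _ _ _), E_etaP, smul_mul_assoc, mul_smul_comm, mul_assoc,
      ← mul_assoc, etaP_etaP, zero_mul, smul_zero]
  case E_Xp z w =>
    simp only [genToGl, E_eta]; congr 3; ring
  case E_Xm z w =>
    simp only [genToGl]
    rw [← mul_assoc, E_etaP, smul_mul_assoc, mul_assoc, mul_assoc, E_comm]
    congr 3; ring
  all_goals
    congr 1
    simp only [genToGl, smul_mul_assoc, mul_smul_comm, sub_mul, mul_sub, mul_assoc, E_C, E_N]
    try simp only [← mul_assoc, C_eta, C_etaP, N_eta, N_etaP, C_N, add_mul, sub_mul]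
    try module

variable (ℏ) in
/-- The homomorphism from `U_q(H₁, H₂, X^±)` to the quotient of `U_q gl(1|1)`. -/
def uqToGl : Uq ℏ →ₐ[ℂ] GlQuot ℏ := Uq.lift (fun s => GlQuot.proj ℏ (genToGl ℏ s)) toGl_rel

theorem uqToGl_gen (s : UqGen) : uqToGl ℏ (Uq.gen ℏ s) = GlQuot.proj ℏ (genToGl ℏ s) :=
  Uq.lift_gen _ _ s

variable (ℏ) in
/-- The homomorphism between the quotients. -/
def toGl : UqQuot ℏ →ₐ[ℂ] GlQuot ℏ := lift ℏ (uqToGl ℏ) (by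
  rw [map_mul, Uq.g, Uq.E, uqToGl_gen, ← map_mul, genToGl, Gl.E_add,
    ← GlQuot.proj_E_two_pi]
  congr 2 <;> ring)

theorem toGl_gen (s : UqGen) : toGl ℏ (proj ℏ (Uq.gen ℏ s)) = GlQuot.proj ℏ (genToGl ℏ s) :=
  (lift_proj ℏ _ _ _).trans (uqToGl_gen s)

end ToGl

end UqQuot

namespace GlQuot

variable {ℏ : ℂ}

open Uq

variable (ℏ) in
/-- The images in `U_q(H₁, H₂, X^±)` of the generators of `U_q gl(1|1)`. -/
def genToUq : GlGen → Uq ℏ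
  | .C => (1 / 2 : ℂ) • (H1 ℏ + H2 ℏ)
  | .N => (1 / 2 : ℂ) • H2 ℏ
  | .eta => Xp ℏ
  | .etaP => Xm ℏ * g ℏ
  | .E c n => E ℏ (c / 2) ((c + n) / 2)

theorem toUq_rel ⦃a b : FreeAlgebra ℂ GlGen⦄ (h : GlRel ℏ a b) :
    FreeAlgebra.lift ℂ (fun s => UqQuot.proj ℏ (genToUq ℏ s)) a =
      FreeAlgebra.lift ℂ (fun s => UqQuot.proj ℏ (genToUq ℏ s)) b := by
  cases h <;> simp only [map_sub, map_add, map_neg, map_mul, map_smul, map_zero, map_one,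
      GlGen.free, FreeAlgebra.lift_ι_apply] <;>
    simp only [← map_sub, ← map_add, ← map_neg, ← map_mul, ← map_smul,
      ← map_zero (UqQuot.proj ℏ), ← map_one (UqQuot.proj ℏ)]
  case eta_etaP =>
    -- Conversely, g anticommutes with X⁺, so the anticommutator of X⁺ and X⁻g is [X⁺, X⁻]g. The
    -- factor g cancels the e^{-iπH₂/2} of K₂⁻¹, and with that of K₂ it gives e^{iπH₂}, which is 1
    -- in the quotient.
    have h1 : genToUq ℏ .eta * genToUq ℏ .etaP + genToUq ℏ .etaP * genToUq ℏ .eta =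
        (Complex.exp ℏ - (Complex.exp ℏ)⁻¹)⁻¹ • (E ℏ (ℏ / 2) (ℏ / 2 + Real.pi * Complex.I) -
          E ℏ (-(ℏ / 2)) (-(ℏ / 2))) := by
      have h2 : g ℏ * Xp ℏ = -(Xp ℏ * g ℏ) := by rw [Xp_g, neg_neg]
      simp only [genToUq]
      rw [mul_assoc, h2, mul_neg, ← mul_assoc, ← mul_assoc, ← sub_eq_add_neg, ← sub_mul, Xp_Xm,
        add_sub_cancel_left, smul_mul_assoc, sub_mul, K1, K2, K1inv, K2inv, g, E_add, E_add, E_add,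
        E_add]
      congr 3 <;> ring
    rw [h1, map_smul, map_smul, map_sub, UqQuot.proj_E_add, map_sub]
    simp only [genToUq]
    congr 3 <;> congr 1 <;> ring
  case E_zero => rw [genToUq, ← E_zero]; congr 2 <;> ring
  case E_add => simp only [genToUq, E_add]; congr 2 <;> ring
  case eta_eta => simp only [genToUq, Xp_Xp]
  case etaP_etaP =>
    simp only [genToUq]
    rw [mul_assoc, ← mul_assoc (g ℏ), ← neg_neg (g ℏ * Xm ℏ), ← Xm_g, neg_mul, mul_neg, mul_assoc,
      ← mul_assoc, Xm_Xm, zero_mul, neg_zero]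
  case E_eta c n =>
    simp only [genToUq, E_Xp]; congr 3; ring
  case E_etaP c n =>
    simp only [genToUq]
    rw [← mul_assoc, E_Xm, smul_mul_assoc, mul_assoc, mul_assoc, g, E_comm]
    congr 3; ring
  all_goals
    congr 1
    simp only [genToUq, g, smul_mul_assoc, mul_smul_comm, add_mul, mul_add, mul_assoc, E_H1, E_H2]
    try simp only [← mul_assoc, H1_Xp, H2_Xp, H1_Xm, H2_Xm, H1_H2, add_mul, smul_mul_assoc]
    try module

variable (ℏ) in
/-- The homomorphism from `U_q gl(1|1)` to the quotient of `U_q(H₁, H₂, X^±)`. -/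
def glToUq : Gl ℏ →ₐ[ℂ] UqQuot ℏ := Gl.lift (fun s => UqQuot.proj ℏ (genToUq ℏ s)) toUq_rel

theorem glToUq_gen (s : GlGen) : glToUq ℏ (Gl.gen ℏ s) = UqQuot.proj ℏ (genToUq ℏ s) :=
  Gl.lift_gen _ _ s

variable (ℏ) in
/-- The homomorphism between the quotients. -/
def toUq : GlQuot ℏ →ₐ[ℂ] UqQuot ℏ := lift (glToUq ℏ) (by
  rw [Gl.E, glToUq_gen, ← map_one (UqQuot.proj ℏ), ← E_zero, ← UqQuot.proj_E_add, genToUq]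
  congr 2 <;> ring)

theorem toUq_gen (s : GlGen) : toUq ℏ (proj ℏ (Gl.gen ℏ s)) = UqQuot.proj ℏ (genToUq ℏ s) :=
  (lift_proj _ _ _).trans (glToUq_gen s)

end GlQuot

namespace UqQuot

variable {ℏ : ℂ}

theorem toGl_H1 : toGl ℏ (proj ℏ (Uq.H1 ℏ)) =
    (2 : ℂ) • (GlQuot.proj ℏ (Gl.C ℏ) - GlQuot.proj ℏ (Gl.N ℏ)) := by
  rw [← map_sub, ← map_smul]; exact toGl_gen .H1

theorem toGl_H2 : toGl ℏ (proj ℏ (Uq.H2 ℏ)) = (2 : ℂ) • GlQuot.proj ℏ (Gl.N ℏ) := by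
  rw [← map_smul]; exact toGl_gen .H2

theorem toGl_Xp : toGl ℏ (proj ℏ (Uq.Xp ℏ)) = GlQuot.proj ℏ (Gl.eta ℏ) := toGl_gen .Xp

theorem toGl_Xm : toGl ℏ (proj ℏ (Uq.Xm ℏ)) =
    GlQuot.proj ℏ (Gl.etaP ℏ * Gl.E ℏ 0 (Real.pi * Complex.I)) := toGl_gen .Xm

theorem toGl_E (z w : ℂ) : toGl ℏ (proj ℏ (Uq.E ℏ z w)) =
    GlQuot.proj ℏ (Gl.E ℏ (2 * z) (2 * w - 2 * z)) := toGl_gen (.E z w)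

theorem toGl_g : toGl ℏ (g ℏ) = GlQuot.proj ℏ (Gl.E ℏ 0 (Real.pi * Complex.I)) := by
  rw [g, Uq.g, toGl_E]; congr 2 <;> ring

theorem toGl_Xm_g : toGl ℏ (proj ℏ (Uq.Xm ℏ * Uq.g ℏ)) = GlQuot.proj ℏ (Gl.etaP ℏ) := by
  rw [map_mul, map_mul, toGl_Xm, ← g, toGl_g, ← map_mul, mul_assoc, Gl.E_add, map_mul,
    show Real.pi * Complex.I + Real.pi * Complex.I = 2 * Real.pi * Complex.I by ring, add_zero,
    GlQuot.proj_E_two_pi, mul_one]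

variable (ℏ) in
/-- The isomorphism between the quotients of `U_q(H₁, H₂, X^±)` and `U_q gl(1|1)`. -/
def equivGl : UqQuot ℏ ≃ₐ[ℂ] GlQuot ℏ :=
  AlgEquiv.ofAlgHom (toGl ℏ) (GlQuot.toUq ℏ)
    (GlQuot.hom_ext fun s => by
      rw [AlgHom.comp_apply, AlgHom.id_apply, GlQuot.toUq_gen]
      cases s with
      | C =>
        rw [GlQuot.genToUq, map_smul, map_add, map_smul, map_add, toGl_H1, toGl_H2]
        change _ = GlQuot.proj ℏ (Gl.C ℏ)
        module
      | N =>
        rw [GlQuot.genToUq, map_smul, map_smul, toGl_H2]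
        change _ = GlQuot.proj ℏ (Gl.N ℏ)
        module
      | eta => exact toGl_Xp
      | etaP => exact toGl_Xm_g
      | E c n =>
        rw [GlQuot.genToUq, toGl_E]
        change _ = GlQuot.proj ℏ (Gl.E ℏ c n)
        congr 2 <;> ring)
    (hom_ext fun s => by
      have hC : GlQuot.toUq ℏ (GlQuot.proj ℏ (Gl.C ℏ)) = _ := GlQuot.toUq_gen .C
      have hN : GlQuot.toUq ℏ (GlQuot.proj ℏ (Gl.N ℏ)) = _ := GlQuot.toUq_gen .N
      have hP : GlQuot.toUq ℏ (GlQuot.proj ℏ (Gl.etaP ℏ)) = _ := GlQuot.toUq_gen .etaP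
      have hE (c n : ℂ) : GlQuot.toUq ℏ (GlQuot.proj ℏ (Gl.E ℏ c n)) = _ :=
        GlQuot.toUq_gen (.E c n)
      rw [AlgHom.comp_apply, AlgHom.id_apply]
      cases s with
      | H1 =>
        change _ = proj ℏ (Uq.H1 ℏ)
        refine (congrArg _ toGl_H1).trans ?_
        rw [map_smul, map_sub, hC, hN, ← map_sub, ← map_smul, GlQuot.genToUq, GlQuot.genToUq]
        congr 1
        module
      | H2 =>
        change _ = proj ℏ (Uq.H2 ℏ)
        refine (congrArg _ toGl_H2).trans ?_
        rw [map_smul, hN, ← map_smul, GlQuot.genToUq]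
        congr 1
        module
      | Xp => exact (congrArg _ toGl_Xp).trans (GlQuot.toUq_gen .eta)
      | Xm =>
        change _ = proj ℏ (Uq.Xm ℏ)
        refine (congrArg _ toGl_Xm).trans ?_
        have h : GlQuot.genToUq ℏ (.E 0 (Real.pi * Complex.I)) = Uq.g ℏ := by
          rw [GlQuot.genToUq, Uq.g]; congr 1 <;> ring
        have h2 := g_mul_g ℏ
        rw [g] at h2
        rw [map_mul, map_mul, hP, hE, h, GlQuot.genToUq, map_mul, mul_assoc, h2, mul_one]
      | E z w =>
        change _ = proj ℏ (Uq.E ℏ z w)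
        refine (congrArg _ (toGl_E z w)).trans ?_
        rw [hE, GlQuot.genToUq]
        congr 2 <;> ring)

end UqQuot

/-! ### The superized coproduct on generators -/

namespace UqQuot

variable {ℏ : ℂ}

theorem coalgebra_comul_proj (a : Uq ℏ) :
    (CoalgebraStruct.comul (proj ℏ a) : UqQuot ℏ ⊗[ℂ] UqQuot ℏ) =
      Algebra.TensorProduct.map (proj ℏ) (proj ℏ) (CoalgebraStruct.comul a) := comulHom_proj ℏ a

theorem conj_proj_of_mul_g {a : Uq ℏ} (h : a * Uq.g ℏ = Uq.g ℏ * a) :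
    Superization.conj (g ℏ) (g_mul_g ℏ) (proj ℏ a) = proj ℏ a := by
  rw [Superization.conj_apply, mul_assoc, g, ← map_mul, h, map_mul, ← mul_assoc, ← g, g_mul_g,
    one_mul]

theorem conj_proj_of_mul_g_neg {a : Uq ℏ} (h : a * Uq.g ℏ = -(Uq.g ℏ * a)) :
    Superization.conj (g ℏ) (g_mul_g ℏ) (proj ℏ a) = -proj ℏ a := by
  rw [Superization.conj_apply, mul_assoc, g, ← map_mul, h, map_neg, map_mul, mul_neg, ← mul_assoc,
    ← g, g_mul_g, one_mul]

theorem conj_H1 : Superization.conj (g ℏ) (g_mul_g ℏ) (proj ℏ (Uq.H1 ℏ)) = proj ℏ (Uq.H1 ℏ) :=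
  conj_proj_of_mul_g (Uq.E_H1 ℏ _ _).symm

theorem conj_H2 : Superization.conj (g ℏ) (g_mul_g ℏ) (proj ℏ (Uq.H2 ℏ)) = proj ℏ (Uq.H2 ℏ) :=
  conj_proj_of_mul_g (Uq.E_H2 ℏ _ _).symm

theorem conj_E (z w : ℂ) :
    Superization.conj (g ℏ) (g_mul_g ℏ) (proj ℏ (Uq.E ℏ z w)) = proj ℏ (Uq.E ℏ z w) :=
  conj_proj_of_mul_g (Uq.E_comm ℏ _ _ _ _)

theorem conj_Xp : Superization.conj (g ℏ) (g_mul_g ℏ) (proj ℏ (Uq.Xp ℏ)) = -proj ℏ (Uq.Xp ℏ) :=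
  conj_proj_of_mul_g_neg Uq.Xp_g

theorem conj_Xm_g : Superization.conj (g ℏ) (g_mul_g ℏ) (proj ℏ (Uq.Xm ℏ * Uq.g ℏ)) =
    -proj ℏ (Uq.Xm ℏ * Uq.g ℏ) :=
  conj_proj_of_mul_g_neg (by rw [Uq.Xm_g, neg_mul, mul_assoc, Uq.Xm_g])

theorem conj_K2inv_Xm : Superization.conj (g ℏ) (g_mul_g ℏ) (proj ℏ (Uq.K2inv ℏ * Uq.Xm ℏ)) =
    -proj ℏ (Uq.K2inv ℏ * Uq.Xm ℏ) :=
  conj_proj_of_mul_g_neg (by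
    rw [mul_assoc, Uq.Xm_g, mul_neg, ← mul_assoc, ← mul_assoc, Uq.K2inv, Uq.g, Uq.E_comm])

theorem super_comul_H1 : (super ℏ).comul (proj ℏ (Uq.H1 ℏ)) =
    proj ℏ (Uq.H1 ℏ) ⊗ₜ 1 + 1 ⊗ₜ proj ℏ (Uq.H1 ℏ) := by
  have h : (CoalgebraStruct.comul (Uq.H1 ℏ) : Uq ℏ ⊗[ℂ] Uq ℏ) = _ := Uq.comulHom_gen ℏ .H1
  refine (congrArg (Superization.twistLeg _ (g_mul_g ℏ)) (coalgebra_comul_proj _)).trans ?_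
  rw [h, Uq.comulGen, map_add, map_add, Algebra.TensorProduct.map_tmul,
    Algebra.TensorProduct.map_tmul, map_one, Superization.twistLeg_even _ _ (map_one _),
    Superization.twistLeg_even _ _ conj_H1]

theorem super_comul_H2 : (super ℏ).comul (proj ℏ (Uq.H2 ℏ)) =
    proj ℏ (Uq.H2 ℏ) ⊗ₜ 1 + 1 ⊗ₜ proj ℏ (Uq.H2 ℏ) := by
  have h : (CoalgebraStruct.comul (Uq.H2 ℏ) : Uq ℏ ⊗[ℂ] Uq ℏ) = _ := Uq.comulHom_gen ℏ .H2
  refine (congrArg (Superization.twistLeg _ (g_mul_g ℏ)) (coalgebra_comul_proj _)).trans ?_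
  rw [h, Uq.comulGen, map_add, map_add, Algebra.TensorProduct.map_tmul,
    Algebra.TensorProduct.map_tmul, map_one, Superization.twistLeg_even _ _ (map_one _),
    Superization.twistLeg_even _ _ conj_H2]

theorem super_comul_E (z w : ℂ) : (super ℏ).comul (proj ℏ (Uq.E ℏ z w)) =
    proj ℏ (Uq.E ℏ z w) ⊗ₜ proj ℏ (Uq.E ℏ z w) := by
  have h : (CoalgebraStruct.comul (Uq.E ℏ z w) : Uq ℏ ⊗[ℂ] Uq ℏ) = _ := Uq.comulHom_gen ℏ (.E z w)
  refine (congrArg (Superization.twistLeg _ (g_mul_g ℏ)) (coalgebra_comul_proj _)).trans ?_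
  rw [h, Uq.comulGen, Algebra.TensorProduct.map_tmul, Superization.twistLeg_even _ _ (conj_E _ _)]

/-- X⁺ is odd, so superization multiplies K₂⁻¹ by g. This removes the factor e^{-iπH₂/2} and leaves
q^{-H₂/2} = q^{-N}. -/
theorem super_comul_Xp : (super ℏ).comul (proj ℏ (Uq.Xp ℏ)) =
    proj ℏ (Uq.Xp ℏ) ⊗ₜ proj ℏ (Uq.K1 ℏ) +
      proj ℏ (Uq.K2inv ℏ * Uq.g ℏ) ⊗ₜ proj ℏ (Uq.Xp ℏ) := by
  have h : (CoalgebraStruct.comul (Uq.Xp ℏ) : Uq ℏ ⊗[ℂ] Uq ℏ) = _ := Uq.comulHom_gen ℏ .Xp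
  refine (congrArg (Superization.twistLeg _ (g_mul_g ℏ)) (coalgebra_comul_proj _)).trans ?_
  rw [h, Uq.comulGen, map_add, map_add, Algebra.TensorProduct.map_tmul,
    Algebra.TensorProduct.map_tmul, Uq.K1, Superization.twistLeg_even _ _ (conj_E _ _),
    Superization.twistLeg_odd _ _ conj_Xp, g, ← map_mul]

/-- The coproduct of g puts g in both legs. In the second summand the odd right leg brings another
g, and the two cancel; in the first, K₂g equals q^N in the quotient. -/
theorem super_comul_Xm_g : (super ℏ).comul (proj ℏ (Uq.Xm ℏ * Uq.g ℏ)) =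
    proj ℏ (Uq.Xm ℏ * Uq.g ℏ) ⊗ₜ proj ℏ (Uq.K2 ℏ * Uq.g ℏ) +
      proj ℏ (Uq.K1inv ℏ) ⊗ₜ proj ℏ (Uq.Xm ℏ * Uq.g ℏ) := by
  have h : (CoalgebraStruct.comul (Uq.Xm ℏ) : Uq ℏ ⊗[ℂ] Uq ℏ) = _ := Uq.comulHom_gen ℏ .Xm
  have h' : (CoalgebraStruct.comul (Uq.g ℏ) : Uq ℏ ⊗[ℂ] Uq ℏ) = _ := Uq.comulHom_gen ℏ (.E _ _)
  have hK : proj ℏ (Uq.K1inv ℏ * Uq.g ℏ) * g ℏ = proj ℏ (Uq.K1inv ℏ) := by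
    rw [map_mul, mul_assoc, ← g, g_mul_g, mul_one]
  refine (congrArg (Superization.twistLeg _ (g_mul_g ℏ)) (coalgebra_comul_proj _)).trans ?_
  rw [Bialgebra.comul_mul, h, h', Uq.comulGen, Uq.comulGen, ← Uq.g, add_mul,
    Algebra.TensorProduct.tmul_mul_tmul, Algebra.TensorProduct.tmul_mul_tmul, map_add, map_add,
    Algebra.TensorProduct.map_tmul, Algebra.TensorProduct.map_tmul,
    Superization.twistLeg_even _ _ (conj_proj_of_mul_g (by rw [Uq.K2, Uq.g, Uq.E_add, Uq.E_comm])),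
    Superization.twistLeg_odd _ _ conj_Xm_g, hK]

theorem super_counit_proj (a : Uq ℏ) : (super ℏ).counit (proj ℏ a) = Uq.counitHom ℏ a :=
  counitHom_proj ℏ a

end UqQuot

/-! ### The quotient super-Hopf algebra and the projection onto it -/

namespace GlQuot

variable {ℏ : ℂ}

variable (ℏ) in
/-- The super-Hopf algebra structure of the quotient. -/
def superHopf : SuperHopfAlgebra (GlQuot ℏ) := (UqQuot.super ℏ).transport (UqQuot.equivGl ℏ)

theorem isHom_equivGl : (UqQuot.super ℏ).IsHom (superHopf ℏ)
    (UqQuot.equivGl ℏ : UqQuot ℏ →ₐ[ℂ] GlQuot ℏ) := SuperHopfAlgebra.isHom_transport _ _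

theorem toGl_C : UqQuot.toGl ℏ (UqQuot.proj ℏ ((1 / 2 : ℂ) • (Uq.H1 ℏ + Uq.H2 ℏ))) =
    proj ℏ (Gl.C ℏ) := by
  rw [map_smul, map_add, map_smul, map_add, UqQuot.toGl_H1, UqQuot.toGl_H2]
  module

theorem toGl_N : UqQuot.toGl ℏ (UqQuot.proj ℏ ((1 / 2 : ℂ) • Uq.H2 ℏ)) = proj ℏ (Gl.N ℏ) := by
  rw [map_smul, map_smul, UqQuot.toGl_H2]
  module

theorem toGl_E (c n : ℂ) : UqQuot.toGl ℏ (UqQuot.proj ℏ (Uq.E ℏ (c / 2) ((c + n) / 2))) =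
    proj ℏ (Gl.E ℏ c n) := by
  rw [UqQuot.toGl_E]
  congr 2 <;> ring

theorem parity_toGl (a : UqQuot ℏ) : (superHopf ℏ).parity (UqQuot.toGl ℏ a) =
    UqQuot.toGl ℏ (Superization.conj (UqQuot.g ℏ) (UqQuot.g_mul_g ℏ) a) :=
  (isHom_equivGl.parity a).symm

theorem counit_toGl (a : Uq ℏ) : (superHopf ℏ).counit (UqQuot.toGl ℏ (UqQuot.proj ℏ a)) =
    Uq.counitHom ℏ a := (isHom_equivGl.counit _).trans (UqQuot.super_counit_proj a)

theorem comul_toGl (a : UqQuot ℏ) : (superHopf ℏ).comul (UqQuot.toGl ℏ a) =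
    TensorProduct.map (UqQuot.toGl ℏ).toLinearMap (UqQuot.toGl ℏ).toLinearMap
      ((UqQuot.super ℏ).comul a) := (isHom_equivGl.comul a).symm

/-- The structure on the quotient is transported from the superization, so its compatibility with
`Gl.superHopf` is not automatic. It is checked here on generators, and below for the counit and the
coproduct. -/
theorem parity_proj (a : Gl ℏ) :
    proj ℏ ((Gl.superHopf ℏ).parity a) = (superHopf ℏ).parity (proj ℏ a) := by
  refine Gl.hom_ext' (f := (proj ℏ).comp (Gl.superHopf ℏ).parity)
    (f' := (superHopf ℏ).parity.comp (proj ℏ)) ?_ ?_ ?_ ?_ (fun c n => ?_) a <;>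
  simp only [AlgHom.comp_apply]
  · rw [Gl.isStandard_superHopf.parity_C, ← toGl_C, parity_toGl]
    simp only [map_smul, map_add, UqQuot.conj_H1, UqQuot.conj_H2]
  · rw [Gl.isStandard_superHopf.parity_N, ← toGl_N, parity_toGl]
    simp only [map_smul, UqQuot.conj_H2]
  · rw [Gl.isStandard_superHopf.parity_eta, ← UqQuot.toGl_Xp, parity_toGl, UqQuot.conj_Xp, map_neg,
      map_neg, UqQuot.toGl_Xp]
  · rw [Gl.isStandard_superHopf.parity_etaP, ← UqQuot.toGl_Xm_g, parity_toGl, UqQuot.conj_Xm_g,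
      map_neg, map_neg, UqQuot.toGl_Xm_g]
  · rw [Gl.isStandard_superHopf.parity_E, ← toGl_E, parity_toGl, UqQuot.conj_E]

variable (ℏ) in
/-- The counit as a homomorphism of algebras. -/
def counitHom : GlQuot ℏ →ₐ[ℂ] ℂ :=
  AlgHom.ofLinearMap (superHopf ℏ).counit (superHopf ℏ).counit_one (superHopf ℏ).counit_mul

theorem counit_proj (a : Gl ℏ) :
    (superHopf ℏ).counit (proj ℏ a) = (Gl.superHopf ℏ).counit a := by
  refine Gl.hom_ext' (f := (counitHom ℏ).comp (proj ℏ)) (f' := Gl.counitHom ℏ)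
    ?_ ?_ ?_ ?_ (fun c n => ?_) a <;>
  rw [AlgHom.comp_apply] <;>
  refine Eq.trans (AlgHom.ofLinearMap_apply _ _ _ _) ?_
  · rw [← toGl_C, counit_toGl, map_smul, map_add, Uq.H1, Uq.H2, Uq.counitHom_gen, Uq.counitHom_gen,
      Gl.counitHom_C]
    simp [Uq.counitGen]
  · rw [← toGl_N, counit_toGl, map_smul, Uq.H2, Uq.counitHom_gen, Gl.counitHom_N]
    simp [Uq.counitGen]
  · rw [← UqQuot.toGl_Xp, counit_toGl, Uq.Xp, Uq.counitHom_gen, Gl.counitHom_eta]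
    rfl
  · rw [← UqQuot.toGl_Xm_g, counit_toGl, map_mul, Uq.Xm, Uq.counitHom_gen, Gl.counitHom_etaP]
    simp [Uq.counitGen]
  · rw [← toGl_E, counit_toGl, Uq.E, Uq.counitHom_gen, Gl.counitHom_E]
    rfl

/-- The coproducts are multiplicative for `superMul` and not for the ordinary product of the tensor
square, so an induction replaces the extensionality of homomorphisms. -/
theorem comul_proj (a : Gl ℏ) :
    TensorProduct.map (proj ℏ).toLinearMap (proj ℏ).toLinearMap ((Gl.superHopf ℏ).comul a) =
      (superHopf ℏ).comul (proj ℏ a) := by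
  induction a using Gl.induction with
  | hc c =>
    rw [AlgHom.commutes, Algebra.algebraMap_eq_smul_one, Algebra.algebraMap_eq_smul_one, map_smul,
      map_smul, map_smul, SuperHopfAlgebra.comul_one, SuperHopfAlgebra.comul_one]
    simp [Algebra.TensorProduct.one_def]
  | hmul a b ha hb =>
    rw [SuperHopfAlgebra.comul_mul, map_superMul _ parity_proj, ha, hb, map_mul,
      SuperHopfAlgebra.comul_mul]
  | hadd a b ha hb => simp only [map_add, ha, hb]
  | hgen s =>
    have hS := Gl.isStandard_superHopf (ℏ := ℏ)
    refine Gl.gen_cases (P := fun a => TensorProduct.map (proj ℏ).toLinearMap (proj ℏ).toLinearMap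
      ((Gl.superHopf ℏ).comul a) = (superHopf ℏ).comul (proj ℏ a)) ?_ ?_ ?_ ?_ (fun c n => ?_) s
    · rw [hS.comul_C, ← toGl_C, comul_toGl]
      simp only [map_smul, map_add, UqQuot.super_comul_H1, UqQuot.super_comul_H2,
        TensorProduct.map_tmul, AlgHom.toLinearMap_apply, map_one]
      rw [← toGl_C]
      simp only [map_smul, map_add, TensorProduct.add_tmul, TensorProduct.tmul_add,
        TensorProduct.smul_tmul', TensorProduct.tmul_smul, smul_add]
      abel
    · rw [hS.comul_N, ← toGl_N, comul_toGl]
      simp only [map_smul, map_add, UqQuot.super_comul_H2,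
        TensorProduct.map_tmul, AlgHom.toLinearMap_apply, map_one]
      rw [← toGl_N]
      simp only [map_smul, TensorProduct.smul_tmul', TensorProduct.tmul_smul, smul_add]
    · rw [hS.comul_eta, ← UqQuot.toGl_Xp, comul_toGl, UqQuot.super_comul_Xp]
      simp only [map_add, TensorProduct.map_tmul, AlgHom.toLinearMap_apply, UqQuot.toGl_Xp, Uq.K1,
        Uq.K2inv, Uq.g, Uq.E_add, UqQuot.toGl_E, Gl.qpow]
      ring_nf
    · rw [hS.comul_etaP, ← UqQuot.toGl_Xm_g, comul_toGl, UqQuot.super_comul_Xm_g]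
      -- This is the exponent of K₂g: the one of q^N plus 2πi, which the quotient ignores.
      have h : 2 * (Complex.I * Real.pi / 2 + ℏ / 2 + Complex.I * Real.pi / 2) - 2 * (0 + 0) =
        ℏ * 1 + 2 * Real.pi * Complex.I := by ring
      simp only [map_add, TensorProduct.map_tmul, AlgHom.toLinearMap_apply, UqQuot.toGl_Xm_g]
      simp only [Uq.K2, Uq.K1inv, Uq.g, Uq.E_add, UqQuot.toGl_E, Gl.qpow, h, proj_E_add]
      ring_nf
    · rw [hS.comul_E, ← toGl_E, comul_toGl, UqQuot.super_comul_E, TensorProduct.map_tmul,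
        TensorProduct.map_tmul, AlgHom.toLinearMap_apply, AlgHom.toLinearMap_apply, toGl_E]

theorem isHom_proj : (Gl.superHopf ℏ).IsHom (superHopf ℏ) (proj ℏ) :=
  .of_bialgebra parity_proj comul_proj counit_proj

theorem isUniversalR (hq : Complex.exp ℏ ^ 2 ≠ 1) : (superHopf ℏ).IsUniversalR (IsPoint ℏ)
    (fun _ _ _ _ x y _ => Gl.R ℏ (x.comp (proj ℏ)) (y.comp (proj ℏ))) :=
  .of_isHom isHom_proj proj_surjective (Gl.isUniversalR hq)

end GlQuot

/-! ### Superization of the universal `R`-matrices -/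

/-- `1 - 2 p ⊗ p`, `p = (1 - g) / 2`, is an involution. -/
theorem one_sub_two_smul_mul_self {B : Type*} [Ring B] [Algebra ℂ B] {s t : B} (hs : s * s = 1)
    (ht : t * t = 1) (hst : Commute s t) :
    (1 - (2 : ℂ) • ((1 / 2 : ℂ) • (1 - s) * (1 / 2 : ℂ) • (1 - t))) *
      (1 - (2 : ℂ) • ((1 / 2 : ℂ) • (1 - s) * (1 / 2 : ℂ) • (1 - t))) = 1 := by
  have h1 (u : B) (hu : u * u = 1) : (1 / 2 : ℂ) • (1 - u) * (1 / 2 : ℂ) • (1 - u) =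
      (1 / 2 : ℂ) • (1 - u) := by
    rw [smul_mul_smul_comm, sub_mul, mul_sub, mul_sub, hu, one_mul, one_mul, mul_one]
    module
  have h2 : Commute ((1 / 2 : ℂ) • (1 - s)) ((1 / 2 : ℂ) • (1 - t)) :=
    (((Commute.one_left _).sub_left ((Commute.one_right _).sub_right hst)).smul_left _).smul_right _
  set a := (1 / 2 : ℂ) • (1 - s)
  set b := (1 / 2 : ℂ) • (1 - t)
  have h3 : a * b * (a * b) = a * b := by
    rw [h2.symm.mul_mul_mul_comm, h1 s hs, h1 t ht]
  clear_value a b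
  rw [sub_mul, one_mul, mul_sub, mul_one, smul_mul_smul_comm, h3]
  module

namespace Superization

variable {H : Type*} [Ring H] [HopfAlgebra ℂ H] {g : H} (hg : IsGroupLikeElem ℂ g)
  (hg2 : g * g = 1) {B : Type*} [Ring B] [Algebra ℂ B] {x y : H →ₐ[ℂ] B}

theorem twistHom_even (h : (superization g hg hg2).SuperCommute x y) {b : H}
    (hb : conj g hg2 b = b) : twistHom hg hg2 h b = y b := by
  rw [twistHom_apply, P0_even hg2 hb, P1_even hg2 hb, map_zero, mul_zero, add_zero]

theorem twistHom_odd (h : (superization g hg hg2).SuperCommute x y) {b : H}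
    (hb : conj g hg2 b = -b) : twistHom hg hg2 h b = x g * y b := by
  rw [twistHom_apply, P0_odd hg2 hb, P1_odd hg2 hb, map_zero, zero_add]

end Superization

namespace UqQuot

variable {ℏ : ℂ}

/-- The extra g is the one that superization inserts beside the odd second leg K₂⁻¹X⁻. Moving it
past η costs a sign, and its product with the e^{iπN} of K₂ is trivial. -/
theorem toGl_K2_Xp_g : toGl ℏ (proj ℏ (Uq.K2 ℏ * Uq.Xp ℏ)) * toGl ℏ (g ℏ) =
    -GlQuot.proj ℏ (Gl.qpow ℏ 0 1 * Gl.eta ℏ) := by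
  have h : Gl.eta ℏ * Gl.E ℏ 0 (Real.pi * Complex.I) =
      -(Gl.E ℏ 0 (Real.pi * Complex.I) * Gl.eta ℏ) := by
    rw [Gl.E_eta, Complex.exp_neg, Complex.exp_pi_mul_I]; simp
  rw [toGl_g, map_mul, map_mul, Uq.K2, toGl_E, toGl_Xp, ← map_mul, ← map_mul, mul_assoc, h, mul_neg,
    map_neg, ← mul_assoc, Gl.E_add, map_mul, map_mul, Gl.qpow,
    show 2 * (Complex.I * Real.pi / 2 + ℏ / 2) - 2 * 0 + Real.pi * Complex.I =
      ℏ * 1 + 2 * Real.pi * Complex.I by ring, GlQuot.proj_E_add]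
  simp

/-- The factor e^{iπN} in the image of X⁻ cancels that of K₂⁻¹ after passing η⁺. The resulting sign
cancels the one in `toGl_K2_Xp_g`. -/
theorem toGl_K2inv_Xm : toGl ℏ (proj ℏ (Uq.K2inv ℏ * Uq.Xm ℏ)) =
    -GlQuot.proj ℏ (Gl.qpow ℏ 0 (-1) * Gl.etaP ℏ) := by
  have h : Gl.etaP ℏ * Gl.E ℏ 0 (Real.pi * Complex.I) =
      -(Gl.E ℏ 0 (Real.pi * Complex.I) * Gl.etaP ℏ) := by
    rw [Gl.E_etaP, Complex.exp_pi_mul_I]; simp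
  rw [map_mul, map_mul, Uq.K2inv, toGl_E, toGl_Xm, ← map_mul, h, mul_neg, map_neg, ← mul_assoc,
    Gl.E_add, Gl.qpow]
  congr 4 <;> ring

/-- `M` is the value of 1 - 2p ⊗ p contributed by superization. The factor e^{-iπ/4 H₂⊗H₂} takes the
same value at the twisted pair, because N has integer spectrum there, and M² = 1. The two cancel,
and the remaining exponential splits into q^{C⊗C} and the exponential of `Gl.R`. -/
theorem superR_eq {B : Type} [NormedRing B] [NormedAlgebra ℂ B] [CompleteSpace B]
    {x y : GlQuot ℏ →ₐ[ℂ] B}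
    (h : (UqQuot.super ℏ).SuperCommute (x.comp (toGl ℏ)) (y.comp (toGl ℏ)))
    (hx : GlQuot.IsPoint ℏ B x) (hy : GlQuot.IsPoint ℏ B y) :
    superR ℏ (R' ℏ) B _ _ h = Gl.R ℏ (x.comp (GlQuot.proj ℏ)) (y.comp (GlQuot.proj ℏ)) ∧
    superR ℏ (R ℏ) B _ _ h = Gl.qCC ℏ (x.comp (GlQuot.proj ℏ)) (y.comp (GlQuot.proj ℏ)) *
        Gl.R ℏ (x.comp (GlQuot.proj ℏ)) (y.comp (GlQuot.proj ℏ)) := by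
  set t := Superization.twistHom (isGroupLikeElem_g ℏ) (g_mul_g ℏ) h with ht
  set a := x (GlQuot.proj ℏ (Gl.C ℏ)) with ha
  set b := x (GlQuot.proj ℏ (Gl.N ℏ)) with hb
  set c := y (GlQuot.proj ℏ (Gl.C ℏ)) with hc
  set d := y (GlQuot.proj ℏ (Gl.N ℏ)) with hd
  set T := 1 + (1 - Complex.exp ℏ ^ 2) • (x (GlQuot.proj ℏ (Gl.qpow ℏ 0 1 * Gl.eta ℏ)) *
    y (GlQuot.proj ℏ (Gl.qpow ℏ 0 (-1) * Gl.etaP ℏ))) with hT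
  set M := 1 - (2 : ℂ) • ((1 / 2 : ℂ) • (1 - x (toGl ℏ (g ℏ))) *
    (1 / 2 : ℂ) • (1 - y (toGl ℏ (g ℏ)))) with hM
  have hH1 (u : GlQuot ℏ →ₐ[ℂ] B) : u (toGl ℏ (proj ℏ (Uq.H1 ℏ))) = (2 : ℂ) •
      (u (GlQuot.proj ℏ (Gl.C ℏ)) - u (GlQuot.proj ℏ (Gl.N ℏ))) := by
    rw [toGl_H1, map_smul, map_sub]
  have hH2 (u : GlQuot ℏ →ₐ[ℂ] B) : u (toGl ℏ (proj ℏ (Uq.H2 ℏ))) =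
      (2 : ℂ) • u (GlQuot.proj ℏ (Gl.N ℏ)) := by
    rw [toGl_H2, map_smul]
  have hC : proj ℏ (Uq.C ℏ) = (1 / 2 : ℂ) • (proj ℏ (Uq.H1 ℏ) + proj ℏ (Uq.H2 ℏ)) := by
    rw [Uq.C, map_smul, map_add]
  have hCt : toGl ℏ (proj ℏ (Uq.C ℏ)) = GlQuot.proj ℏ (Gl.C ℏ) := GlQuot.toGl_C
  have heven {v : UqQuot ℏ} (hv : Superization.conj (g ℏ) (g_mul_g ℏ) v = v) :
      t v = y (toGl ℏ v) := Superization.twistHom_even (isGroupLikeElem_g ℏ) (g_mul_g ℏ) h hv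
  have hconjC : Superization.conj (g ℏ) (g_mul_g ℏ) (proj ℏ (Uq.C ℏ)) = proj ℏ (Uq.C ℏ) := by
    rw [hC, map_smul, map_add, conj_H1, conj_H2]
  -- the Cartan parts of the two legs commute
  have hN : GlQuot.proj ℏ (Gl.N ℏ) = toGl ℏ (proj ℏ ((1 / 2 : ℂ) • Uq.H2 ℏ)) :=
    GlQuot.toGl_N.symm
  have hconjN : Superization.conj (g ℏ) (g_mul_g ℏ) (proj ℏ ((1 / 2 : ℂ) • Uq.H2 ℏ)) =
      proj ℏ ((1 / 2 : ℂ) • Uq.H2 ℏ) := by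
    rw [map_smul, map_smul, conj_H2]
  have hac : Commute a c := by rw [ha, hc, ← hCt]; exact h.even_left _ _ hconjC
  have had : Commute a d := by rw [ha, hd, ← hCt, hN]; exact h.even_left _ _ hconjC
  have hbc : Commute b c := by rw [hb, hc, ← hCt, hN]; exact h.even_left _ _ hconjN
  have hbd : Commute b d := by rw [hb, hd, hN]; exact h.even_left _ _ hconjN
  have hab : Commute a b := by
    rw [Commute, SemiconjBy, ha, hb, ← map_mul, ← map_mul, Gl.C_N, map_mul, map_mul]
  have hcd : Commute c d := by
    rw [Commute, SemiconjBy, hc, hd, ← map_mul, ← map_mul, Gl.C_N, map_mul, map_mul]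
  -- The products that occur in the exponents commute, so exponentials may be split and reordered.
  have hAC : Commute (a * c) (a * d) :=
    ((Commute.refl a).mul_right had).mul_left (hac.symm.mul_right hcd)
  have hAB : Commute (a * c) (b * c) :=
    (hab.mul_right hac).mul_left (hbc.symm.mul_right (Commute.refl c))
  have hBD : Commute (a * c) (b * d) :=
    (hab.mul_right had).mul_left (hbc.symm.mul_right hcd)
  -- the values of `g`
  have hg (u : GlQuot ℏ →ₐ[ℂ] B) (hu : GlQuot.IsPoint ℏ B u) : u (toGl ℏ (g ℏ)) =
      NormedSpace.exp ((Real.pi * Complex.I) • u (GlQuot.proj ℏ (Gl.N ℏ))) := by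
    have h1 := hu 0 (Real.pi * Complex.I)
    rw [zero_smul, zero_add] at h1
    rw [toGl_g]
    exact h1
  have hexp (u : GlQuot ℏ →ₐ[ℂ] B) (hu : GlQuot.IsPoint ℏ B u) :
      NormedSpace.exp ((2 * Real.pi * Complex.I) • u (GlQuot.proj ℏ (Gl.N ℏ))) = 1 := by
    have h1 := hu 0 (2 * Real.pi * Complex.I)
    rw [zero_smul, zero_add] at h1
    refine h1.symm.trans ?_
    rw [AlgHom.comp_apply, GlQuot.proj_E_two_pi, map_one]
  have hgg (u : GlQuot ℏ →ₐ[ℂ] B) : u (toGl ℏ (g ℏ)) * u (toGl ℏ (g ℏ)) = 1 := by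
    rw [← map_mul, ← map_mul, g_mul_g, map_one, map_one]
  have hMM : M * M = 1 := one_sub_two_smul_mul_self (hgg x) (hgg y)
    (h.even_left _ _ (Superization.conj_self (g_mul_g ℏ)))
  have hMexp : NormedSpace.exp (-(Real.pi * Complex.I) • (b * d)) = M := by
    rw [exp_pi_I_mul_eq hbd (hexp x hx) (hexp y hy), hM, hg x hx, hg y hy]
  have hodd : x (toGl ℏ (proj ℏ (Uq.K2 ℏ * Uq.Xp ℏ))) * t (proj ℏ (Uq.K2inv ℏ * Uq.Xm ℏ)) =
      x (GlQuot.proj ℏ (Gl.qpow ℏ 0 1 * Gl.eta ℏ)) *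
        y (GlQuot.proj ℏ (Gl.qpow ℏ 0 (-1) * Gl.etaP ℏ)) := by
    have h1 : t (proj ℏ (Uq.K2inv ℏ * Uq.Xm ℏ)) =
        x (toGl ℏ (g ℏ)) * y (toGl ℏ (proj ℏ (Uq.K2inv ℏ * Uq.Xm ℏ))) :=
      Superization.twistHom_odd (isGroupLikeElem_g ℏ) (g_mul_g ℏ) h conj_K2inv_Xm
    -- The factor x(g), commuted into the first leg by the twisted homomorphism, meets K₂X⁺; the two
    -- signs cancel.
    rw [h1, ← mul_assoc, ← map_mul, toGl_K2_Xp_g, toGl_K2inv_Xm, map_neg, map_neg, neg_mul_neg]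
  have hR : Uq.R ℏ ((x.comp (toGl ℏ)).comp (proj ℏ)) (t.comp (proj ℏ)) =
      M * NormedSpace.exp (ℏ • (a * c - a * d - b * c)) * T := by
    rw [Uq.R]
    simp only [AlgHom.comp_apply]
    rw [hodd, ← hT, heven conj_H1, heven conj_H2, hH1, hH2, hH1, hH2, ← hMexp]
    have e1 : (-(Complex.I * Real.pi / 4)) • ((2 : ℂ) • b * (2 : ℂ) • d) =
        -(Real.pi * Complex.I) • (b * d) := by
      rw [smul_mul_smul_comm, smul_smul]; congr 1; ring
    -- The quadratic identity (C - N) ⊗ (C - N) - N ⊗ N = C ⊗ C - C ⊗ N - N ⊗ C.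
    have e2 : (ℏ / 4) • ((2 : ℂ) • (a - b) * (2 : ℂ) • (c - d) - (2 : ℂ) • b * (2 : ℂ) • d) =
        ℏ • (a * c - a * d - b * c) := by
      simp only [smul_mul_smul_comm, sub_mul, mul_sub]; module
    rw [← ha, ← hb, ← hc, ← hd, e1, e2]
  have hCC : NormedSpace.exp (ℏ • (a * c - a * d - b * c)) =
      NormedSpace.exp (ℏ • (a * c)) * NormedSpace.exp ((-ℏ) • (a * d + b * c)) := by
    rw [← exp_add_of_commute_complex
      (((hAC.add_right hAB).smul_left _).smul_right _)]
    congr 1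
    module
  have hL : superR ℏ (R ℏ) B _ _ h =
      NormedSpace.exp (ℏ • (a * c)) * (NormedSpace.exp ((-ℏ) • (a * d + b * c)) * T) := by
    have h1 : superR ℏ (R ℏ) B _ _ h =
        M * Uq.R ℏ ((x.comp (toGl ℏ)).comp (proj ℏ)) (t.comp (proj ℏ)) := by
      rw [hM]
      simp only [superR, Superization.universalR, R, map_smul, map_sub, map_one,
        AlgHom.comp_apply, ← ht]
    rw [h1, hR, ← mul_assoc, ← mul_assoc, hMM, one_mul, hCC, mul_assoc]
  refine ⟨?_, hL⟩
  have h1 : superR ℏ (R' ℏ) B _ _ h = M * (NormedSpace.exp ((-ℏ) • (a * c)) *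
      Uq.R ℏ ((x.comp (toGl ℏ)).comp (proj ℏ)) (t.comp (proj ℏ))) := by
    rw [hM]
    simp only [superR, Superization.universalR, R', map_smul, map_sub, map_one,
      AlgHom.comp_apply, ← ht, Uq.qCCinv, hCt, heven hconjC]
    rfl
  -- M is defined through g, but `hMexp` presents it as an exponential in N ⊗ N, which commutes with
  -- C ⊗ C.
  have h2 : Commute M (NormedSpace.exp ((-ℏ) • (a * c))) := by
    rw [← hMexp]
    exact exp_mul_eq_of_mul_eq
      (exp_mul_eq_of_mul_eq ((hBD.smul_left (-ℏ)).smul_right _)).symm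
  have h3 : NormedSpace.exp ((-ℏ) • (a * c)) * NormedSpace.exp (ℏ • (a * c)) = 1 := by
    rw [← exp_add_of_commute_complex (((Commute.refl _).smul_left _).smul_right _), neg_smul,
      neg_add_cancel, NormedSpace.exp_zero]
  rw [h1, hR, hCC, ← mul_assoc, h2.eq, mul_assoc, ← mul_assoc M, ← mul_assoc M, hMM, one_mul,
    mul_assoc, ← mul_assoc, h3, one_mul]
  rfl

end UqQuot

end

/-! ### The main theorem -/

theorem proposition1 (ℏ : ℂ) (hq : Complex.exp ℏ ^ 2 ≠ 1) :
    -- the super-Hopf algebra `U_q gl(1|1)` exists and is super-quasitriangular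
    ∃ D : SuperHopfAlgebra (Gl ℏ), Gl.IsStandard D ∧
      D.IsUniversalR (Gl.IsPoint ℏ) (fun _ _ _ _ x y _ => Gl.R ℏ x y) ∧
    -- and so is its quotient by `e^{2πiN} = 1`
    ∃ D' : SuperHopfAlgebra (GlQuot ℏ), D.IsHom D' (GlQuot.proj ℏ) ∧
      D'.IsUniversalR (GlQuot.IsPoint ℏ)
        (fun _ _ _ _ x y _ => Gl.R ℏ (x.comp (GlQuot.proj ℏ)) (y.comp (GlQuot.proj ℏ))) ∧
    -- the superization of the quotient of `U_q(H₁, H₂, X^±)` is isomorphic to it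
    ∃ φ : UqQuot ℏ ≃ₐ[ℂ] GlQuot ℏ,
      (UqQuot.super ℏ).IsHom D' (φ : UqQuot ℏ →ₐ[ℂ] GlQuot ℏ) ∧
      φ (UqQuot.proj ℏ ((1 / 2 : ℂ) • (Uq.H1 ℏ + Uq.H2 ℏ))) = GlQuot.proj ℏ (Gl.C ℏ) ∧
      φ (UqQuot.proj ℏ ((1 / 2 : ℂ) • Uq.H2 ℏ)) = GlQuot.proj ℏ (Gl.N ℏ) ∧
      φ (UqQuot.proj ℏ (Uq.Xp ℏ)) = GlQuot.proj ℏ (Gl.eta ℏ) ∧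
      φ (UqQuot.proj ℏ (Uq.Xm ℏ * Uq.g ℏ)) = GlQuot.proj ℏ (Gl.etaP ℏ) ∧
      (∀ z w : ℂ, φ (UqQuot.proj ℏ (Uq.E ℏ z w)) =
        GlQuot.proj ℏ (Gl.E ℏ (2 * z) (2 * w - 2 * z))) ∧
    -- `R` and `q^{-C ⊗ C} R` are quasitriangular structures, and these are their superizations
      (SuperHopfAlgebra.ofHopf (UqQuot ℏ)).IsUniversalR (UqQuot.IsPoint ℏ) (UqQuot.R ℏ) ∧
      (SuperHopfAlgebra.ofHopf (UqQuot ℏ)).IsUniversalR (UqQuot.IsPoint ℏ) (UqQuot.R' ℏ) ∧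
      ∀ (B : Type) [NormedRing B] [NormedAlgebra ℂ B] [CompleteSpace B] (x y : GlQuot ℏ →ₐ[ℂ] B)
        (h : (UqQuot.super ℏ).SuperCommute (x.comp (φ : UqQuot ℏ →ₐ[ℂ] GlQuot ℏ))
          (y.comp (φ : UqQuot ℏ →ₐ[ℂ] GlQuot ℏ))),
        GlQuot.IsPoint ℏ B x → GlQuot.IsPoint ℏ B y →
          UqQuot.superR ℏ (UqQuot.R' ℏ) B _ _ h =
            Gl.R ℏ (x.comp (GlQuot.proj ℏ)) (y.comp (GlQuot.proj ℏ)) ∧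
          UqQuot.superR ℏ (UqQuot.R ℏ) B _ _ h =
            Gl.qCC ℏ (x.comp (GlQuot.proj ℏ)) (y.comp (GlQuot.proj ℏ)) *
              Gl.R ℏ (x.comp (GlQuot.proj ℏ)) (y.comp (GlQuot.proj ℏ)) := by
  refine ⟨Gl.superHopf ℏ, Gl.isStandard_superHopf, Gl.isUniversalR hq, GlQuot.superHopf ℏ,
    GlQuot.isHom_proj, GlQuot.isUniversalR hq, UqQuot.equivGl ℏ, GlQuot.isHom_equivGl,
    GlQuot.toGl_C, GlQuot.toGl_N, UqQuot.toGl_Xp, UqQuot.toGl_Xm_g, UqQuot.toGl_E,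
    UqQuot.isUniversalR hq, UqQuot.isUniversalR' hq, ?_⟩
  intro B _ _ _ x y h hx hy
  exact UqQuot.superR_eq h hx hy
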